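/- Let $\mathbf{k}$ be an algebraically closed field of characteristic zero, and for each $t\ge 1$ fix a primitive $t$-th root of unity $\zeta_t\in\mathbf{k}$. Let $\mathbb{G}=\langle \mathbb{g}_1\rangle\times\cdots\times\langle \mathbb{g}_n\rangle=\mathbb{Z}_{\mathbb{m}_1}\times\cdots\times\mathbb{Z}_{\mathbb{m}_n}$ and $G=\langle g_1\rangle\times\cdots\times\langle g_n\rangle=\mathbb{Z}_{\mathbb{m}_1^2}\times\cdots\times\mathbb{Z}_{\mathbb{m}_n^2}$ with $\mathbb{m}_i\ge 1$. Let $\pi:G\to\mathbb{G}$, $g_i\mapsto\mathbb{g}_i$, be the canonical epimorphism and $\iota:\mathbb{G}\to G$, $\prod_i\mathbb{g}_i^{j_i}\mapsto\prod_i g_i^{j_i}$ $(0\le j_i<\mathbb{m}_i)$, its set-theoretic section. Let $\Phi$ be a $3$-cocycle on $\mathbb{G}$ of the form $$\Phi(\mathbb{g}^{i},\mathbb{g}^{j},\mathbb{g}^{k})=\prod_{l}\zeta_{\mathbb{m}_l}^{a_l i_l\left[\frac{j_l+k_l}{\mathbb{m}_l}\right]}\prod_{s<t}\zeta_{\mathbb{m}_t}^{a_{st}i_t\left[\frac{j_s+k_s}{\mathbb{m}_s}\right]}\prod_{r<s<t}\zeta_{(\mathbb{m}_r,\mathbb{m}_s,\mathbb{m}_t)}^{-a_{rst}k_rj_si_t},$$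 where $\mathbb{g}^{i}=\mathbb{g}_1^{i_1}\cdots\mathbb{g}_n^{i_n}$ with $0\le i_l<\mathbb{m}_l$ (likewise for $j,k$), $[x]$ is the integer part of $x$, $(\cdot,\ldots,\cdot)$ in an index is the greatest common divisor, and $0\le a_l<\mathbb{m}_l$, $0\le a_{st}<(\mathbb{m}_s,\mathbb{m}_t)$, $0\le a_{rst}<(\mathbb{m}_r,\mathbb{m}_s,\mathbb{m}_t)$. Assume that $\Phi$ is abelian, i.e. that the twisted quantum double $D^{\Phi}(\mathbb{G})$ is a commutative algebra. For a finite abelian group $H$ and a $3$-cocycle $\Psi$ on $H$, let ${}^H_H\mathcal{YD}^{\Psi}$ be the braided tensor category of left-left Yetter--Drinfeld modules over $(\mathbf{k}H,\Psi)$: $H$-graded spaces $V=\bigoplus_{h}{}^hV$ on which $H$ acts preserving the degree, with $1\triangleright v=v$ and $e\triangleright(f\triangleright v)=\widetilde\Psi_h(e,f)\,(ef)\triangleright v$ for $v\in{}^hV$, where $\widetilde\Psi_h(e,f)=\frac{\Psi(h,e,f)\Psi(e,f,h)}{\Psi(e,h,f)}$. The tensor product has $\deg(u\otimes v)=\deg(u)\deg(v)$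 and $x\triangleright(u_g\otimes v_h)=\widetilde\Psi_x(g,h)(x\triangleright u_g)\otimes(x\triangleright v_h)$, the associativity constraint is $(u_e\otimes v_f)\otimes w_g\mapsto\Psi(e,f,g)^{-1}u_e\otimes(v_f\otimes w_g)$, and the braiding is $u_e\otimes v\mapsto(e\triangleright v)\otimes u_e$. The Nichols algebra $\mathcal{B}(V)$ of $V\in{}^H_H\mathcal{YD}^{\Psi}$ is the quotient of the tensor Hopf algebra $T_\Psi(V)$ in this category (elements of $V$ being primitive) by its unique maximal $\mathbb{N}$-graded Hopf ideal generated by homogeneous elements of degree at least $2$. Let $V$ be a finite-dimensional object of ${}^{\mathbb{G}}_{\mathbb{G}}\mathcal{YD}^{\Phi}$, with coaction $\delta_L$ and action $\triangleright$. Let $\widetilde V\in{}^{G}_{G}\mathcal{YD}^{\pi^*\Phi}$ be the space $V$ with coaction $(\iota\otimes\mathrm{id})\delta_L$ and action $g\blacktriangleright Z=\pi(g)\triangleright Z$, where $\pi^*\Phi(x,y,z)=\Phi(\pi(x),\pi(y),\pi(z))$. Then: 1. $\mathcal{B}(\widetilde V)$ is isomorphic to $\mathcal{B}(V)$: there are canonical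 bases $X_1,\dots,X_l$ of $V$ and $Y_1,\dots,Y_l$ of $\widetilde V$ (bases of homogeneous elements each spanning a line stable under the group action) and a linear isomorphism $\mathcal{B}(V)\to\mathcal{B}(\widetilde V)$ that preserves multiplication and comultiplication and the $\mathbb{Z}^l$-gradings given by $\deg X_i=e_i$ and $\deg Y_i=e_i$, where $e_1,\dots,e_l$ is the standard basis of $\mathbb{Z}^l$. 2. $\mathcal{B}(\widetilde V)$ is twist equivalent to a usual Nichols algebra: there are an object $V'$ of the ordinary (untwisted) category ${}^G_G\mathcal{YD}$ and a map $J:G\times G\to\mathbf{k}^*$ with $J(g,1)=J(1,g)=1$ for all $g\in G$ and $\pi^*\Phi=\partial J$, where $\partial J(e,f,g)=\frac{J(f,g)J(e,fg)}{J(ef,g)J(e,f)}$, such that $\mathcal{B}(\widetilde V)$ is isomorphic, as a Hopf algebra in ${}^G_G\mathcal{YD}^{\pi^*\Phi}$, to the twist $\mathcal{B}(V')^J$. Here $\mathcal{B}(V')^J$ is the graded space $\mathcal{B}(V')$ with the same unit, counit and antipode, and with action $g\triangleright_J X=\frac{J(g,x)}{J(x,g)}\,g\triangleright X$, multiplication $X\circ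 Y=J(x,y)XY$ and comultiplication $X\mapsto J(x_1,x_2)^{-1}X_1\otimes X_2$, for homogeneous elements, whose degrees are denoted by the corresponding lower-case letters. -/

import Mathlib

open scoped TensorProduct DirectSum

universe u v w

noncomputable section

namespace TwistedYD

/-! ## Cochains on a group -/

section Cochains

variable {k : Type u} [Field k] {G : Type v} [CommGroup G]

/-- `Φ̃_g(e, f) = Φ(g, e, f) Φ(e, f, g) / Φ(e, g, f)`. -/
def tilde (Φ : G → G → G → kˣ) (g e f : G) : kˣ :=
  Φ g e f * Φ e f g / Φ e g f

/-- The differential of a `2`-cochain: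
`(∂J)(e, f, g) = J(f, g) J(e, fg) / (J(ef, g) J(e, f))`. -/
def coboundary (J : G → G → kˣ) (e f g : G) : kˣ :=
  J f g * J e (f * g) / (J (e * f) g * J e f)

/-- The pull-back `π^*Φ` of a `3`-cochain along a group morphism `π`. -/
def pullbackCochain {H : Type w} [CommGroup H] (π : H →* G) (Φ : G → G → G → kˣ) :
    H → H → H → kˣ :=
  fun x y z => Φ (π x) (π y) (π z)

/-- The coefficient `θ_g(x, y)` in the multiplication of the twisted quantum double. -/
def theta (Φ : G → G → G → kˣ) (g x y : G) : kˣ :=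
  Φ g x y * Φ x y ((x * y)⁻¹ * g * x * y) / Φ x (x⁻¹ * g * x) y

/-- The multiplication of the twisted quantum double `D^Φ(G)`, on the vector space with basis
`e(g) ⊗ x` (written `(g, x)`):
`(e(g) ⊗ x)(e(h) ⊗ y) = θ_g(x, y) δ_{x⁻¹gx, h} e(g) ⊗ xy`. -/
def doubleMul [DecidableEq G] (Φ : G → G → G → kˣ) :
    (G × G →₀ k) →ₗ[k] (G × G →₀ k) →ₗ[k] (G × G →₀ k) :=
  Finsupp.linearCombination k fun p : G × G =>
    Finsupp.linearCombination k fun q : G × G =>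
      if p.2⁻¹ * p.1 * p.2 = q.1 then
        Finsupp.single (p.1, p.2 * q.2) ((theta Φ p.1 p.2 q.2 : kˣ) : k)
      else 0

/-- A `3`-cocycle `Φ` is abelian if the algebra `D^Φ(G)` is commutative. -/
def IsAbelianCocycle [DecidableEq G] (Φ : G → G → G → kˣ) : Prop :=
  ∀ a b : G × G →₀ k, doubleMul Φ a b = doubleMul Φ b a

end Cochains

/-! ## Graded spaces with operators, and twisted Yetter-Drinfeld modules -/

/-- A vector space with operators `proj g` (the homogeneous components of a coaction
`δ(v) = ∑ g, g ⊗ proj g v`) and `act g` (the maps `v ↦ g ▷ v`), indexed by `G`.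
The axioms are in `IsYD` below. -/
structure YDData (k : Type u) [Field k] (G : Type v) where
  carrier : Type u
  [instAddCommGroup : AddCommGroup carrier]
  [instModule : Module k carrier]
  proj : G → carrier →ₗ[k] carrier
  act : G → carrier →ₗ[k] carrier

attribute [instance] YDData.instAddCommGroup YDData.instModule

section YD

variable {k : Type u} [Field k] {G : Type v} [CommGroup G] [Fintype G] [DecidableEq G]

/-- `A` is a left-left Yetter-Drinfeld module over `(kG, Φ)`: the `proj g` are the projections of
a decomposition `A = ⨁ g, ^gA` (equivalently, of a left `kG`-comodule structure), and `▷` makes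
each `^gA` a projective representation: `e ▷ (f ▷ v) = Φ̃_g(e, f) (ef) ▷ v` for `v ∈ ^gA`. -/
structure IsYD (Φ : G → G → G → kˣ) (A : YDData k G) : Prop where
  proj_proj : ∀ (g h : G) (v : A.carrier),
    A.proj g (A.proj h v) = if g = h then A.proj h v else 0
  sum_proj : ∀ v : A.carrier, ∑ g, A.proj g v = v
  proj_act : ∀ (g x : G) (v : A.carrier), A.proj g (A.act x v) = A.act x (A.proj g v)
  one_act : ∀ v : A.carrier, A.act 1 v = v
  act_act : ∀ (g e f : G) (v : A.carrier), A.proj g v = v →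
    A.act e (A.act f v) = ((tilde Φ g e f : kˣ) : k) • A.act (e * f) v

/-- The objects of the category of left-left Yetter-Drinfeld modules over `(kG, Φ)`. -/
structure YDModule (Φ : G → G → G → kˣ) extends YDData k G where
  isYD : IsYD Φ toYDData

variable (k G) in
/-- The unit object: `k` in degree `1` with the trivial action. -/
def unitObj : YDData k G where
  carrier := k
  proj g := if g = 1 then LinearMap.id else 0
  act _ := LinearMap.id

/-- The tensor product: `deg (m_g ⊗ n_h) = gh` and
`x ▷ (m_g ⊗ n_h) = Φ̃_x(g, h) (x ▷ m_g) ⊗ (x ▷ n_h)`. -/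
def tensorObj (Φ : G → G → G → kˣ) (A B : YDData k G) : YDData k G where
  carrier := A.carrier ⊗[k] B.carrier
  proj x := ∑ g : G, TensorProduct.map (A.proj g) (B.proj (g⁻¹ * x))
  act x := ∑ g : G, ∑ h : G, ((tilde Φ x g h : kˣ) : k) •
    TensorProduct.map (A.act x ∘ₗ A.proj g) (B.act x ∘ₗ B.proj h)

/-- The associativity constraint `(a_e ⊗ b_f) ⊗ c_g ↦ Φ(e, f, g)⁻¹ a_e ⊗ (b_f ⊗ c_g)`. -/
def assocHom (Φ : G → G → G → kˣ) (A B C : YDData k G) :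
    (A.carrier ⊗[k] B.carrier) ⊗[k] C.carrier →ₗ[k]
      A.carrier ⊗[k] (B.carrier ⊗[k] C.carrier) :=
  ∑ e : G, ∑ f : G, ∑ g : G, (((Φ e f g)⁻¹ : kˣ) : k) •
    ((TensorProduct.assoc k A.carrier B.carrier C.carrier).toLinearMap ∘ₗ
      TensorProduct.map (TensorProduct.map (A.proj e) (B.proj f)) (C.proj g))

/-- The inverse constraint `a_e ⊗ (b_f ⊗ c_g) ↦ Φ(e, f, g) (a_e ⊗ b_f) ⊗ c_g`. -/
def assocInv (Φ : G → G → G → kˣ) (A B C : YDData k G) :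
    A.carrier ⊗[k] (B.carrier ⊗[k] C.carrier) →ₗ[k]
      (A.carrier ⊗[k] B.carrier) ⊗[k] C.carrier :=
  ∑ e : G, ∑ f : G, ∑ g : G, ((Φ e f g : kˣ) : k) •
    ((TensorProduct.assoc k A.carrier B.carrier C.carrier).symm.toLinearMap ∘ₗ
      TensorProduct.map (A.proj e) (TensorProduct.map (B.proj f) (C.proj g)))

/-- The braiding `a_e ⊗ b ↦ (e ▷ b) ⊗ a_e`. -/
def braiding (A B : YDData k G) :
    A.carrier ⊗[k] B.carrier →ₗ[k] B.carrier ⊗[k] A.carrier :=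
  ∑ e : G, (TensorProduct.comm k A.carrier B.carrier).toLinearMap ∘ₗ
    TensorProduct.map (A.proj e) (B.act e)

end YD

/-! ## Hopf algebras in the twisted Yetter-Drinfeld category -/

/-- The structure maps of a Hopf algebra in a category of Yetter-Drinfeld modules. -/
structure HopfData (k : Type u) [Field k] (G : Type v) extends YDData k G where
  one : carrier
  mul : carrier →ₗ[k] carrier →ₗ[k] carrier
  comul : carrier →ₗ[k] carrier ⊗[k] carrier
  counit : carrier →ₗ[k] k
  antipode : carrier →ₗ[k] carrier

section Hopf

variable {k : Type u} [Field k] {G : Type v}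

/-- Hopf ideals in the category: subobjects that are two-sided ideals and coideals,
stable under the antipode. -/
structure IsHopfIdeal (A : HopfData k G) (I : Submodule k A.carrier) : Prop where
  proj_mem : ∀ g, ∀ x ∈ I, A.proj g x ∈ I
  act_mem : ∀ g, ∀ x ∈ I, A.act g x ∈ I
  mul_mem_left : ∀ a, ∀ x ∈ I, A.mul a x ∈ I
  mul_mem_right : ∀ a, ∀ x ∈ I, A.mul x a ∈ I
  comul_mem : ∀ x ∈ I, A.comul x ∈
    LinearMap.range (TensorProduct.map I.subtype (LinearMap.id : A.carrier →ₗ[k] A.carrier)) ⊔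
    LinearMap.range (TensorProduct.map (LinearMap.id : A.carrier →ₗ[k] A.carrier) I.subtype)
  counit_eq_zero : ∀ x ∈ I, A.counit x = 0
  antipode_mem : ∀ x ∈ I, A.antipode x ∈ I

theorem IsHopfIdeal.comul_le {A : HopfData k G} {I : Submodule k A.carrier}
    (hI : IsHopfIdeal A I) :
    I ≤ LinearMap.ker (TensorProduct.map I.mkQ I.mkQ ∘ₗ A.comul) := by
  intro x hx
  have h := hI.comul_mem x hx
  have hz : I.mkQ ∘ₗ I.subtype = 0 := by
    ext y
    simp
  rw [LinearMap.mem_ker, LinearMap.comp_apply]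
  rw [← LinearMap.mem_ker]
  refine (sup_le ?_ ?_ : _ ≤ LinearMap.ker (TensorProduct.map I.mkQ I.mkQ)) h
  · rw [LinearMap.range_le_ker_iff, ← TensorProduct.map_comp, hz]
    exact TensorProduct.map_zero_left _
  · rw [LinearMap.range_le_ker_iff, ← TensorProduct.map_comp, hz]
    exact TensorProduct.map_zero_right _

/-- The quotient Hopf algebra `A / I` by a Hopf ideal. -/
def HopfData.quotient (A : HopfData k G) (I : Submodule k A.carrier) (hI : IsHopfIdeal A I) :
    HopfData k G where
  carrier := A.carrier ⧸ I
  proj g := I.mapQ I (A.proj g) (hI.proj_mem g)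
  act g := I.mapQ I (A.act g) (hI.act_mem g)
  one := I.mkQ A.one
  mul := I.liftQ
    (LinearMap.mk₂ k
      (fun a => I.mapQ I (A.mul a) (hI.mul_mem_left a))
      (by intro a b c; induction c using Submodule.Quotient.induction_on; simp)
      (by intro r a c; induction c using Submodule.Quotient.induction_on; simp)
      (by intro a b c; simp)
      (by intro r a c; simp))
    (by
      intro x hx
      rw [LinearMap.mem_ker]
      ext c
      simpa using hI.mul_mem_right c x hx)
  comul := I.liftQ (TensorProduct.map I.mkQ I.mkQ ∘ₗ A.comul) hI.comul_le
  counit := I.liftQ A.counit (fun x hx => hI.counit_eq_zero x hx)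
  antipode := I.mapQ I A.antipode hI.antipode_mem

/-- Isomorphisms of Hopf algebras in a fixed category of Yetter-Drinfeld modules. -/
structure HopfIso (A B : HopfData k G) where
  toEquiv : A.carrier ≃ₗ[k] B.carrier
  map_proj : ∀ g x, toEquiv (A.proj g x) = B.proj g (toEquiv x)
  map_act : ∀ g x, toEquiv (A.act g x) = B.act g (toEquiv x)
  map_one : toEquiv A.one = B.one
  map_mul : ∀ x y, toEquiv (A.mul x y) = B.mul (toEquiv x) (toEquiv y)
  map_comul : ∀ x, TensorProduct.map toEquiv.toLinearMap toEquiv.toLinearMap (A.comul x) =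
    B.comul (toEquiv x)
  map_counit : ∀ x, B.counit (toEquiv x) = A.counit x
  map_antipode : ∀ x, toEquiv (A.antipode x) = B.antipode (toEquiv x)

variable [CommGroup G] [Fintype G] [DecidableEq G]

/-- The twisting `A^J` by a `2`-cochain `J`. The tensor functor `V ↦ V^J` with
`(U ⊗ V)^J → U^J ⊗ V^J`, `Y ⊗ Z ↦ J(y, z)⁻¹ Y ⊗ Z`, transports the structure:
`g ▷_J X = J(g, x) / J(x, g) (g ▷ X)`, `X ∘ Y = J(x, y) XY`,
`Δ^J(X) = J(x₁, x₂)⁻¹ X₁ ⊗ X₂`, on homogeneous elements. -/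
def HopfData.twist (A : HopfData k G) (J : G → G → kˣ) : HopfData k G where
  carrier := A.carrier
  proj := A.proj
  act g := ∑ x : G, ((J g x / J x g : kˣ) : k) • (A.act g ∘ₗ A.proj x)
  one := A.one
  mul := ∑ x : G, ∑ y : G, ((J x y : kˣ) : k) • A.mul.compl₁₂ (A.proj x) (A.proj y)
  comul := ∑ x : G, ∑ y : G, (((J x y)⁻¹ : kˣ) : k) •
    (TensorProduct.map (A.proj x) (A.proj y) ∘ₗ A.comul)
  counit := A.counit
  antipode := A.antipode

/-- The Hopf algebras `A` (over `(kG, Φ)`) and `B` (over `(kG, Ψ)`) are twist equivalent: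
`Ψ = Φ · ∂J` and `A^J ≅ B` for some normalized `2`-cochain `J`. -/
def TwistEquivalent (Φ : G → G → G → kˣ) (A : HopfData k G)
    (Ψ : G → G → G → kˣ) (B : HopfData k G) : Prop :=
  ∃ J : G → G → kˣ, (∀ g, J g 1 = 1 ∧ J 1 g = 1) ∧
    (∀ e f g, Ψ e f g = Φ e f g * coboundary J e f g) ∧
    Nonempty (HopfIso (A.twist J) B)

end Hopf

/-! ## The tensor algebra -/

section TensorAlgebra

variable {k : Type u} [Field k] {G : Type v} [CommGroup G] [Fintype G] [DecidableEq G]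

/-- The left-bracketed tensor powers `(⋯((V ⊗ V) ⊗ V) ⋯ ) ⊗ V`. -/
def tpow (Φ : G → G → G → kˣ) (V : YDData k G) : ℕ → YDData k G
  | 0 => unitObj k G
  | n + 1 => tensorObj Φ (tpow Φ V n) V

/-- The underlying object `⨁ n, V^{⊗ n}` of the tensor algebra. -/
def tensorAlgObj (Φ : G → G → G → kˣ) (V : YDData k G) : YDData k G where
  carrier := ⨁ n, (tpow Φ V n).carrier
  proj g := DirectSum.lmap fun n => (tpow Φ V n).proj g
  act g := DirectSum.lmap fun n => (tpow Φ V n).act g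

/-- The inclusion of the `n`-th tensor power in the tensor algebra. -/
def tIncl (Φ : G → G → G → kˣ) (V : YDData k G) (n : ℕ) :
    (tpow Φ V n).carrier →ₗ[k] (tensorAlgObj Φ V).carrier :=
  DirectSum.lof k ℕ (fun n => (tpow Φ V n).carrier) n

/-- Linear maps out of the tensor algebra, given on each tensor power. -/
def tLift (Φ : G → G → G → kˣ) (V : YDData k G) {M : Type u} [AddCommGroup M] [Module k M]
    (f : ∀ n, (tpow Φ V n).carrier →ₗ[k] M) : (tensorAlgObj Φ V).carrier →ₗ[k] M :=
  DirectSum.toModule k ℕ M f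

/-- The component of degree `n`, as an element of the tensor algebra. -/
def tComp (Φ : G → G → G → kˣ) (V : YDData k G) (n : ℕ) :
    (tensorAlgObj Φ V).carrier →ₗ[k] (tensorAlgObj Φ V).carrier :=
  tIncl Φ V n ∘ₗ DirectSum.component k ℕ (fun n => (tpow Φ V n).carrier) n

/-- The unit of the tensor algebra. -/
def tOne (Φ : G → G → G → kˣ) (V : YDData k G) : (tensorAlgObj Φ V).carrier :=
  tIncl Φ V 0 (1 : k)

/-- The inclusion of `V` as the generating space, of degree `1`. -/
def tGen (Φ : G → G → G → kˣ) (V : YDData k G) :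
    V.carrier →ₗ[k] (tensorAlgObj Φ V).carrier :=
  tIncl Φ V 1 ∘ₗ (TensorProduct.mk k k V.carrier 1)

/-- The multiplication `V^{⊗ n} ⊗ V^{⊗ m} → V^{⊗ (n + m)}`: repeated application of the inverse
associativity constraint `V^{⊗ n} ⊗ (V^{⊗ m} ⊗ V) → (V^{⊗ n} ⊗ V^{⊗ m}) ⊗ V`. -/
def powMul (Φ : G → G → G → kˣ) (V : YDData k G) (n : ℕ) :
    ∀ m : ℕ, (tpow Φ V n).carrier ⊗[k] (tpow Φ V m).carrier →ₗ[k] (tpow Φ V (n + m)).carrier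
  | 0 => (TensorProduct.rid k (tpow Φ V n).carrier).toLinearMap
  | m + 1 => TensorProduct.map (powMul Φ V n m) LinearMap.id ∘ₗ
      assocInv Φ (tpow Φ V n) (tpow Φ V m) V

/-- The multiplication of the tensor algebra. -/
def tMul (Φ : G → G → G → kˣ) (V : YDData k G) :
    (tensorAlgObj Φ V).carrier →ₗ[k] (tensorAlgObj Φ V).carrier →ₗ[k]
      (tensorAlgObj Φ V).carrier :=
  tLift Φ V fun n => (tLift Φ V fun m =>
    (TensorProduct.curry (tIncl Φ V (n + m) ∘ₗ powMul Φ V n m)).flip).flip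

/-- The multiplication on `A ⊗ A` in the braided category, for an object `A` with a
multiplication `mul`: the composite
`(A ⊗ A) ⊗ (A ⊗ A) → A ⊗ (A ⊗ (A ⊗ A)) → A ⊗ ((A ⊗ A) ⊗ A) → A ⊗ ((A ⊗ A) ⊗ A)
→ A ⊗ (A ⊗ (A ⊗ A)) → (A ⊗ A) ⊗ (A ⊗ A) → A ⊗ A`
of associativity constraints, the braiding in the middle, and `mul ⊗ mul`. -/
def tensorSquareMul (Φ : G → G → G → kˣ) (A : YDData k G)
    (mul : A.carrier →ₗ[k] A.carrier →ₗ[k] A.carrier) :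
    (A.carrier ⊗[k] A.carrier) ⊗[k] (A.carrier ⊗[k] A.carrier) →ₗ[k]
      A.carrier ⊗[k] A.carrier :=
  TensorProduct.map (TensorProduct.lift mul) (TensorProduct.lift mul) ∘ₗ
  assocInv Φ A A (tensorObj Φ A A) ∘ₗ
  TensorProduct.map LinearMap.id (assocHom Φ A A A) ∘ₗ
  TensorProduct.map LinearMap.id (TensorProduct.map (braiding A A) LinearMap.id) ∘ₗ
  TensorProduct.map LinearMap.id (assocInv Φ A A A) ∘ₗ
  assocHom Φ A A (tensorObj Φ A A)

/-- The comultiplication on generators, `Δ(X) = X ⊗ 1 + 1 ⊗ X`. -/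
def genComul (Φ : G → G → G → kˣ) (V : YDData k G) :
    V.carrier →ₗ[k] (tensorAlgObj Φ V).carrier ⊗[k] (tensorAlgObj Φ V).carrier :=
  (TensorProduct.mk k (tensorAlgObj Φ V).carrier (tensorAlgObj Φ V).carrier).flip (tOne Φ V) ∘ₗ
      tGen Φ V +
    TensorProduct.mk k (tensorAlgObj Φ V).carrier (tensorAlgObj Φ V).carrier (tOne Φ V) ∘ₗ
      tGen Φ V

/-- The comultiplication on `V^{⊗ n}`: the multiplicative extension of `genComul`, that is
`Δ(1) = 1 ⊗ 1` and `Δ(tX) = Δ(t) Δ(X)` for `X ∈ V`. -/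
def powComul (Φ : G → G → G → kˣ) (V : YDData k G) :
    ∀ n : ℕ, (tpow Φ V n).carrier →ₗ[k]
      (tensorAlgObj Φ V).carrier ⊗[k] (tensorAlgObj Φ V).carrier
  | 0 => LinearMap.toSpanSingleton k _ (tOne Φ V ⊗ₜ[k] tOne Φ V)
  | n + 1 => tensorSquareMul Φ (tensorAlgObj Φ V) (tMul Φ V) ∘ₗ
      TensorProduct.map (powComul Φ V n) (genComul Φ V)

/-- The counit on `V^{⊗ n}`: the identity for `n = 0` and zero otherwise. -/
def powCounit (Φ : G → G → G → kˣ) (V : YDData k G) :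
    ∀ n : ℕ, (tpow Φ V n).carrier →ₗ[k] k
  | 0 => (LinearMap.id : k →ₗ[k] k)
  | _ + 1 => 0

/-- The antipode on `V^{⊗ n}`: the braided anti-multiplicative extension of `X ↦ -X`, that is
`S(1) = 1` and `S(tX) = (mul ∘ braiding) (S(t) ⊗ S(X))` for `X ∈ V`. -/
def powAntipode (Φ : G → G → G → kˣ) (V : YDData k G) :
    ∀ n : ℕ, (tpow Φ V n).carrier →ₗ[k] (tensorAlgObj Φ V).carrier
  | 0 => tIncl Φ V 0
  | n + 1 => TensorProduct.lift (tMul Φ V) ∘ₗ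
      braiding (tensorAlgObj Φ V) (tensorAlgObj Φ V) ∘ₗ
      TensorProduct.map (powAntipode Φ V n) (-tGen Φ V)

/-- The tensor algebra `T_Φ(V)` with its Hopf algebra structure. -/
def tensorAlg (Φ : G → G → G → kˣ) (V : YDData k G) : HopfData k G where
  toYDData := tensorAlgObj Φ V
  one := tOne Φ V
  mul := tMul Φ V
  comul := tLift Φ V (powComul Φ V)
  counit := tLift Φ V (powCounit Φ V)
  antipode := tLift Φ V (powAntipode Φ V)

/-! ## Nichols algebras -/

/-- The `ℕ`-graded Hopf ideals of `T_Φ(V)` generated by (equivalently, spanned by) homogeneous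
elements of degree at least `2`. -/
structure IsNicholsHopfIdeal (Φ : G → G → G → kˣ) (V : YDData k G)
    (I : Submodule k (tensorAlg Φ V).carrier) : Prop where
  isHopfIdeal : IsHopfIdeal (tensorAlg Φ V) I
  graded : ∀ n, ∀ x ∈ I, tComp Φ V n x ∈ I
  comp_zero : ∀ x ∈ I, tComp Φ V 0 x = 0
  comp_one : ∀ x ∈ I, tComp Φ V 1 x = 0

/-- The sum of all graded Hopf ideals generated in degrees at least `2`. It is itself one of
them (`isNicholsHopfIdeal_nicholsIdeal`), hence it is the unique maximal one. -/
def nicholsIdeal (Φ : G → G → G → kˣ) (V : YDData k G) :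
    Submodule k (tensorAlg Φ V).carrier :=
  sSup {I | IsNicholsHopfIdeal Φ V I}

theorem isNicholsHopfIdeal_nicholsIdeal (Φ : G → G → G → kˣ) (V : YDData k G) :
    IsNicholsHopfIdeal Φ V (nicholsIdeal Φ V) := by
  have key : ∀ (P : Submodule k (tensorAlg Φ V).carrier),
      (∀ I, IsNicholsHopfIdeal Φ V I → I ≤ P) → nicholsIdeal Φ V ≤ P :=
    fun P h => sSup_le h
  have le : ∀ I, IsNicholsHopfIdeal Φ V I → I ≤ nicholsIdeal Φ V := fun I hI => le_sSup hI
  refine ⟨⟨?_, ?_, ?_, ?_, ?_, ?_, ?_⟩, ?_, ?_, ?_⟩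
  · exact fun g => key ((nicholsIdeal Φ V).comap ((tensorAlg Φ V).proj g))
      fun I hI x hx => le I hI (hI.isHopfIdeal.proj_mem g x hx)
  · exact fun g => key ((nicholsIdeal Φ V).comap ((tensorAlg Φ V).act g))
      fun I hI x hx => le I hI (hI.isHopfIdeal.act_mem g x hx)
  · exact fun a => key ((nicholsIdeal Φ V).comap ((tensorAlg Φ V).mul a))
      fun I hI x hx => le I hI (hI.isHopfIdeal.mul_mem_left a x hx)
  · exact fun a => key ((nicholsIdeal Φ V).comap ((tensorAlg Φ V).mul.flip a))
      fun I hI x hx => le I hI (hI.isHopfIdeal.mul_mem_right a x hx)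
  · refine fun x hx => key (Submodule.comap (tensorAlg Φ V).comul (_ ⊔ _)) ?_ hx
    intro I hI x hx
    refine SetLike.le_def.mp (sup_le_sup ?_ ?_) (hI.isHopfIdeal.comul_mem x hx)
    · have : I.subtype = (nicholsIdeal Φ V).subtype ∘ₗ Submodule.inclusion (le I hI) := rfl
      rw [this, ← LinearMap.comp_id (LinearMap.id : (tensorAlg Φ V).carrier →ₗ[k] _),
        TensorProduct.map_comp, LinearMap.comp_id]
      exact LinearMap.range_comp_le_range _ _
    · have : I.subtype = (nicholsIdeal Φ V).subtype ∘ₗ Submodule.inclusion (le I hI) := rfl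
      rw [this, ← LinearMap.comp_id (LinearMap.id : (tensorAlg Φ V).carrier →ₗ[k] _),
        TensorProduct.map_comp, LinearMap.comp_id]
      exact LinearMap.range_comp_le_range _ _
  · exact key (LinearMap.ker (tensorAlg Φ V).counit)
      fun I hI x hx => hI.isHopfIdeal.counit_eq_zero x hx
  · exact key ((nicholsIdeal Φ V).comap (tensorAlg Φ V).antipode)
      fun I hI x hx => le I hI (hI.isHopfIdeal.antipode_mem x hx)
  · exact fun n => key ((nicholsIdeal Φ V).comap (tComp Φ V n))
      fun I hI x hx => le I hI (hI.graded n x hx)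
  · exact key (LinearMap.ker (tComp Φ V 0)) fun I hI x hx => hI.comp_zero x hx
  · exact key (LinearMap.ker (tComp Φ V 1)) fun I hI x hx => hI.comp_one x hx

/-- The Nichols algebra `B(V) = T_Φ(V) / I`, where `I` is the maximal graded Hopf ideal generated
by homogeneous elements of degree at least `2`. -/
def nichols {Φ : G → G → G → kˣ} (V : YDModule Φ) : HopfData k G :=
  (tensorAlg Φ V.toYDData).quotient (nicholsIdeal Φ V.toYDData)
    (isNicholsHopfIdeal_nicholsIdeal Φ V.toYDData).isHopfIdeal

/-- The canonical map from `V` to `B(V)`. -/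
def nicholsGen {Φ : G → G → G → kˣ} (V : YDModule Φ) :
    V.carrier →ₗ[k] (nichols V).carrier :=
  (nicholsIdeal Φ V.toYDData).mkQ ∘ₗ tGen Φ V.toYDData

/-- A canonical basis of `V`: each `X_i` is homogeneous and spans a one-dimensional projective
representation of `G`. -/
def IsCanonicalBasis {Φ : G → G → G → kˣ} (V : YDModule Φ) {l : ℕ}
    (X : Module.Basis (Fin l) k V.carrier) : Prop :=
  ∀ i, (∃ g, V.proj g (X i) = X i) ∧ ∀ x, ∃ c : k, V.act x (X i) = c • X i

/-- The component of degree `α` for the `ℤ^l`-grading of `B(V)` with `deg X_i = e_i`: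
the span of the left-bracketed monomials in the `X_i` that contain each `X_i` exactly
`α i` times. -/
def nicholsComponent {Φ : G → G → G → kˣ} (V : YDModule Φ) {l : ℕ}
    (X : Module.Basis (Fin l) k V.carrier) (α : Fin l → ℤ) : Submodule k (nichols V).carrier :=
  Submodule.span k {y | ∃ s : List (Fin l), (∀ i, (s.count i : ℤ) = α i) ∧
    y = s.foldl (fun t i => (nichols V).mul t (nicholsGen V (X i))) (nichols V).one}

end TensorAlgebra

section ChangeOfGroup

variable {k : Type u} [Field k] {G : Type v} [CommGroup G] [Fintype G] [DecidableEq G]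
  {H : Type w} [CommGroup H] [Fintype H] [DecidableEq H]

/-- Isomorphy of Nichols algebras over possibly different groups: there are canonical bases with
the same number `l` of elements, and a `ℤ^l`-graded linear isomorphism that preserves
multiplication and comultiplication. -/
def NicholsIsomorphic {Φ : G → G → G → kˣ} (V : YDModule Φ) {Ψ : H → H → H → kˣ}
    (U : YDModule Ψ) : Prop :=
  ∃ (l : ℕ) (X : Module.Basis (Fin l) k V.carrier) (Y : Module.Basis (Fin l) k U.carrier),
    IsCanonicalBasis V X ∧ IsCanonicalBasis U Y ∧
    ∃ F : (nichols V).carrier ≃ₗ[k] (nichols U).carrier,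
      (∀ α : Fin l → ℤ,
        (nicholsComponent V X α).map F.toLinearMap = nicholsComponent U Y α) ∧
      (∀ x y, F ((nichols V).mul x y) = (nichols U).mul (F x) (F y)) ∧
      (∀ x, TensorProduct.map F.toLinearMap F.toLinearMap ((nichols V).comul x) =
        (nichols U).comul (F x))

/-- For a group morphism `π : H → G` with a set-theoretic section `ι`, the module `Ṽ` over
`(kH, π^*Φ)`: the same space with coaction `(ι ⊗ id) δ` and action `h ▶ Z = π(h) ▷ Z`. -/
def YDModule.pullback {Φ : G → G → G → kˣ} (V : YDModule Φ) (π : H →* G) (ι : G → H)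
    (hι : ∀ g, π (ι g) = g) : YDModule (pullbackCochain π Φ) where
  carrier := V.carrier
  proj h := ∑ g : G, if ι g = h then V.proj g else 0
  act h := V.act (π h)
  isYD := by
    have hinj : ∀ g g', ι g = ι g' ↔ g = g' :=
      fun g g' => ⟨fun e => by rw [← hι g, e, hι], fun e => by rw [e]⟩
    have hproj : ∀ h (v : V.carrier), (∑ g : G, if ι g = h then V.proj g else 0) v =
        if ι (π h) = h then V.proj (π h) v else 0 := by
      intro h v
      rw [LinearMap.sum_apply]
      by_cases hh : ι (π h) = h
      · rw [if_pos hh, Finset.sum_eq_single (π h)]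
        · rw [if_pos hh]
        · intro g _ hg
          rw [if_neg, LinearMap.zero_apply]
          rintro rfl
          exact hg (hι g).symm
        · simp
      · rw [if_neg hh]
        refine Finset.sum_eq_zero fun g _ => ?_
        rw [if_neg, LinearMap.zero_apply]
        rintro rfl
        exact hh (by rw [hι])
    refine ⟨?_, ?_, ?_, ?_, ?_⟩
    · intro g h v
      dsimp only
      rw [hproj h v, hproj g]
      by_cases h1 : ι (π h) = h
      · by_cases h2 : ι (π g) = g
        · rw [if_pos h1, if_pos h2, V.isYD.proj_proj]
          have : π g = π h ↔ g = h := by rw [← hinj, h1, h2]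
          simp [this]
        · have : g ≠ h := by rintro rfl; exact h2 h1
          simp [h2, this]
      · simp [h1]
    · intro v
      dsimp only
      simp_rw [LinearMap.sum_apply]
      rw [Finset.sum_comm]
      conv_rhs => rw [← V.isYD.sum_proj v]
      refine Finset.sum_congr rfl fun g _ => ?_
      rw [Finset.sum_eq_single (ι g)]
      · simp
      · intro h _ hh
        rw [if_neg (Ne.symm hh), LinearMap.zero_apply]
      · simp
    · intro g x v
      dsimp only
      rw [hproj, hproj]
      split_ifs
      · exact V.isYD.proj_act _ _ _
      · simp
    · intro v
      dsimp only
      rw [map_one]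
      exact V.isYD.one_act v
    · intro g e f v hv
      dsimp only at hv ⊢
      rw [hproj] at hv
      rw [map_mul]
      by_cases hg : ι (π g) = g
      · rw [if_pos hg] at hv
        exact V.isYD.act_act _ _ _ _ hv
      · rw [if_neg hg] at hv
        rw [← hv]
        simp

end ChangeOfGroup

/-! ## Finite abelian groups and their standard `3`-cocycles -/

section Standard

variable {n : ℕ}

/-- The group `ℤ_{m_1} × ⋯ × ℤ_{m_n}`, written multiplicatively. -/
abbrev AbGroup (m : Fin n → ℕ) : Type := (i : Fin n) → Multiplicative (ZMod (m i))

/-- The exponent `0 ≤ i_r < m_r` of the `r`-th generator in `g = g_1^{i_1} ⋯ g_n^{i_n}`. -/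
def expo {m : Fin n → ℕ} (g : AbGroup m) (r : Fin n) : ℕ := (Multiplicative.toAdd (g r)).val

/-- The sequences `(a_l, a_{st}, a_{rst})` with `0 ≤ a_l < m_l`, `0 ≤ a_{st} < (m_s, m_t)` and
`0 ≤ a_{rst} < (m_r, m_s, m_t)` for `r < s < t`. (Entries of `two` and `three` at indices that
are not increasing play no role.) -/
structure CocycleIndex (m : Fin n → ℕ) where
  one : Fin n → ℕ
  two : Fin n → Fin n → ℕ
  three : Fin n → Fin n → Fin n → ℕ
  one_lt : ∀ l, one l < m l
  two_lt : ∀ s t, s < t → two s t < Nat.gcd (m s) (m t)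
  three_lt : ∀ r s t, r < s → s < t → three r s t < Nat.gcd (m r) (Nat.gcd (m s) (m t))

variable {k : Type u} [Field k]

/-- The standard `3`-cocycle `Φ_a`, for chosen roots of unity `ζ`:
`(g^i, g^j, g^k) ↦ ∏_l ζ_{m_l}^{a_l i_l [(j_l + k_l) / m_l]}
∏_{s < t} ζ_{m_t}^{a_{st} i_t [(j_s + k_s) / m_s]}
∏_{r < s < t} ζ_{(m_r, m_s, m_t)}^{- a_{rst} k_r j_s i_t}`. -/
def stdCocycle (ζ : ℕ → kˣ) (m : Fin n → ℕ) (a : CocycleIndex m)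
    (x y z : AbGroup m) : kˣ :=
  (∏ l, ζ (m l) ^ (a.one l * expo x l * ((expo y l + expo z l) / m l))) *
  (∏ s, ∏ t, if s < t then
    ζ (m t) ^ (a.two s t * expo x t * ((expo y s + expo z s) / m s)) else 1) *
  (∏ r, ∏ s, ∏ t, if r < s ∧ s < t then
    (ζ (Nat.gcd (m r) (Nat.gcd (m s) (m t))) ^
      (a.three r s t * expo z r * expo y s * expo x t))⁻¹ else 1)

/-- The canonical epimorphism `ℤ_{m_1²} × ⋯ × ℤ_{m_n²} → ℤ_{m_1} × ⋯ × ℤ_{m_n}`,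
`g_i ↦ 𝕘_i`. -/
def canonicalProj (m : Fin n → ℕ) : AbGroup (fun i => m i ^ 2) →* AbGroup m where
  toFun g i := Multiplicative.ofAdd
    (ZMod.castHom (dvd_pow_self (m i) two_ne_zero) (ZMod (m i)) (Multiplicative.toAdd (g i)))
  map_one' := by
    funext i
    simp
  map_mul' g h := by
    funext i
    simp

/-- The section `∏ 𝕘_i^{j_i} ↦ ∏ g_i^{j_i}`, `0 ≤ j_i < m_i`, of the canonical epimorphism. -/
def canonicalSection (m : Fin n → ℕ) (g : AbGroup m) : AbGroup (fun i => m i ^ 2) :=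
  fun i => Multiplicative.ofAdd ((expo g i : ℕ) : ZMod (m i ^ 2))

theorem canonicalProj_section (m : Fin n → ℕ) [∀ i, NeZero (m i)] (g : AbGroup m) :
    canonicalProj m (canonicalSection m g) = g := by
  funext i
  have h : ((((Multiplicative.toAdd (g i)).val : ℕ) : ZMod (m i)) : ZMod (m i)) =
      Multiplicative.toAdd (g i) := ZMod.natCast_zmod_val _
  simp only [canonicalProj, canonicalSection, expo, MonoidHom.coe_mk, OneHom.coe_mk, toAdd_ofAdd,
    map_natCast]
  exact congrArg Multiplicative.ofAdd h

end Standard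

end TwistedYD

end

/-!
Let `p : H → G` be a group morphism and `J` a normalized `2`-cochain on `H`, and suppose that
`Ψ = p^*Φ · ∂J`. A linear map `f : W → V` from a Yetter-Drinfeld module over `(kH, Ψ)` to one over
`(kG, Φ)` is called twisted here (`IsTwistedMap`) if it maps degree `h` to degree `p h` and
satisfies `f (x ▷ w) = J(x, h) / J(h, x) • p x ▷ f w` for `w` of degree `h`. Such a map extends to
the tensor algebras, and the extension respects unit, counit and antipode, and multiplication and
comultiplication up to the scalars `J` (`IsTwistedMap.isTwistedHopfMap`); this is an induction on
the tensor degree in which every step is the relation `Ψ = p^*Φ · ∂J`.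

If `f` is bijective and `p` is surjective, the extension matches the maximal Hopf ideals
(`IsTwistedMap.map_nicholsIdeal`). The image of a Hopf ideal is again one. The preimage may fail
to be graded by the finer group `H`, but its graded closure is a Hopf ideal
(`IsHopfIdeal.homogSpan_comap`), and by maximality it is no larger than the maximal one. Hence `f`
induces an isomorphism of Nichols algebras up to `J` (`IsTwistedMap.exists_nichols_equiv`).

Both parts of the theorem are instances of this. For the first, `p` is the canonical epimorphism,
`J = 1`, and `f` is the identity of `V`. For the second, `p` is the identity, `Φ = 1`, and
`f : Ṽ → V'` is the identity of the underlying space, where `V'` is `Ṽ` with its action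
divided by `J(x, h) / J(h, x)` (`YDModule.untwist`). This uses that the pulled-back cocycle is a
coboundary (`exists_coboundary_eq_pullback`): commutativity of the twisted double forces the
coefficients `a_{rst}` to vanish, and each of the other factors becomes a coboundary on `∏ ℤ_{m_i²}`
through a cochain with values in the powers of an `m_t`-th root of `ζ_{m_t}`
(`exists_coboundary_pair`).

The canonical bases exist because the untwisted module `V'` is a representation of a finite abelian
group by commuting operators of finite order that preserve the degree, so that the projections and
the actions are simultaneously diagonalizable in characteristic zero
(`YDModule.exists_isCanonicalBasis`).
-/

set_option linter.unusedSectionVars false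

noncomputable section

namespace TwistedYD

/-! ### Homogeneous elements and the structure maps on them -/

section Homogeneous

variable {k : Type u} [Field k] {G : Type v}

/-- `a` is homogeneous of degree `g`. The zero vector is homogeneous of every degree. -/
def YDData.IsHomogeneous (A : YDData k G) (g : G) (a : A.carrier) : Prop := A.proj g a = a

theorem YDData.IsHomogeneous.eq {A : YDData k G} {g : G} {a : A.carrier}
    (h : A.IsHomogeneous g a) : A.proj g a = a := h

theorem YDData.IsHomogeneous.zero (A : YDData k G) (g : G) : A.IsHomogeneous g 0 :=
  map_zero _

theorem YDData.IsHomogeneous.add {A : YDData k G} {g : G} {a b : A.carrier}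
    (ha : A.IsHomogeneous g a) (hb : A.IsHomogeneous g b) : A.IsHomogeneous g (a + b) := by
  unfold YDData.IsHomogeneous at *
  rw [map_add, ha, hb]

theorem YDData.IsHomogeneous.smul {A : YDData k G} {g : G} {a : A.carrier} (c : k)
    (ha : A.IsHomogeneous g a) : A.IsHomogeneous g (c • a) := by
  unfold YDData.IsHomogeneous at *
  rw [map_smul, ha]

theorem YDData.IsHomogeneous.neg {A : YDData k G} {g : G} {a : A.carrier}
    (ha : A.IsHomogeneous g a) : A.IsHomogeneous g (-a) := by
  unfold YDData.IsHomogeneous at *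
  rw [map_neg, ha]

variable [Fintype G] [DecidableEq G]

/-- The part of the axioms of a Yetter-Drinfeld module that does not involve the `3`-cocycle:
the operators `proj g` are the projections of a `G`-grading, and `▷` preserves it. -/
structure IsGraded (A : YDData k G) : Prop where
  proj_proj : ∀ (g h : G) (v : A.carrier),
    A.proj g (A.proj h v) = if g = h then A.proj h v else 0
  sum_proj : ∀ v : A.carrier, ∑ g, A.proj g v = v
  proj_act : ∀ (g x : G) (v : A.carrier), A.proj g (A.act x v) = A.act x (A.proj g v)

namespace IsGraded

variable {A B : YDData k G}

theorem homog_proj (hA : IsGraded A) (g : G) (a : A.carrier) :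
    A.IsHomogeneous g (A.proj g a) := by
  rw [YDData.IsHomogeneous, hA.proj_proj, if_pos rfl]

theorem homog_act (hA : IsGraded A) (x : G) {g : G} {a : A.carrier}
    (ha : A.IsHomogeneous g a) : A.IsHomogeneous g (A.act x a) := by
  unfold YDData.IsHomogeneous at *
  rw [hA.proj_act, ha]

theorem proj_apply (hA : IsGraded A) {g : G} {a : A.carrier} (ha : A.IsHomogeneous g a)
    (h : G) : A.proj h a = if h = g then a else 0 := by
  have := hA.proj_proj h g a
  rwa [ha.eq] at this

theorem induction_on (hA : IsGraded A) {P : A.carrier → Prop} (zero : P 0)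
    (add : ∀ a b, P a → P b → P (a + b))
    (homog : ∀ g a, A.IsHomogeneous g a → P a) (a : A.carrier) : P a := by
  rw [← hA.sum_proj a]
  exact Finset.sum_induction _ P add zero fun g _ => homog g _ (hA.homog_proj g a)

theorem tensor_induction_on (hA : IsGraded A) (hB : IsGraded B)
    {P : A.carrier ⊗[k] B.carrier → Prop} (zero : P 0)
    (add : ∀ X Y, P X → P Y → P (X + Y))
    (tmul : ∀ g h a b, A.IsHomogeneous g a → B.IsHomogeneous h b → P (a ⊗ₜ b))
    (X : A.carrier ⊗[k] B.carrier) : P X := by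
  induction X using TensorProduct.induction_on with
  | zero => exact zero
  | add X Y hX hY => exact add X Y hX hY
  | tmul a b =>
    refine hA.induction_on (P := fun a => P (a ⊗ₜ b)) ?_ ?_ ?_ a
    · rw [TensorProduct.zero_tmul]; exact zero
    · intro a a' h h'; rw [TensorProduct.add_tmul]; exact add _ _ h h'
    · intro g a ha
      refine hB.induction_on (P := fun b => P (a ⊗ₜ b)) ?_ ?_ ?_ b
      · rw [TensorProduct.tmul_zero]; exact zero
      · intro b b' h h'; rw [TensorProduct.tmul_add]; exact add _ _ h h'
      · intro h b hb
        exact tmul g h a b ha hb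

end IsGraded

end Homogeneous

section Tensor

variable {k : Type u} [Field k] {G : Type v} [CommGroup G] [Fintype G] [DecidableEq G]
  {Φ : G → G → G → kˣ} {A B C : YDData k G}

theorem IsYD.isGraded (h : IsYD Φ A) : IsGraded A := ⟨h.proj_proj, h.sum_proj, h.proj_act⟩

variable (Φ A B) in
/-- The projections of `tensorObj Φ A B`, as endomorphisms of `A ⊗ B`. -/
def tensorProj (x : G) : A.carrier ⊗[k] B.carrier →ₗ[k] A.carrier ⊗[k] B.carrier :=
  (tensorObj Φ A B).proj x

variable (Φ A B) in
/-- The action on `tensorObj Φ A B`, as endomorphisms of `A ⊗ B`. -/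
def tensorAct (x : G) : A.carrier ⊗[k] B.carrier →ₗ[k] A.carrier ⊗[k] B.carrier :=
  (tensorObj Φ A B).act x

theorem tensorProj_tmul (hA : IsGraded A) (hB : IsGraded B) {g h : G} {a : A.carrier}
    {b : B.carrier} (ha : A.IsHomogeneous g a) (hb : B.IsHomogeneous h b) (x : G) :
    tensorProj Φ A B x (a ⊗ₜ[k] b) = if x = g * h then a ⊗ₜ[k] b else 0 := by
  have : tensorProj Φ A B x (a ⊗ₜ[k] b) =
      ∑ y : G, A.proj y a ⊗ₜ[k] B.proj (y⁻¹ * x) b := by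
    change (∑ y : G, TensorProduct.map (A.proj y) (B.proj (y⁻¹ * x))) (a ⊗ₜ[k] b) = _
    rw [LinearMap.sum_apply]
    rfl
  rw [this, Finset.sum_eq_single g]
  · rw [ha.eq, hB.proj_apply hb]
    by_cases hx : x = g * h
    · rw [if_pos hx, if_pos (by rw [hx]; group)]
    · rw [if_neg hx, if_neg (by rintro rfl; exact hx (by group)), TensorProduct.tmul_zero]
  · intro y _ hy
    rw [hA.proj_apply ha, if_neg hy, TensorProduct.zero_tmul]
  · simp

theorem homog_tmul (Φ : G → G → G → kˣ) (hA : IsGraded A) (hB : IsGraded B) {g h : G}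
    {a : A.carrier} {b : B.carrier} (ha : A.IsHomogeneous g a) (hb : B.IsHomogeneous h b) :
    (tensorObj Φ A B).IsHomogeneous (g * h) (a ⊗ₜ[k] b) :=
  (tensorProj_tmul (Φ := Φ) hA hB ha hb _).trans (if_pos rfl)

theorem sum_smul_map_tmul (hA : IsGraded A) (hB : IsGraded B) {g h : G} {a : A.carrier}
    {b : B.carrier} (ha : A.IsHomogeneous g a) (hb : B.IsHomogeneous h b)
    {M N : Type*} [AddCommGroup M] [Module k M] [AddCommGroup N] [Module k N]
    (c : G → G → k) (p : A.carrier →ₗ[k] M) (q : B.carrier →ₗ[k] N) :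
    (∑ x : G, ∑ y : G, c x y • TensorProduct.map (p ∘ₗ A.proj x) (q ∘ₗ B.proj y))
      (a ⊗ₜ[k] b) = c g h • (p a ⊗ₜ[k] q b) := by
  simp only [LinearMap.sum_apply, LinearMap.smul_apply, TensorProduct.map_tmul,
    LinearMap.comp_apply]
  rw [Finset.sum_eq_single g, Finset.sum_eq_single h]
  · rw [ha.eq, hb.eq]
  · intro y _ hy
    rw [hB.proj_apply hb, if_neg hy, map_zero, TensorProduct.tmul_zero, smul_zero]
  · simp
  · intro y _ hy
    refine Finset.sum_eq_zero fun _ _ => ?_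
    rw [hA.proj_apply ha, if_neg hy, map_zero, TensorProduct.zero_tmul, smul_zero]
  · simp

theorem tensorAct_tmul (hA : IsGraded A) (hB : IsGraded B) {g h : G} {a : A.carrier}
    {b : B.carrier} (ha : A.IsHomogeneous g a) (hb : B.IsHomogeneous h b) (x : G) :
    tensorAct Φ A B x (a ⊗ₜ[k] b) =
      ((tilde Φ x g h : kˣ) : k) • (A.act x a ⊗ₜ[k] B.act x b) :=
  sum_smul_map_tmul hA hB ha hb _ _ _

theorem assocHom_tmul (hA : IsGraded A) (hB : IsGraded B) (hC : IsGraded C) {e f g : G}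
    {a : A.carrier} {b : B.carrier} {c : C.carrier} (ha : A.IsHomogeneous e a)
    (hb : B.IsHomogeneous f b) (hc : C.IsHomogeneous g c) :
    assocHom Φ A B C ((a ⊗ₜ[k] b) ⊗ₜ[k] c) =
      (((Φ e f g)⁻¹ : kˣ) : k) • (a ⊗ₜ[k] (b ⊗ₜ[k] c)) := by
  simp only [assocHom, LinearMap.sum_apply, LinearMap.smul_apply, TensorProduct.map_tmul,
    LinearMap.comp_apply, LinearEquiv.coe_coe, TensorProduct.assoc_tmul]
  rw [Finset.sum_eq_single e, Finset.sum_eq_single f, Finset.sum_eq_single g]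
  · rw [ha.eq, hb.eq, hc.eq]
  · intro y _ hy
    rw [hC.proj_apply hc, if_neg hy]; simp
  · simp
  · intro y _ hy
    rw [hB.proj_apply hb, if_neg hy]; simp
  · simp
  · intro y _ hy
    rw [hA.proj_apply ha, if_neg hy]; simp
  · simp

theorem assocInv_tmul (hA : IsGraded A) (hB : IsGraded B) (hC : IsGraded C) {e f g : G}
    {a : A.carrier} {b : B.carrier} {c : C.carrier} (ha : A.IsHomogeneous e a)
    (hb : B.IsHomogeneous f b) (hc : C.IsHomogeneous g c) :
    assocInv Φ A B C (a ⊗ₜ[k] (b ⊗ₜ[k] c)) =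
      ((Φ e f g : kˣ) : k) • ((a ⊗ₜ[k] b) ⊗ₜ[k] c) := by
  simp only [assocInv, LinearMap.sum_apply, LinearMap.smul_apply, TensorProduct.map_tmul,
    LinearMap.comp_apply, LinearEquiv.coe_coe, TensorProduct.assoc_symm_tmul]
  rw [Finset.sum_eq_single e, Finset.sum_eq_single f, Finset.sum_eq_single g]
  · rw [ha.eq, hb.eq, hc.eq]
  · intro y _ hy
    rw [hC.proj_apply hc, if_neg hy]; simp
  · simp
  · intro y _ hy
    rw [hB.proj_apply hb, if_neg hy]; simp
  · simp
  · intro y _ hy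
    rw [hA.proj_apply ha, if_neg hy]; simp
  · simp

theorem braiding_tmul (hA : IsGraded A) {e : G} {a : A.carrier} (ha : A.IsHomogeneous e a)
    (b : B.carrier) : braiding A B (a ⊗ₜ[k] b) = B.act e b ⊗ₜ[k] a := by
  simp only [braiding, LinearMap.sum_apply, TensorProduct.map_tmul,
    LinearMap.comp_apply, LinearEquiv.coe_coe, TensorProduct.comm_tmul]
  rw [Finset.sum_eq_single e]
  · rw [ha.eq]
  · intro y _ hy
    rw [hA.proj_apply ha, if_neg hy]; simp
  · simp

/-- A homogeneous element of degree `g` in `A ⊗ B` is a sum of tensors `a ⊗ b` of homogeneous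
elements with `deg a * deg b = g`. -/
theorem tensorObj_homog_induction (hA : IsGraded A) (hB : IsGraded B) {g : G}
    {P : A.carrier ⊗[k] B.carrier → Prop} (zero : P 0)
    (add : ∀ X Y, P X → P Y → P (X + Y))
    (tmul : ∀ x y a b, A.IsHomogeneous x a → B.IsHomogeneous y b → x * y = g → P (a ⊗ₜ b))
    {X : A.carrier ⊗[k] B.carrier} (hX : (tensorObj Φ A B).IsHomogeneous g X) : P X := by
  have key : ∀ X, P (tensorProj Φ A B g X) := by
    intro X
    refine hA.tensor_induction_on hB (P := fun X => P (tensorProj Φ A B g X)) ?_ ?_ ?_ X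
    · rwa [map_zero]
    · intro X Y hX hY
      rw [map_add]
      exact add _ _ hX hY
    · intro x y a b ha hb
      rw [tensorProj_tmul hA hB ha hb]
      split_ifs with h
      · exact tmul x y a b ha hb h.symm
      · exact zero
  have := key X
  rwa [show tensorProj Φ A B g X = X from hX] at this

theorem tensorProj_tensorProj (hA : IsGraded A) (hB : IsGraded B) (g h : G)
    (v : A.carrier ⊗[k] B.carrier) : tensorProj Φ A B g (tensorProj Φ A B h v) =
      if g = h then tensorProj Φ A B h v else 0 := by
  refine hA.tensor_induction_on hB (P := fun v => tensorProj Φ A B g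
    (tensorProj Φ A B h v) = if g = h then tensorProj Φ A B h v else 0) ?_ ?_ ?_ v
  · rw [map_zero, map_zero, ite_self]
  · intro X Y hX hY
    rw [map_add, map_add, hX, hY]
    split_ifs
    · rfl
    · exact add_zero _
  · intro x y a b ha hb
    rw [tensorProj_tmul hA hB ha hb]
    split_ifs with h1 h2 h2
    · rw [tensorProj_tmul hA hB ha hb, if_pos (h2.trans h1)]
    · rw [tensorProj_tmul hA hB ha hb, if_neg (by rwa [← h1])]
    · exact map_zero (tensorProj Φ A B g)
    · exact map_zero (tensorProj Φ A B g)

theorem sum_tensorProj (hA : IsGraded A) (hB : IsGraded B) (v : A.carrier ⊗[k] B.carrier) :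
    ∑ g, tensorProj Φ A B g v = v := by
  refine hA.tensor_induction_on hB
    (P := fun v => ∑ g, tensorProj Φ A B g v = v) ?_ ?_ ?_ v
  · exact Finset.sum_eq_zero fun g _ => map_zero (tensorProj Φ A B g)
  · intro X Y hX hY
    simp_rw [map_add]
    rw [Finset.sum_add_distrib, hX, hY]
  · intro x y a b ha hb
    simp_rw [tensorProj_tmul hA hB ha hb]
    rw [Finset.sum_ite_eq', if_pos (Finset.mem_univ _)]

theorem tensorProj_tensorAct (hA : IsGraded A) (hB : IsGraded B) (g x : G)
    (v : A.carrier ⊗[k] B.carrier) : tensorProj Φ A B g (tensorAct Φ A B x v) =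
      tensorAct Φ A B x (tensorProj Φ A B g v) := by
  refine hA.tensor_induction_on hB (P := fun v => tensorProj Φ A B g
    (tensorAct Φ A B x v) = tensorAct Φ A B x (tensorProj Φ A B g v))
      ?_ ?_ ?_ v
  · rw [map_zero, map_zero, map_zero]
  · intro X Y hX hY
    rw [map_add, map_add, map_add, map_add, hX, hY]
  · intro y z a b ha hb
    rw [tensorProj_tmul hA hB ha hb, tensorAct_tmul hA hB ha hb, map_smul]
    rw [tensorProj_tmul hA hB (hA.homog_act x ha) (hB.homog_act x hb)]
    split_ifs
    · rw [tensorAct_tmul hA hB ha hb]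
    · rw [map_zero, smul_zero]

theorem isGraded_tensorObj (Φ : G → G → G → kˣ) (hA : IsGraded A) (hB : IsGraded B) :
    IsGraded (tensorObj Φ A B) where
  proj_proj := tensorProj_tensorProj hA hB
  sum_proj := sum_tensorProj hA hB
  proj_act := tensorProj_tensorAct hA hB

/-- The braided multiplication of `A ⊗ A` on homogeneous elements. -/
theorem tensorSquareMul_tmul (hA : IsGraded A) (mul : A.carrier →ₗ[k] A.carrier →ₗ[k] A.carrier)
    {x y z w : G} {a b c d : A.carrier} (ha : A.IsHomogeneous x a) (hb : A.IsHomogeneous y b)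
    (hc : A.IsHomogeneous z c) (hd : A.IsHomogeneous w d) :
    tensorSquareMul Φ A mul ((a ⊗ₜ[k] b) ⊗ₜ[k] (c ⊗ₜ[k] d)) =
      ((Φ y z w * Φ x z (y * w) / (Φ x y (z * w) * Φ z y w) : kˣ) : k) •
        (mul a (A.act y c) ⊗ₜ[k] mul b d) := by
  have hAA := isGraded_tensorObj Φ hA hA
  -- the constraints that involve `tensorObj Φ A A`, as maps between iterated tensor products
  let p : (A.carrier ⊗[k] A.carrier) ⊗[k] (A.carrier ⊗[k] A.carrier) →ₗ[k]
    A.carrier ⊗[k] (A.carrier ⊗[k] (A.carrier ⊗[k] A.carrier)) :=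
    assocHom Φ A A (tensorObj Φ A A)
  let q : A.carrier ⊗[k] (A.carrier ⊗[k] (A.carrier ⊗[k] A.carrier)) →ₗ[k]
    (A.carrier ⊗[k] A.carrier) ⊗[k] (A.carrier ⊗[k] A.carrier) :=
    assocInv Φ A A (tensorObj Φ A A)
  have h1 : p ((a ⊗ₜ[k] b) ⊗ₜ[k] (c ⊗ₜ[k] d)) =
      (((Φ x y (z * w))⁻¹ : kˣ) : k) • (a ⊗ₜ[k] (b ⊗ₜ[k] (c ⊗ₜ[k] d))) :=
    assocHom_tmul hA hA hAA ha hb (homog_tmul Φ hA hA hc hd)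
  have h2 := assocInv_tmul (Φ := Φ) hA hA hA hb hc hd
  have h3 := braiding_tmul (B := A) hA hb c
  have h4 := assocHom_tmul (Φ := Φ) hA hA hA (hA.homog_act y hc) hb hd
  have h5 : q (a ⊗ₜ[k] (A.act y c ⊗ₜ[k] (b ⊗ₜ[k] d))) =
      ((Φ x z (y * w) : kˣ) : k) • ((a ⊗ₜ[k] A.act y c) ⊗ₜ[k] (b ⊗ₜ[k] d)) :=
    assocInv_tmul hA hA hAA ha (hA.homog_act y hc) (homog_tmul Φ hA hA hb hd)
  change TensorProduct.map (TensorProduct.lift mul) (TensorProduct.lift mul)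
    (q (TensorProduct.map LinearMap.id (assocHom Φ A A A)
      (TensorProduct.map LinearMap.id (TensorProduct.map (braiding A A) LinearMap.id)
        (TensorProduct.map LinearMap.id (assocInv Φ A A A)
          (p ((a ⊗ₜ[k] b) ⊗ₜ[k] (c ⊗ₜ[k] d))))))) = _
  simp only [h1, h2, h3, h4, h5, map_smul, TensorProduct.map_tmul, TensorProduct.tmul_smul,
    LinearMap.id_apply, smul_smul, TensorProduct.lift.tmul]
  congr 1
  push_cast
  field_simp

end Tensor

/-! ### The tensor algebra is a graded Hopf algebra -/

section TensorSquare

variable {k : Type u} [Field k] {G : Type v} [CommGroup G] [Fintype G] [DecidableEq G]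
  {Φ : G → G → G → kˣ} {A : YDData k G}

theorem homog_tensorSquareMul (hA : IsGraded A)
    {mul : A.carrier →ₗ[k] A.carrier →ₗ[k] A.carrier}
    (hmul : ∀ g h a b, A.IsHomogeneous g a → A.IsHomogeneous h b →
      A.IsHomogeneous (g * h) (mul a b))
    {g h : G} {X Y : A.carrier ⊗[k] A.carrier} (hX : (tensorObj Φ A A).IsHomogeneous g X)
    (hY : (tensorObj Φ A A).IsHomogeneous h Y) :
    (tensorObj Φ A A).IsHomogeneous (g * h) (tensorSquareMul Φ A mul (X ⊗ₜ[k] Y)) := by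
  refine tensorObj_homog_induction hA hA (P := fun X => (tensorObj Φ A A).IsHomogeneous (g * h)
    (tensorSquareMul Φ A mul (X ⊗ₜ[k] Y))) ?_ ?_ ?_ hX
  · rw [TensorProduct.zero_tmul, map_zero]
    exact .zero _ _
  · intro X X' hX hX'
    rw [TensorProduct.add_tmul, map_add]
    exact hX.add hX'
  · intro x y a b ha hb hxy
    refine tensorObj_homog_induction hA hA (P := fun Y => (tensorObj Φ A A).IsHomogeneous (g * h)
      (tensorSquareMul Φ A mul ((a ⊗ₜ b) ⊗ₜ[k] Y))) ?_ ?_ ?_ hY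
    · rw [TensorProduct.tmul_zero, map_zero]
      exact .zero _ _
    · intro X X' hX hX'
      rw [TensorProduct.tmul_add, map_add]
      exact hX.add hX'
    · intro z w c d hc hd hzw
      rw [tensorSquareMul_tmul hA mul ha hb hc hd]
      refine YDData.IsHomogeneous.smul (A := tensorObj Φ A A) _ ?_
      have : g * h = (x * z) * (y * w) := by
        rw [← hxy, ← hzw, mul_mul_mul_comm]
      rw [this]
      exact homog_tmul Φ hA hA (hmul _ _ _ _ ha (hA.homog_act y hc)) (hmul _ _ _ _ hb hd)

end TensorSquare

section TensorPowers

variable {k : Type u} [Field k] {G : Type v} [CommGroup G] [Fintype G] [DecidableEq G]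
  {Φ : G → G → G → kˣ} {V : YDData k G}

variable (Φ V) in
/-- The identification of `V^{⊗ n} ⊗ V` with `V^{⊗ (n + 1)}`. -/
def tpowMk (n : ℕ) :
    (tpow Φ V n).carrier ⊗[k] V.carrier →ₗ[k] (tpow Φ V (n + 1)).carrier :=
  LinearMap.id

theorem tpowMk_bijective (n : ℕ) : Function.Bijective (tpowMk Φ V n) :=
  Function.bijective_id

theorem unitObj_proj (g : G) (c : (unitObj k G).carrier) :
    (unitObj k G).proj g c = if g = 1 then c else 0 := by
  change (if g = 1 then (LinearMap.id : k →ₗ[k] k) else 0) c = _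
  split_ifs <;> rfl

variable (k G) in
theorem isGraded_unitObj : IsGraded (unitObj k G) where
  proj_proj g h v := by
    simp only [unitObj_proj]
    split_ifs <;> simp_all
  sum_proj v := by
    simp_rw [unitObj_proj]
    rw [Finset.sum_ite_eq', if_pos (Finset.mem_univ _)]
  proj_act g x v := rfl

theorem isGraded_tpow (hV : IsGraded V) : ∀ n, IsGraded (tpow Φ V n)
  | 0 => isGraded_unitObj k G
  | n + 1 => isGraded_tensorObj Φ (isGraded_tpow hV n) hV

theorem homog_tpow_zero (c : k) : (tpow Φ V 0).IsHomogeneous 1 c :=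
  (unitObj_proj 1 c).trans (if_pos rfl)

theorem eq_one_or_eq_zero_of_homog (hV : IsGraded V) {g : G} {t : (tpow Φ V 0).carrier}
   
    (ht : (tpow Φ V 0).IsHomogeneous g t) : g = 1 ∨ t = 0 := by
  by_cases hg : g = 1
  · exact .inl hg
  · right
    have := (isGraded_tpow hV 0).proj_apply ht 1
    rw [(homog_tpow_zero (Φ := Φ) (V := V) t).eq, if_neg (Ne.symm hg)] at this
    exact this

theorem homog_tpowMk (hV : IsGraded V) {n : ℕ} {g h : G} {t : (tpow Φ V n).carrier}
    {v : V.carrier} (ht : (tpow Φ V n).IsHomogeneous g t) (hv : V.IsHomogeneous h v) :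
    (tpow Φ V (n + 1)).IsHomogeneous (g * h) (tpowMk Φ V n (t ⊗ₜ[k] v)) :=
  homog_tmul Φ (isGraded_tpow hV n) hV ht hv

theorem tpow_act_tpowMk (hV : IsGraded V) {n : ℕ} {g h : G} {t : (tpow Φ V n).carrier}
    {v : V.carrier} (ht : (tpow Φ V n).IsHomogeneous g t) (hv : V.IsHomogeneous h v) (x : G) :
    (tpow Φ V (n + 1)).act x (tpowMk Φ V n (t ⊗ₜ[k] v)) =
      ((tilde Φ x g h : kˣ) : k) •
        tpowMk Φ V n ((tpow Φ V n).act x t ⊗ₜ[k] V.act x v) :=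
  tensorAct_tmul (isGraded_tpow hV n) hV ht hv x

theorem tpow_succ_induction (hV : IsGraded V) {n : ℕ}
    {P : (tpow Φ V (n + 1)).carrier → Prop} (zero : P 0)
    (add : ∀ X Y, P X → P Y → P (X + Y))
    (tmul : ∀ g h t v, (tpow Φ V n).IsHomogeneous g t → V.IsHomogeneous h v →
      P (tpowMk Φ V n (t ⊗ₜ v)))
    (X : (tpow Φ V (n + 1)).carrier) : P X :=
  (isGraded_tpow hV n).tensor_induction_on hV zero add tmul X

theorem tpow_succ_homog_induction (hV : IsGraded V) {n : ℕ} {g : G}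
    {P : (tpow Φ V (n + 1)).carrier → Prop} (zero : P 0)
    (add : ∀ X Y, P X → P Y → P (X + Y))
    (tmul : ∀ x y t v, (tpow Φ V n).IsHomogeneous x t → V.IsHomogeneous y v → x * y = g →
      P (tpowMk Φ V n (t ⊗ₜ v)))
    {X : (tpow Φ V (n + 1)).carrier} (hX : (tpow Φ V (n + 1)).IsHomogeneous g X) : P X :=
  tensorObj_homog_induction (isGraded_tpow hV n) hV zero add tmul hX

theorem powMul_zero (n : ℕ) (t : (tpow Φ V n).carrier) (c : k) :
    powMul Φ V n 0 (t ⊗ₜ[k] (show (tpow Φ V 0).carrier from c)) = c • t :=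
  TensorProduct.rid_tmul t c

theorem powMul_succ (hV : IsGraded V) {n m : ℕ} {e f g : G} {t : (tpow Φ V n).carrier}
    {s : (tpow Φ V m).carrier} {v : V.carrier} (ht : (tpow Φ V n).IsHomogeneous e t)
    (hs : (tpow Φ V m).IsHomogeneous f s) (hv : V.IsHomogeneous g v) :
    powMul Φ V n (m + 1) (t ⊗ₜ[k] tpowMk Φ V m (s ⊗ₜ[k] v)) =
      ((Φ e f g : kˣ) : k) • tpowMk Φ V (n + m) (powMul Φ V n m (t ⊗ₜ[k] s) ⊗ₜ[k] v) := by
  change (TensorProduct.map (powMul Φ V n m) LinearMap.id)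
    (assocInv Φ (tpow Φ V n) (tpow Φ V m) V (t ⊗ₜ[k] (s ⊗ₜ[k] v))) = _
  rw [assocInv_tmul (isGraded_tpow hV n) (isGraded_tpow hV m) hV ht hs hv, map_smul,
    TensorProduct.map_tmul]
  rfl

theorem homog_powMul (hV : IsGraded V) {n : ℕ} {e : G} {t : (tpow Φ V n).carrier}
    (ht : (tpow Φ V n).IsHomogeneous e t) : ∀ (m : ℕ) {f : G} {s : (tpow Φ V m).carrier},
    (tpow Φ V m).IsHomogeneous f s →
      (tpow Φ V (n + m)).IsHomogeneous (e * f) (powMul Φ V n m (t ⊗ₜ[k] s))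
  | 0, f, s, hs => by
    have h1 : powMul Φ V n 0 (t ⊗ₜ[k] s) = (show k from s) • t := powMul_zero n t s
    rw [h1]
    rcases eq_one_or_eq_zero_of_homog hV hs with rfl | rfl
    · rw [mul_one]
      exact ht.smul _
    · change (tpow Φ V n).IsHomogeneous _ ((0 : k) • t)
      rw [zero_smul]
      exact .zero _ _
  | m + 1, f, s, hs => by
    refine tpow_succ_homog_induction hV (P := fun s =>
      (tpow Φ V (n + (m + 1))).IsHomogeneous (e * f) (powMul Φ V n (m + 1) (t ⊗ₜ[k] s)))
      ?_ ?_ ?_ hs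
    · rw [TensorProduct.tmul_zero, map_zero]
      exact .zero _ _
    · intro X Y hX hY
      rw [TensorProduct.tmul_add, map_add]
      exact hX.add hY
    · intro x y s v hs hv hxy
      rw [powMul_succ hV ht hs hv]
      refine YDData.IsHomogeneous.smul (A := tpow Φ V (n + m + 1)) _ ?_
      rw [← hxy, ← mul_assoc]
      exact homog_tpowMk hV (homog_powMul hV ht m hs) hv

end TensorPowers

section TensorAlgebraGrading

variable {k : Type u} [Field k] {G : Type v} [CommGroup G] [Fintype G] [DecidableEq G]
  {Φ : G → G → G → kˣ} {V : YDData k G}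

theorem tLift_tIncl {M : Type u} [AddCommGroup M] [Module k M]
    (f : ∀ n, (tpow Φ V n).carrier →ₗ[k] M) (n : ℕ) (t : (tpow Φ V n).carrier) :
    tLift Φ V f (tIncl Φ V n t) = f n t :=
  DirectSum.toModule_lof _ _ _

theorem tensorAlgObj_proj_tIncl (g : G) (n : ℕ) (t : (tpow Φ V n).carrier) :
    (tensorAlgObj Φ V).proj g (tIncl Φ V n t) = tIncl Φ V n ((tpow Φ V n).proj g t) :=
  DirectSum.lmap_lof _ _ _

theorem tensorAlgObj_act_tIncl (g : G) (n : ℕ) (t : (tpow Φ V n).carrier) :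
    (tensorAlgObj Φ V).act g (tIncl Φ V n t) = tIncl Φ V n ((tpow Φ V n).act g t) :=
  DirectSum.lmap_lof _ _ _

theorem tComp_tIncl (m n : ℕ) (t : (tpow Φ V n).carrier) :
    tComp Φ V m (tIncl Φ V n t) = if m = n then tIncl Φ V n t else 0 := by
  change tIncl Φ V m (DirectSum.component k ℕ (fun n => (tpow Φ V n).carrier) m
    (DirectSum.lof k ℕ (fun n => (tpow Φ V n).carrier) n t)) = _
  split_ifs with h
  · subst h
    rw [DirectSum.component.lof_self]
  · rw [DirectSum.component.of, dif_neg (Ne.symm h), map_zero]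

theorem tensorAlgObj_induction {P : (tensorAlgObj Φ V).carrier → Prop} (zero : P 0)
    (add : ∀ X Y, P X → P Y → P (X + Y)) (incl : ∀ n t, P (tIncl Φ V n t))
    (X : (tensorAlgObj Φ V).carrier) : P X :=
  DirectSum.induction_on X zero incl add

theorem isGraded_tensorAlgObj (hV : IsGraded V) : IsGraded (tensorAlgObj Φ V) where
  proj_proj g h v := by
    refine tensorAlgObj_induction (P := fun v => (tensorAlgObj Φ V).proj g
      ((tensorAlgObj Φ V).proj h v) = if g = h then (tensorAlgObj Φ V).proj h v else 0)
      ?_ ?_ ?_ v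
    · rw [map_zero, map_zero, ite_self]
    · intro X Y hX hY
      rw [map_add, map_add, hX, hY]
      split_ifs
      · rfl
      · exact add_zero _
    · intro n t
      rw [tensorAlgObj_proj_tIncl, tensorAlgObj_proj_tIncl, (isGraded_tpow hV n).proj_proj]
      split_ifs
      · rfl
      · exact map_zero _
  sum_proj v := by
    refine tensorAlgObj_induction (P := fun v => ∑ g, (tensorAlgObj Φ V).proj g v = v)
      ?_ ?_ ?_ v
    · exact Finset.sum_eq_zero fun g _ => map_zero _
    · intro X Y hX hY
      simp_rw [map_add]
      rw [Finset.sum_add_distrib, hX, hY]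
    · intro n t
      simp_rw [tensorAlgObj_proj_tIncl]
      rw [← map_sum, (isGraded_tpow hV n).sum_proj]
  proj_act g x v := by
    refine tensorAlgObj_induction (P := fun v => (tensorAlgObj Φ V).proj g
      ((tensorAlgObj Φ V).act x v) = (tensorAlgObj Φ V).act x ((tensorAlgObj Φ V).proj g v))
      ?_ ?_ ?_ v
    · rw [map_zero, map_zero, map_zero]
    · intro X Y hX hY
      rw [map_add, map_add, map_add, map_add, hX, hY]
    · intro n t
      rw [tensorAlgObj_proj_tIncl, tensorAlgObj_act_tIncl, tensorAlgObj_act_tIncl,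
        tensorAlgObj_proj_tIncl, (isGraded_tpow hV n).proj_act]

theorem homog_tIncl {n : ℕ} {g : G} {t : (tpow Φ V n).carrier}
    (ht : (tpow Φ V n).IsHomogeneous g t) :
    (tensorAlgObj Φ V).IsHomogeneous g (tIncl Φ V n t) := by
  rw [YDData.IsHomogeneous, tensorAlgObj_proj_tIncl, ht.eq]

/-- A homogeneous element of degree `g` in the tensor algebra is a sum of homogeneous elements
of degree `g` in the tensor powers. -/
theorem tensorAlgObj_homog_induction (hV : IsGraded V) {g : G}
    {P : (tensorAlgObj Φ V).carrier → Prop} (zero : P 0)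
    (add : ∀ X Y, P X → P Y → P (X + Y))
    (incl : ∀ n t, (tpow Φ V n).IsHomogeneous g t → P (tIncl Φ V n t))
    {X : (tensorAlgObj Φ V).carrier} (hX : (tensorAlgObj Φ V).IsHomogeneous g X) : P X := by
  have key : ∀ X, P ((tensorAlgObj Φ V).proj g X) := by
    intro X
    refine tensorAlgObj_induction (P := fun X => P ((tensorAlgObj Φ V).proj g X)) ?_ ?_ ?_ X
    · rwa [map_zero]
    · intro X Y hX hY
      rw [map_add]
      exact add _ _ hX hY
    · intro n t
      rw [tensorAlgObj_proj_tIncl]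
      exact incl n _ ((isGraded_tpow hV n).homog_proj g t)
  have := key X
  rwa [hX.eq] at this

theorem tMul_tIncl (n m : ℕ) (t : (tpow Φ V n).carrier) (s : (tpow Φ V m).carrier) :
    tMul Φ V (tIncl Φ V n t) (tIncl Φ V m s) = tIncl Φ V (n + m) (powMul Φ V n m (t ⊗ₜ[k] s)) := by
  rw [tMul, tLift_tIncl]
  rw [LinearMap.flip_apply, tLift_tIncl]
  rfl

theorem homog_tMul (hV : IsGraded V) {g h : G} {a b : (tensorAlgObj Φ V).carrier}
    (ha : (tensorAlgObj Φ V).IsHomogeneous g a) (hb : (tensorAlgObj Φ V).IsHomogeneous h b) :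
    (tensorAlgObj Φ V).IsHomogeneous (g * h) (tMul Φ V a b) := by
  refine tensorAlgObj_homog_induction hV (P := fun a =>
    (tensorAlgObj Φ V).IsHomogeneous (g * h) (tMul Φ V a b)) ?_ ?_ ?_ ha
  · rw [map_zero]
    exact .zero _ _
  · intro X Y hX hY
    rw [map_add]
    exact hX.add hY
  · intro n t ht
    refine tensorAlgObj_homog_induction hV (P := fun b =>
      (tensorAlgObj Φ V).IsHomogeneous (g * h) (tMul Φ V (tIncl Φ V n t) b)) ?_ ?_ ?_ hb
    · rw [map_zero]
      exact .zero _ _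
    · intro X Y hX hY
      rw [map_add]
      exact hX.add hY
    · intro m s hs
      rw [tMul_tIncl]
      exact homog_tIncl (homog_powMul hV ht m hs)

theorem homog_tOne : (tensorAlgObj Φ V).IsHomogeneous 1 (tOne Φ V) :=
  homog_tIncl (homog_tpow_zero 1)

theorem homog_tGen (hV : IsGraded V) {g : G} {v : V.carrier} (hv : V.IsHomogeneous g v) :
    (tensorAlgObj Φ V).IsHomogeneous g (tGen Φ V v) := by
  have := homog_tpowMk (Φ := Φ) hV (n := 0) (homog_tpow_zero 1) hv
  rw [one_mul] at this
  exact homog_tIncl this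

theorem genComul_apply (v : V.carrier) :
    genComul Φ V v = tGen Φ V v ⊗ₜ[k] tOne Φ V + tOne Φ V ⊗ₜ[k] tGen Φ V v := rfl

theorem powComul_succ (n : ℕ) (t : (tpow Φ V n).carrier) (v : V.carrier) :
    powComul Φ V (n + 1) (tpowMk Φ V n (t ⊗ₜ[k] v)) =
      tensorSquareMul Φ (tensorAlgObj Φ V) (tMul Φ V)
        (powComul Φ V n t ⊗ₜ[k] genComul Φ V v) := rfl

theorem homog_genComul (hV : IsGraded V) {g : G} {v : V.carrier} (hv : V.IsHomogeneous g v) :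
    (tensorObj Φ (tensorAlgObj Φ V) (tensorAlgObj Φ V)).IsHomogeneous g (genComul Φ V v) := by
  have hT := isGraded_tensorAlgObj (Φ := Φ) hV
  have h1 := homog_tmul Φ hT hT (homog_tGen (Φ := Φ) hV hv) homog_tOne
  have h2 := homog_tmul Φ hT hT homog_tOne (homog_tGen (Φ := Φ) hV hv)
  rw [mul_one] at h1
  rw [one_mul] at h2
  exact h1.add h2

theorem homog_powComul (hV : IsGraded V) : ∀ (n : ℕ) {g : G} {t : (tpow Φ V n).carrier},
    (tpow Φ V n).IsHomogeneous g t →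
      (tensorObj Φ (tensorAlgObj Φ V) (tensorAlgObj Φ V)).IsHomogeneous g (powComul Φ V n t)
  | 0, g, t, ht => by
    have hT := isGraded_tensorAlgObj (Φ := Φ) hV
    rcases eq_one_or_eq_zero_of_homog hV ht with rfl | rfl
    · have h1 := homog_tmul Φ hT hT homog_tOne homog_tOne
      rw [mul_one] at h1
      exact h1.smul _
    · rw [map_zero]
      exact .zero _ _
  | n + 1, g, t, ht => by
    refine tpow_succ_homog_induction hV (P := fun t =>
      (tensorObj Φ (tensorAlgObj Φ V) (tensorAlgObj Φ V)).IsHomogeneous g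
        (powComul Φ V (n + 1) t)) ?_ ?_ ?_ ht
    · rw [map_zero]
      exact .zero _ _
    · intro X Y hX hY
      rw [map_add]
      exact hX.add hY
    · intro x y t v ht hv hxy
      rw [powComul_succ, ← hxy]
      exact homog_tensorSquareMul (isGraded_tensorAlgObj hV)
        (fun _ _ _ _ ha hb => homog_tMul hV ha hb) (homog_powComul hV n ht)
        (homog_genComul hV hv)

theorem powAntipode_succ (hV : IsGraded V) {n : ℕ} {g : G} {t : (tpow Φ V n).carrier}
    (ht : (tensorAlgObj Φ V).IsHomogeneous g (powAntipode Φ V n t)) (v : V.carrier) :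
    powAntipode Φ V (n + 1) (tpowMk Φ V n (t ⊗ₜ[k] v)) =
      tMul Φ V ((tensorAlgObj Φ V).act g (-tGen Φ V v)) (powAntipode Φ V n t) := by
  change TensorProduct.lift (tMul Φ V) (braiding (tensorAlgObj Φ V) (tensorAlgObj Φ V)
    (powAntipode Φ V n t ⊗ₜ[k] (-tGen Φ V v))) = _
  rw [braiding_tmul (isGraded_tensorAlgObj hV) ht, TensorProduct.lift.tmul]

theorem homog_powAntipode (hV : IsGraded V) : ∀ (n : ℕ) {g : G} {t : (tpow Φ V n).carrier},
    (tpow Φ V n).IsHomogeneous g t →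
      (tensorAlgObj Φ V).IsHomogeneous g (powAntipode Φ V n t)
  | 0, g, t, ht => homog_tIncl ht
  | n + 1, g, t, ht => by
    refine tpow_succ_homog_induction hV (P := fun t =>
      (tensorAlgObj Φ V).IsHomogeneous g (powAntipode Φ V (n + 1) t)) ?_ ?_ ?_ ht
    · rw [map_zero]
      exact .zero _ _
    · intro X Y hX hY
      rw [map_add]
      exact hX.add hY
    · intro x y t v ht hv hxy
      rw [powAntipode_succ hV (homog_powAntipode hV n ht), ← hxy, mul_comm x y]
      exact homog_tMul hV ((isGraded_tensorAlgObj hV).homog_act _ (homog_tGen hV hv).neg)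
        (homog_powAntipode hV n ht)

theorem homog_tComul (hV : IsGraded V) {g : G} {a : (tensorAlgObj Φ V).carrier}
    (ha : (tensorAlgObj Φ V).IsHomogeneous g a) :
    (tensorObj Φ (tensorAlgObj Φ V) (tensorAlgObj Φ V)).IsHomogeneous g
      (tLift Φ V (powComul Φ V) a) := by
  refine tensorAlgObj_homog_induction hV (P := fun a =>
    (tensorObj Φ (tensorAlgObj Φ V) (tensorAlgObj Φ V)).IsHomogeneous g
      (tLift Φ V (powComul Φ V) a)) ?_ ?_ ?_ ha
  · rw [map_zero]
    exact .zero _ _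
  · intro X Y hX hY
    rw [map_add]
    exact hX.add hY
  · intro n t ht
    rw [tLift_tIncl]
    exact homog_powComul hV n ht

theorem tCounit_eq_zero (hV : IsGraded V) {g : G} {a : (tensorAlgObj Φ V).carrier}
    (ha : (tensorAlgObj Φ V).IsHomogeneous g a) (hg : g ≠ 1) :
    tLift Φ V (powCounit Φ V) a = 0 := by
  refine tensorAlgObj_homog_induction hV (P := fun a =>
    tLift Φ V (powCounit Φ V) a = 0) ?_ ?_ ?_ ha
  · rw [map_zero]
  · intro X Y hX hY
    rw [map_add, hX, hY, add_zero]
  · intro n t ht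
    rw [tLift_tIncl]
    cases n with
    | zero => exact (eq_one_or_eq_zero_of_homog hV ht).resolve_left hg
    | succ n => rfl

theorem homog_tAntipode (hV : IsGraded V) {g : G} {a : (tensorAlgObj Φ V).carrier}
    (ha : (tensorAlgObj Φ V).IsHomogeneous g a) :
    (tensorAlgObj Φ V).IsHomogeneous g (tLift Φ V (powAntipode Φ V) a) := by
  refine tensorAlgObj_homog_induction hV (P := fun a => (tensorAlgObj Φ V).IsHomogeneous g
    (tLift Φ V (powAntipode Φ V) a)) ?_ ?_ ?_ ha
  · rw [map_zero]
    exact .zero _ _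
  · intro X Y hX hY
    rw [map_add]
    exact hX.add hY
  · intro n t ht
    rw [tLift_tIncl]
    exact homog_powAntipode hV n ht

/-- The structure maps of a Hopf algebra preserve its `G`-grading. (The grading of
`tensorObj Φ B B` is independent of `Φ`.) -/
structure IsGradedHopf (Φ : G → G → G → kˣ) (B : HopfData k G) : Prop where
  isGraded : IsGraded B.toYDData
  homog_mul : ∀ g h a b, B.IsHomogeneous g a → B.IsHomogeneous h b →
    B.IsHomogeneous (g * h) (B.mul a b)
  homog_comul : ∀ g a, B.IsHomogeneous g a →
    (tensorObj Φ B.toYDData B.toYDData).IsHomogeneous g (B.comul a)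
  counit_eq_zero : ∀ g a, B.IsHomogeneous g a → g ≠ 1 → B.counit a = 0
  homog_antipode : ∀ g a, B.IsHomogeneous g a → B.IsHomogeneous g (B.antipode a)

theorem isGradedHopf_tensorAlg (hV : IsGraded V) : IsGradedHopf Φ (tensorAlg Φ V) where
  isGraded := isGraded_tensorAlgObj hV
  homog_mul _ _ _ _ ha hb := homog_tMul hV ha hb
  homog_comul _ _ ha := homog_tComul hV ha
  counit_eq_zero _ _ ha := tCounit_eq_zero hV ha
  homog_antipode _ _ ha := homog_tAntipode hV ha

end TensorAlgebraGrading

/-! ### Maps that intertwine the structure up to a `2`-cochain -/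

section CochainIdentities

variable {k : Type u} [Field k] {G : Type v} [CommGroup G] {H : Type w} [CommGroup H]
  {p : H →* G} {J : H → H → kˣ} {Φ : G → G → G → kˣ} {Ψ : H → H → H → kˣ}

/-- The `3`-cochain `Ψ` on `H` is the pull-back of `Φ` along `p`, multiplied by `∂J`. -/
def IsTwistedPullback (p : H →* G) (J : H → H → kˣ) (Φ : G → G → G → kˣ)
    (Ψ : H → H → H → kˣ) : Prop :=
  ∀ e f g, Ψ e f g = Φ (p e) (p f) (p g) * coboundary J e f g

theorem tilde_coboundary (J : H → H → kˣ) (x e f : H) :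
    tilde (coboundary J) x e f * (J x e / J e x) * (J x f / J f x) =
      J x (e * f) / J (e * f) x := by
  unfold tilde coboundary
  rw [mul_comm x e, mul_comm x f]
  ext
  push_cast
  field_simp

theorem IsTwistedPullback.tilde_eq (h : IsTwistedPullback p J Φ Ψ) (x e f : H) :
    tilde Ψ x e f * J e f * (J x e / J e x) * (J x f / J f x) =
      J x (e * f) / J (e * f) x * J e f * tilde Φ (p x) (p e) (p f) := by
  unfold tilde
  rw [h, h, h]
  unfold coboundary
  rw [mul_comm x e, mul_comm x f]
  ext
  push_cast
  field_simp

theorem IsTwistedPullback.square_eq (h : IsTwistedPullback p J Φ Ψ) (x y z w : H) :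
    Ψ y z w * Ψ x z (y * w) / (Ψ x y (z * w) * Ψ z y w) * J (x * z) (y * w) *
      (J x z * (J y z / J z y)) * J y w =
    J (x * y) (z * w) * (J x y * J z w) *
      (Φ (p y) (p z) (p w) * Φ (p x) (p z) (p y * p w) /
        (Φ (p x) (p y) (p z * p w) * Φ (p z) (p y) (p w))) := by
  rw [h, h, h, h]
  unfold coboundary
  rw [mul_comm z y, mul_left_comm z y w, map_mul, map_mul]
  ext
  push_cast
  field_simp

end CochainIdentities

section CochainScale

variable {k : Type u} [Field k] {G : Type v} [CommGroup G] [Fintype G] [DecidableEq G]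

/-- The operator `a ⊗ b ↦ J(deg a, deg b) a ⊗ b`. -/
def cochainScale (J : G → G → kˣ) (A B : YDData k G) :
    A.carrier ⊗[k] B.carrier →ₗ[k] A.carrier ⊗[k] B.carrier :=
  ∑ x : G, ∑ y : G, ((J x y : kˣ) : k) • TensorProduct.map (A.proj x) (B.proj y)

variable {J : G → G → kˣ} {A B : YDData k G}

theorem cochainScale_tmul (hA : IsGraded A) (hB : IsGraded B) {g h : G} {a : A.carrier}
    {b : B.carrier} (ha : A.IsHomogeneous g a) (hb : B.IsHomogeneous h b) :
    cochainScale J A B (a ⊗ₜ[k] b) = ((J g h : kˣ) : k) • (a ⊗ₜ[k] b) :=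
  sum_smul_map_tmul hA hB ha hb (fun x y => ((J x y : kˣ) : k)) LinearMap.id LinearMap.id

theorem cochainScale_inv (hA : IsGraded A) (hB : IsGraded B) (X : A.carrier ⊗[k] B.carrier) :
    cochainScale J⁻¹ A B (cochainScale J A B X) = X := by
  refine hA.tensor_induction_on hB
    (P := fun X => cochainScale J⁻¹ A B (cochainScale J A B X) = X) ?_ ?_ ?_ X
  · rw [map_zero, map_zero]
  · intro X Y hX hY
    rw [map_add, map_add, hX, hY]
  · intro g h a b ha hb
    rw [cochainScale_tmul hA hB ha hb, map_smul, cochainScale_tmul hA hB ha hb, smul_smul]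
    simp

theorem cochainScale_bijective (hA : IsGraded A) (hB : IsGraded B) :
    Function.Bijective (cochainScale J A B) :=
  Function.bijective_iff_has_inverse.mpr ⟨cochainScale J⁻¹ A B, cochainScale_inv hA hB,
    fun X => by simpa using cochainScale_inv (J := J⁻¹) hA hB X⟩

end CochainScale

section TwistedMap

variable {k : Type u} [Field k] {G : Type v} [CommGroup G] [Fintype G] [DecidableEq G]
  {H : Type w} [CommGroup H] [Fintype H] [DecidableEq H]

/-- A linear map `f : W → V` from an `H`-graded space with operators to a `G`-graded one, which
multiplies degrees by `p : H → G` and intertwines the actions up to the scalars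
`J(x, h) / J(h, x)`. -/
structure IsTwistedMap (p : H →* G) (J : H → H → kˣ) (W : YDData k H) (V : YDData k G)
    (f : W.carrier →ₗ[k] V.carrier) : Prop where
  map_homog : ∀ h w, W.IsHomogeneous h w → V.IsHomogeneous (p h) (f w)
  map_act : ∀ x h w, W.IsHomogeneous h w →
    f (W.act x w) = ((J x h / J h x : kˣ) : k) • V.act (p x) (f w)

/-- A map of Hopf algebras up to the `2`-cochain `J`: it is multiplicative up to `J` and
comultiplicative up to `J⁻¹`. For `J = 1` it preserves all structure maps; for `p = id` it is a
morphism `B → A^J`. -/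
structure IsTwistedHopfMap (p : H →* G) (J : H → H → kˣ) (B : HopfData k H) (A : HopfData k G)
    (φ : B.carrier →ₗ[k] A.carrier) : Prop
    extends IsTwistedMap p J B.toYDData A.toYDData φ where
  map_one : φ B.one = A.one
  map_mul : ∀ g h a b, B.IsHomogeneous g a → B.IsHomogeneous h b →
    φ (B.mul a b) = ((J g h : kˣ) : k) • A.mul (φ a) (φ b)
  map_comul : ∀ b, TensorProduct.map φ φ (cochainScale J B.toYDData B.toYDData (B.comul b)) =
    A.comul (φ b)
  map_counit : ∀ b, A.counit (φ b) = B.counit b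
  map_antipode : ∀ b, φ (B.antipode b) = A.antipode (φ b)

variable {p : H →* G} {J : H → H → kˣ} {Φ : G → G → G → kˣ} {Ψ : H → H → H → kˣ}

theorem IsTwistedMap.map_tensorSquareMul {B : YDData k H} {A : YDData k G}
    {φ : B.carrier →ₗ[k] A.carrier} (hφ : IsTwistedMap p J B A φ) (hB : IsGraded B)
    (hA : IsGraded A) (hΨ : IsTwistedPullback p J Φ Ψ)
    {mulB : B.carrier →ₗ[k] B.carrier →ₗ[k] B.carrier}
    {mulA : A.carrier →ₗ[k] A.carrier →ₗ[k] A.carrier}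
    (homog_mul : ∀ g h a b, B.IsHomogeneous g a → B.IsHomogeneous h b →
      B.IsHomogeneous (g * h) (mulB a b))
    (map_mul : ∀ g h a b, B.IsHomogeneous g a → B.IsHomogeneous h b →
      φ (mulB a b) = ((J g h : kˣ) : k) • mulA (φ a) (φ b))
    {g h : H} {X Y : B.carrier ⊗[k] B.carrier} (hX : (tensorObj Ψ B B).IsHomogeneous g X)
    (hY : (tensorObj Ψ B B).IsHomogeneous h Y) :
    TensorProduct.map φ φ (cochainScale J B B (tensorSquareMul Ψ B mulB (X ⊗ₜ[k] Y))) =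
      ((J g h : kˣ) : k) • tensorSquareMul Φ A mulA
        (TensorProduct.map φ φ (cochainScale J B B X) ⊗ₜ[k]
          TensorProduct.map φ φ (cochainScale J B B Y)) := by
  refine tensorObj_homog_induction hB hB (P := fun X =>
    TensorProduct.map φ φ (cochainScale J B B (tensorSquareMul Ψ B mulB (X ⊗ₜ[k] Y))) =
      ((J g h : kˣ) : k) • tensorSquareMul Φ A mulA
        (TensorProduct.map φ φ (cochainScale J B B X) ⊗ₜ[k]
          TensorProduct.map φ φ (cochainScale J B B Y))) ?_ ?_ ?_ hX
  · simp only [TensorProduct.zero_tmul, map_zero, smul_zero]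
  · intro X X' hX hX'
    simp only [TensorProduct.add_tmul, map_add, smul_add, hX, hX']
  intro x y a b ha hb hxy
  refine tensorObj_homog_induction hB hB (P := fun Y =>
    TensorProduct.map φ φ (cochainScale J B B (tensorSquareMul Ψ B mulB ((a ⊗ₜ b) ⊗ₜ[k] Y))) =
      ((J g h : kˣ) : k) • tensorSquareMul Φ A mulA
        (TensorProduct.map φ φ (cochainScale J B B (a ⊗ₜ b)) ⊗ₜ[k]
          TensorProduct.map φ φ (cochainScale J B B Y))) ?_ ?_ ?_ hY
  · simp only [TensorProduct.tmul_zero, map_zero, smul_zero]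
  · intro X X' hX hX'
    simp only [TensorProduct.tmul_add, map_add, smul_add, hX, hX']
  intro z w c d hc hd hzw
  have hyc := hB.homog_act y hc
  have key := congrArg (Units.val) (hΨ.square_eq x y z w)
  rw [Units.val_mul, Units.val_mul, Units.val_mul, Units.val_mul (_ * _) (_ / _)] at key
  rw [tensorSquareMul_tmul hB mulB ha hb hc hd, map_smul, map_smul,
    cochainScale_tmul hB hB (homog_mul _ _ _ _ ha hyc) (homog_mul _ _ _ _ hb hd), map_smul,
    TensorProduct.map_tmul, map_mul _ _ _ _ ha hyc, map_mul _ _ _ _ hb hd,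
    hφ.map_act y z c hc, cochainScale_tmul hB hB ha hb, cochainScale_tmul hB hB hc hd]
  simp only [← TensorProduct.smul_tmul', TensorProduct.tmul_smul, map_smul, smul_smul,
    TensorProduct.map_tmul]
  rw [tensorSquareMul_tmul hA mulA (hφ.map_homog _ _ ha) (hφ.map_homog _ _ hb)
    (hφ.map_homog _ _ hc) (hφ.map_homog _ _ hd), smul_smul, ← hxy, ← hzw]
  congr 1
  push_cast at key ⊢
  linear_combination key

end TwistedMap

section TensorAlgebraMap

variable {k : Type u} [Field k] {G : Type v} [CommGroup G] [Fintype G] [DecidableEq G]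
  {H : Type w} [CommGroup H] [Fintype H] [DecidableEq H]
  {p : H →* G} {J : H → H → kˣ} {Φ : G → G → G → kˣ} {Ψ : H → H → H → kˣ}
  {W : YDData k H} {V : YDData k G} {f : W.carrier →ₗ[k] V.carrier}

variable (J Φ Ψ) in
/-- The map `W^{⊗ n} → V^{⊗ n}` induced by `f`, with `t ⊗ w ↦ J(deg t, deg w) t ⊗ f(w)` at each
step; this is the restriction of the map between tensor algebras that extends `f` and is
multiplicative up to `J`. -/
def tpowMap (f : W.carrier →ₗ[k] V.carrier) :
    ∀ n : ℕ, (tpow Ψ W n).carrier →ₗ[k] (tpow Φ V n).carrier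
  | 0 => (LinearMap.id : k →ₗ[k] k)
  | n + 1 => tpowMk Φ V n ∘ₗ TensorProduct.map (tpowMap f n) f ∘ₗ
      cochainScale J (tpow Ψ W n) W

theorem tpowMap_succ (hW : IsGraded W) {n : ℕ} {g h : H} {t : (tpow Ψ W n).carrier}
    {w : W.carrier} (ht : (tpow Ψ W n).IsHomogeneous g t) (hw : W.IsHomogeneous h w) :
    tpowMap J Φ Ψ f (n + 1) (tpowMk Ψ W n (t ⊗ₜ[k] w)) =
      ((J g h : kˣ) : k) • tpowMk Φ V n (tpowMap J Φ Ψ f n t ⊗ₜ[k] f w) := by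
  change tpowMk Φ V n (TensorProduct.map (tpowMap J Φ Ψ f n) f
    (cochainScale J (tpow Ψ W n) W (t ⊗ₜ[k] w))) = _
  rw [cochainScale_tmul (isGraded_tpow hW n) hW ht hw, map_smul, map_smul,
    TensorProduct.map_tmul]

theorem tpowMap_bijective (hW : IsGraded W) (hf : Function.Bijective f) :
    ∀ n, Function.Bijective (tpowMap J Φ Ψ f n)
  | 0 => Function.bijective_id
  | n + 1 => by
    have h1 := (LinearEquiv.bijective (TensorProduct.congr
      (LinearEquiv.ofBijective _ (tpowMap_bijective hW hf n)) (LinearEquiv.ofBijective f hf)))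
    exact (tpowMk_bijective n).comp (h1.comp (cochainScale_bijective (isGraded_tpow hW n) hW))

theorem IsTwistedMap.homog_tpowMap (hf : IsTwistedMap p J W V f) (hW : IsGraded W)
    (hV : IsGraded V) : ∀ (n : ℕ) {h : H} {t : (tpow Ψ W n).carrier},
      (tpow Ψ W n).IsHomogeneous h t → (tpow Φ V n).IsHomogeneous (p h) (tpowMap J Φ Ψ f n t)
  | 0, h, t, ht => by
    rcases eq_one_or_eq_zero_of_homog hW ht with rfl | rfl
    · rw [map_one]
      exact homog_tpow_zero _
    · rw [map_zero]
      exact .zero _ _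
  | n + 1, h, t, ht => by
    refine tpow_succ_homog_induction hW (P := fun t =>
      (tpow Φ V (n + 1)).IsHomogeneous (p h) (tpowMap J Φ Ψ f (n + 1) t)) ?_ ?_ ?_ ht
    · rw [map_zero]
      exact .zero _ _
    · intro X Y hX hY
      rw [map_add]
      exact hX.add hY
    · intro x y t w ht hw hxy
      rw [tpowMap_succ hW ht hw, ← hxy, map_mul]
      exact (homog_tpowMk hV (hf.homog_tpowMap hW hV n ht) (hf.map_homog _ _ hw)).smul _

theorem IsTwistedMap.tpowMap_act (hf : IsTwistedMap p J W V f) (hW : IsGraded W)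
    (hV : IsGraded V) (hΨ : IsTwistedPullback p J Φ Ψ) (hJ : ∀ g, J g 1 = 1 ∧ J 1 g = 1)
    (x : H) : ∀ (n : ℕ) {h : H} {t : (tpow Ψ W n).carrier}, (tpow Ψ W n).IsHomogeneous h t →
      tpowMap J Φ Ψ f n ((tpow Ψ W n).act x t) =
        ((J x h / J h x : kˣ) : k) • (tpow Φ V n).act (p x) (tpowMap J Φ Ψ f n t)
  | 0, h, t, ht => by
    rcases eq_one_or_eq_zero_of_homog hW ht with rfl | rfl
    · rw [(hJ x).1, (hJ x).2, div_one, Units.val_one, one_smul]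
      rfl
    · rw [map_zero, map_zero, map_zero, smul_zero]
  | n + 1, h, t, ht => by
    refine tpow_succ_homog_induction hW (P := fun t =>
      tpowMap J Φ Ψ f (n + 1) ((tpow Ψ W (n + 1)).act x t) =
        ((J x h / J h x : kˣ) : k) • (tpow Φ V (n + 1)).act (p x) (tpowMap J Φ Ψ f (n + 1) t))
      ?_ ?_ ?_ ht
    · simp only [map_zero, smul_zero]
    · intro X Y hX hY
      simp only [map_add, smul_add, hX, hY]
    · intro y z t w ht hw hyz
      have hy := (isGraded_tpow (Φ := Ψ) hW n).homog_act x ht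
      have hz := hW.homog_act x hw
      have key := congrArg (Units.val) (hΨ.tilde_eq x y z)
      rw [tpow_act_tpowMk hW ht hw, map_smul, tpowMap_succ hW hy hz, tpowMap_succ hW ht hw,
        map_smul, tpow_act_tpowMk hV (hf.homog_tpowMap hW hV n ht) (hf.map_homog _ _ hw),
        hf.tpowMap_act hW hV hΨ hJ x n ht, hf.map_act x z w hw]
      simp only [← TensorProduct.smul_tmul', TensorProduct.tmul_smul, map_smul, smul_smul]
      rw [← hyz]
      congr 1
      push_cast at key ⊢
      linear_combination key

theorem IsTwistedMap.tpowMap_powMul (hf : IsTwistedMap p J W V f) (hW : IsGraded W)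
    (hV : IsGraded V) (hΨ : IsTwistedPullback p J Φ Ψ) (hJ : ∀ g, J g 1 = 1 ∧ J 1 g = 1)
    {n : ℕ} {g : H} {t : (tpow Ψ W n).carrier} (ht : (tpow Ψ W n).IsHomogeneous g t) :
    ∀ (m : ℕ) {h : H} {s : (tpow Ψ W m).carrier}, (tpow Ψ W m).IsHomogeneous h s →
      tpowMap J Φ Ψ f (n + m) (powMul Ψ W n m (t ⊗ₜ[k] s)) = ((J g h : kˣ) : k) •
        powMul Φ V n m (tpowMap J Φ Ψ f n t ⊗ₜ[k] tpowMap J Φ Ψ f m s)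
  | 0, h, s, hs => by
    have h1 : powMul Ψ W n 0 (t ⊗ₜ[k] s) = (show k from s) • t := powMul_zero n t (show k from s)
    have h2 : powMul Φ V n 0 (tpowMap J Φ Ψ f n t ⊗ₜ[k] tpowMap J Φ Ψ f 0 s) =
      (show k from s) • tpowMap J Φ Ψ f n t := powMul_zero n _ (show k from s)
    rcases eq_one_or_eq_zero_of_homog hW hs with rfl | rfl
    · rw [h1, h2, (hJ g).1, Units.val_one, one_smul]
      exact map_smul _ _ _
    · simp only [TensorProduct.tmul_zero, map_zero, smul_zero]
  | m + 1, h, s, hs => by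
    refine tpow_succ_homog_induction hW (P := fun s =>
      tpowMap J Φ Ψ f (n + (m + 1)) (powMul Ψ W n (m + 1) (t ⊗ₜ[k] s)) = ((J g h : kˣ) : k) •
        powMul Φ V n (m + 1) (tpowMap J Φ Ψ f n t ⊗ₜ[k] tpowMap J Φ Ψ f (m + 1) s))
      ?_ ?_ ?_ hs
    · simp only [TensorProduct.tmul_zero, map_zero, smul_zero]
    · intro X Y hX hY
      simp only [TensorProduct.tmul_add, map_add, smul_add, hX, hY]
    · intro y z s w hs hw hyz
      have h1 : tpowMap J Φ Ψ f (n + (m + 1))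
          (powMul Ψ W n (m + 1) (t ⊗ₜ[k] tpowMk Ψ W m (s ⊗ₜ[k] w))) =
          (((Ψ g y z * (J (g * y) z * J g y) : kˣ)) : k) • tpowMk Φ V (n + m)
            (powMul Φ V n m (tpowMap J Φ Ψ f n t ⊗ₜ[k] tpowMap J Φ Ψ f m s) ⊗ₜ[k] f w) := by
        have h3 := tpowMap_succ (J := J) (Φ := Φ) (f := f) hW (homog_powMul hW ht m hs) hw
        rw [powMul_succ hW ht hs hw]
        refine (map_smul (tpowMap J Φ Ψ f (n + m + 1)) _ _).trans ?_
        rw [h3, hf.tpowMap_powMul hW hV hΨ hJ ht m hs]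
        simp only [← TensorProduct.smul_tmul', map_smul, smul_smul]
        push_cast
        rfl
      rw [h1, tpowMap_succ hW hs hw, TensorProduct.tmul_smul, map_smul,
        powMul_succ hV (hf.homog_tpowMap hW hV n ht) (hf.homog_tpowMap hW hV m hs)
          (hf.map_homog _ _ hw), smul_smul]
      refine Eq.trans ?_ (smul_smul _ _ _).symm
      congr 1
      rw [hΨ, ← hyz]
      unfold coboundary
      push_cast
      field_simp

variable (J Φ Ψ) in
/-- The map between tensor algebras that extends `f` and is multiplicative up to `J`. -/
def tensorAlgMap (f : W.carrier →ₗ[k] V.carrier) :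
    (tensorAlgObj Ψ W).carrier →ₗ[k] (tensorAlgObj Φ V).carrier :=
  DirectSum.lmap (tpowMap J Φ Ψ f)

theorem tensorAlgMap_tIncl (n : ℕ) (t : (tpow Ψ W n).carrier) :
    tensorAlgMap J Φ Ψ f (tIncl Ψ W n t) = tIncl Φ V n (tpowMap J Φ Ψ f n t) :=
  DirectSum.lmap_lof _ _ _

theorem tensorAlgMap_bijective (hW : IsGraded W) (hf : Function.Bijective f) :
    Function.Bijective (tensorAlgMap J Φ Ψ f) :=
  ⟨(DirectSum.lmap_injective _).mpr fun n => (tpowMap_bijective hW hf n).1,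
    (DirectSum.lmap_surjective _).mpr fun n => (tpowMap_bijective hW hf n).2⟩

theorem tensorAlgMap_tComp (n : ℕ) (a : (tensorAlgObj Ψ W).carrier) :
    tensorAlgMap J Φ Ψ f (tComp Ψ W n a) = tComp Φ V n (tensorAlgMap J Φ Ψ f a) := by
  refine tensorAlgObj_induction (P := fun a =>
    tensorAlgMap J Φ Ψ f (tComp Ψ W n a) = tComp Φ V n (tensorAlgMap J Φ Ψ f a)) ?_ ?_ ?_ a
  · simp only [map_zero]
  · intro X Y hX hY
    simp only [map_add, hX, hY]
  · intro m t
    rw [tComp_tIncl, tensorAlgMap_tIncl, tComp_tIncl]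
    split_ifs
    · rw [tensorAlgMap_tIncl]
    · rw [map_zero]

theorem tensorAlgMap_tGen (hW : IsGraded W) (hJ : ∀ g, J g 1 = 1 ∧ J 1 g = 1)
    (w : W.carrier) : tensorAlgMap J Φ Ψ f (tGen Ψ W w) = tGen Φ V (f w) := by
  refine hW.induction_on (P := fun w =>
    tensorAlgMap J Φ Ψ f (tGen Ψ W w) = tGen Φ V (f w)) ?_ ?_ ?_ w
  · simp only [map_zero]
  · intro X Y hX hY
    simp only [map_add, hX, hY]
  · intro g w hw
    change tensorAlgMap J Φ Ψ f (tIncl Ψ W 1 (tpowMk Ψ W 0 ((1 : k) ⊗ₜ[k] w))) =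
      tIncl Φ V 1 (tpowMk Φ V 0 ((1 : k) ⊗ₜ[k] f w))
    rw [tensorAlgMap_tIncl]
    refine congrArg (tIncl Φ V 1) ?_
    refine (tpowMap_succ hW (homog_tpow_zero 1) hw).trans ?_
    rw [(hJ g).2, Units.val_one, one_smul]
    rfl

theorem IsTwistedMap.map_tensorAlg (hf : IsTwistedMap p J W V f) (hW : IsGraded W)
    (hV : IsGraded V) (hΨ : IsTwistedPullback p J Φ Ψ) (hJ : ∀ g, J g 1 = 1 ∧ J 1 g = 1) :
    IsTwistedMap p J (tensorAlgObj Ψ W) (tensorAlgObj Φ V) (tensorAlgMap J Φ Ψ f) where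
  map_homog h a ha := by
    refine tensorAlgObj_homog_induction hW (P := fun a =>
      (tensorAlgObj Φ V).IsHomogeneous (p h) (tensorAlgMap J Φ Ψ f a)) ?_ ?_ ?_ ha
    · rw [map_zero]
      exact .zero _ _
    · intro X Y hX hY
      rw [map_add]
      exact hX.add hY
    · intro n t ht
      rw [tensorAlgMap_tIncl]
      exact homog_tIncl (hf.homog_tpowMap hW hV n ht)
  map_act x h a ha := by
    refine tensorAlgObj_homog_induction hW (P := fun a => tensorAlgMap J Φ Ψ f
      ((tensorAlgObj Ψ W).act x a) = ((J x h / J h x : kˣ) : k) •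
        (tensorAlgObj Φ V).act (p x) (tensorAlgMap J Φ Ψ f a)) ?_ ?_ ?_ ha
    · simp only [map_zero, smul_zero]
    · intro X Y hX hY
      simp only [map_add, smul_add, hX, hY]
    · intro n t ht
      rw [tensorAlgObj_act_tIncl, tensorAlgMap_tIncl, tensorAlgMap_tIncl, tensorAlgObj_act_tIncl,
        hf.tpowMap_act hW hV hΨ hJ x n ht, map_smul]

theorem IsTwistedMap.tensorAlgMap_tMul (hf : IsTwistedMap p J W V f) (hW : IsGraded W)
    (hV : IsGraded V) (hΨ : IsTwistedPullback p J Φ Ψ) (hJ : ∀ g, J g 1 = 1 ∧ J 1 g = 1)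
    (g h : H) (a b : (tensorAlgObj Ψ W).carrier) (ha : (tensorAlgObj Ψ W).IsHomogeneous g a)
    (hb : (tensorAlgObj Ψ W).IsHomogeneous h b) :
    tensorAlgMap J Φ Ψ f (tMul Ψ W a b) = ((J g h : kˣ) : k) •
      tMul Φ V (tensorAlgMap J Φ Ψ f a) (tensorAlgMap J Φ Ψ f b) := by
  refine tensorAlgObj_homog_induction hW (P := fun a =>
    tensorAlgMap J Φ Ψ f (tMul Ψ W a b) = ((J g h : kˣ) : k) •
      tMul Φ V (tensorAlgMap J Φ Ψ f a) (tensorAlgMap J Φ Ψ f b))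
      ?_ ?_ ?_ ha
  · simp only [map_zero, smul_zero, LinearMap.zero_apply]
  · intro X Y hX hY
    simp only [map_add, smul_add, LinearMap.add_apply, hX, hY]
  intro n t ht
  refine tensorAlgObj_homog_induction hW (P := fun b =>
    tensorAlgMap J Φ Ψ f (tMul Ψ W (tIncl Ψ W n t) b) = ((J g h : kˣ) : k) •
      tMul Φ V (tensorAlgMap J Φ Ψ f (tIncl Ψ W n t))
        (tensorAlgMap J Φ Ψ f b)) ?_ ?_ ?_ hb
  · simp only [map_zero, smul_zero]
  · intro X Y hX hY
    simp only [map_add, smul_add, hX, hY]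
  · intro m s hs
    rw [tMul_tIncl, tensorAlgMap_tIncl, tensorAlgMap_tIncl, tensorAlgMap_tIncl, tMul_tIncl,
      hf.tpowMap_powMul hW hV hΨ hJ ht m hs, map_smul]

theorem IsTwistedMap.map_powComul (hf : IsTwistedMap p J W V f) (hW : IsGraded W)
    (hV : IsGraded V) (hΨ : IsTwistedPullback p J Φ Ψ) (hJ : ∀ g, J g 1 = 1 ∧ J 1 g = 1) :
    ∀ (n : ℕ) (t : (tpow Ψ W n).carrier),
      TensorProduct.map (tensorAlgMap J Φ Ψ f) (tensorAlgMap J Φ Ψ f)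
        (cochainScale J (tensorAlgObj Ψ W) (tensorAlgObj Ψ W) (powComul Ψ W n t)) =
      powComul Φ V n (tpowMap J Φ Ψ f n t) := by
  have hTW := isGraded_tensorAlgObj (Φ := Ψ) hW
  have hTV := isGraded_tensorAlgObj (Φ := Φ) hV
  have h1 : tensorAlgMap J Φ Ψ f (tOne Ψ W) = tOne Φ V := tensorAlgMap_tIncl 0 _
  intro n
  induction n with
  | zero =>
    intro t
    change TensorProduct.map (tensorAlgMap J Φ Ψ f) (tensorAlgMap J Φ Ψ f)
        (cochainScale J (tensorAlgObj Ψ W) (tensorAlgObj Ψ W)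
          ((show k from t) • (tOne Ψ W ⊗ₜ[k] tOne Ψ W))) =
      (show k from t) • (tOne Φ V ⊗ₜ[k] tOne Φ V)
    rw [map_smul, map_smul, cochainScale_tmul hTW hTW homog_tOne homog_tOne, (hJ 1).1,
      Units.val_one, one_smul, TensorProduct.map_tmul, h1]
  | succ n ih =>
    intro t
    refine tpow_succ_induction hW (P := fun t =>
      TensorProduct.map (tensorAlgMap J Φ Ψ f) (tensorAlgMap J Φ Ψ f)
        (cochainScale J (tensorAlgObj Ψ W) (tensorAlgObj Ψ W) (powComul Ψ W (n + 1) t)) =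
      powComul Φ V (n + 1) (tpowMap J Φ Ψ f (n + 1) t)) ?_ ?_ ?_ t
    · simp only [map_zero]
    · intro X Y hX hY
      simp only [map_add, hX, hY]
    · intro g h t w ht hw
      have h2 : TensorProduct.map (tensorAlgMap J Φ Ψ f)
          (tensorAlgMap J Φ Ψ f)
          (cochainScale J (tensorAlgObj Ψ W) (tensorAlgObj Ψ W) (genComul Ψ W w)) =
          genComul Φ V (f w) := by
        rw [genComul_apply, genComul_apply, map_add,
          cochainScale_tmul hTW hTW (homog_tGen hW hw) homog_tOne,
          cochainScale_tmul hTW hTW homog_tOne (homog_tGen hW hw), (hJ h).1, (hJ h).2,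
          Units.val_one, one_smul, one_smul, map_add, TensorProduct.map_tmul,
          TensorProduct.map_tmul, h1, tensorAlgMap_tGen hW hJ]
      rw [powComul_succ, (hf.map_tensorAlg hW hV hΨ hJ).map_tensorSquareMul hTW hTV hΨ
        (fun _ _ _ _ ha hb => homog_tMul hW ha hb) (hf.tensorAlgMap_tMul hW hV hΨ hJ)
        (homog_powComul hW n ht) (homog_genComul hW hw), ih, h2, tpowMap_succ hW ht hw, map_smul,
        powComul_succ]

theorem IsTwistedMap.map_powAntipode (hf : IsTwistedMap p J W V f) (hW : IsGraded W)
    (hV : IsGraded V) (hΨ : IsTwistedPullback p J Φ Ψ) (hJ : ∀ g, J g 1 = 1 ∧ J 1 g = 1) :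
    ∀ (n : ℕ) (t : (tpow Ψ W n).carrier),
      tensorAlgMap J Φ Ψ f (powAntipode Ψ W n t) =
        powAntipode Φ V n (tpowMap J Φ Ψ f n t) := by
  have hTW := isGraded_tensorAlgObj (Φ := Ψ) hW
  have hTf := hf.map_tensorAlg hW hV hΨ hJ
  intro n
  induction n with
  | zero => exact fun t => tensorAlgMap_tIncl 0 t
  | succ n ih =>
    intro t
    refine tpow_succ_induction hW (P := fun t =>
      tensorAlgMap J Φ Ψ f (powAntipode Ψ W (n + 1) t) =
        powAntipode Φ V (n + 1) (tpowMap J Φ Ψ f (n + 1) t)) ?_ ?_ ?_ t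
    · simp only [map_zero]
    · intro X Y hX hY
      simp only [map_add, hX, hY]
    · intro g h t w ht hw
      have hS := homog_powAntipode hW n ht
      have hw' := (homog_tGen (Φ := Ψ) hW hw).neg
      rw [powAntipode_succ hW hS, hf.tensorAlgMap_tMul hW hV hΨ hJ h g _ _
        (hTW.homog_act g hw') hS, hTf.map_act g h _ hw', map_neg,
        tensorAlgMap_tGen hW hJ, ih, tpowMap_succ hW ht hw,
        map_smul (powAntipode Φ V (n + 1)),
        powAntipode_succ hV (homog_powAntipode hV n (hf.homog_tpowMap hW hV n ht)), map_smul,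
        LinearMap.smul_apply, smul_smul]
      congr 1
      push_cast
      field_simp

/-- The map between tensor algebras induced by a twisted map of generating spaces respects the
Hopf structures. -/
theorem IsTwistedMap.isTwistedHopfMap (hf : IsTwistedMap p J W V f) (hW : IsGraded W)
    (hV : IsGraded V) (hΨ : IsTwistedPullback p J Φ Ψ) (hJ : ∀ g, J g 1 = 1 ∧ J 1 g = 1) :
    IsTwistedHopfMap p J (tensorAlg Ψ W) (tensorAlg Φ V)
      (tensorAlgMap J Φ Ψ f) where
  toIsTwistedMap := hf.map_tensorAlg hW hV hΨ hJ
  map_one := tensorAlgMap_tIncl 0 _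
  map_mul := hf.tensorAlgMap_tMul hW hV hΨ hJ
  map_comul b := by
    refine tensorAlgObj_induction (P := fun b => TensorProduct.map
      (tensorAlgMap J Φ Ψ f) (tensorAlgMap J Φ Ψ f)
      (cochainScale J (tensorAlgObj Ψ W) (tensorAlgObj Ψ W) (tLift Ψ W (powComul Ψ W) b)) =
      tLift Φ V (powComul Φ V) (tensorAlgMap J Φ Ψ f b)) ?_ ?_ ?_ b
    · simp only [map_zero]
    · intro X Y hX hY
      simp only [map_add, hX, hY]
    · intro n t
      rw [tLift_tIncl, tensorAlgMap_tIncl, tLift_tIncl, hf.map_powComul hW hV hΨ hJ]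
  map_counit b := by
    refine tensorAlgObj_induction (P := fun b => tLift Φ V (powCounit Φ V)
      (tensorAlgMap J Φ Ψ f b) = tLift Ψ W (powCounit Ψ W) b) ?_ ?_ ?_ b
    · simp only [map_zero]
    · intro X Y hX hY
      simp only [map_add, hX, hY]
    · intro n t
      rw [tensorAlgMap_tIncl, tLift_tIncl, tLift_tIncl]
      cases n <;> rfl
  map_antipode b := by
    refine tensorAlgObj_induction (P := fun b => tensorAlgMap J Φ Ψ f
      (tLift Ψ W (powAntipode Ψ W) b) =
      tLift Φ V (powAntipode Φ V) (tensorAlgMap J Φ Ψ f b)) ?_ ?_ ?_ b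
    · simp only [map_zero]
    · intro X Y hX hY
      simp only [map_add, hX, hY]
    · intro n t
      rw [tLift_tIncl, tensorAlgMap_tIncl, tLift_tIncl, hf.map_powAntipode hW hV hΨ hJ]

end TensorAlgebraMap

/-! ### Transport of Hopf ideals and of Nichols algebras -/

section Coideal

variable {k : Type u} [Field k] {M N : Type u} [AddCommGroup M] [Module k M] [AddCommGroup N]
  [Module k N]

/-- The subspace `I ⊗ M + M ⊗ I` of `M ⊗ M`. -/
def coidealSpan (I : Submodule k M) : Submodule k (M ⊗[k] M) :=
  LinearMap.range (TensorProduct.map I.subtype (LinearMap.id : M →ₗ[k] M)) ⊔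
    LinearMap.range (TensorProduct.map (LinearMap.id : M →ₗ[k] M) I.subtype)

theorem tmul_mem_coidealSpan_left {I : Submodule k M} {x : M} (hx : x ∈ I) (y : M) :
    x ⊗ₜ[k] y ∈ coidealSpan I :=
  Submodule.mem_sup_left ⟨⟨x, hx⟩ ⊗ₜ[k] y, rfl⟩

theorem tmul_mem_coidealSpan_right {I : Submodule k M} {x : M} (hx : x ∈ I) (y : M) :
    y ⊗ₜ[k] x ∈ coidealSpan I :=
  Submodule.mem_sup_right ⟨y ⊗ₜ[k] ⟨x, hx⟩, rfl⟩

theorem coidealSpan_le {I : Submodule k M} {Q : Submodule k (M ⊗[k] M)}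
    (hl : ∀ x ∈ I, ∀ y, x ⊗ₜ[k] y ∈ Q) (hr : ∀ x ∈ I, ∀ y, y ⊗ₜ[k] x ∈ Q) :
    coidealSpan I ≤ Q := by
  refine sup_le ?_ ?_
  · rintro _ ⟨X, rfl⟩
    induction X using TensorProduct.induction_on with
    | zero => simp
    | tmul x y => exact hl x x.2 y
    | add X Y hX hY => rw [map_add]; exact Q.add_mem hX hY
  · rintro _ ⟨X, rfl⟩
    induction X using TensorProduct.induction_on with
    | zero => simp
    | tmul x y => exact hr y y.2 x
    | add X Y hX hY => rw [map_add]; exact Q.add_mem hX hY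

theorem map_mem_coidealSpan {I : Submodule k M} {I' : Submodule k N} {f g : M →ₗ[k] N}
    (hf : ∀ x ∈ I, f x ∈ I') (hg : ∀ x ∈ I, g x ∈ I') {X : M ⊗[k] M}
    (hX : X ∈ coidealSpan I) : TensorProduct.map f g X ∈ coidealSpan I' := by
  refine coidealSpan_le (Q := (coidealSpan I').comap (TensorProduct.map f g)) ?_ ?_ hX
  · exact fun x hx y => tmul_mem_coidealSpan_left (hf x hx) _
  · exact fun x hx y => tmul_mem_coidealSpan_right (hg x hx) _

end Coideal

section HopfIdeals

variable {k : Type u} [Field k] {G : Type v} [CommGroup G] [Fintype G] [DecidableEq G]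
  {H : Type w} [CommGroup H] [Fintype H] [DecidableEq H]
  {p : H →* G} {J : H → H → kˣ} {Ψ : H → H → H → kˣ}
  {B : HopfData k H} {A : HopfData k G} {φ : B.carrier →ₗ[k] A.carrier}

theorem IsHopfIdeal.cochainScale_mem {I : Submodule k B.carrier} (hI : IsHopfIdeal B I)
    {X : B.carrier ⊗[k] B.carrier} (hX : X ∈ coidealSpan I) :
    cochainScale J B.toYDData B.toYDData X ∈ coidealSpan I := by
  rw [cochainScale, LinearMap.sum_apply]
  refine Submodule.sum_mem _ fun x _ => ?_
  rw [LinearMap.sum_apply]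
  refine Submodule.sum_mem _ fun y _ => Submodule.smul_mem _ _ ?_
  exact map_mem_coidealSpan (hI.proj_mem x) (hI.proj_mem y) hX

theorem IsTwistedHopfMap.mul_eq (hφ : IsTwistedHopfMap p J B A φ) {g h : H} {a b : B.carrier}
    (ha : B.IsHomogeneous g a) (hb : B.IsHomogeneous h b) :
    A.mul (φ a) (φ b) = φ ((((J g h)⁻¹ : kˣ) : k) • B.mul a b) := by
  rw [map_smul, hφ.map_mul g h a b ha hb, smul_smul]
  simp

theorem IsTwistedHopfMap.act_eq (hφ : IsTwistedHopfMap p J B A φ) {x h : H} {b : B.carrier}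
    (hb : B.IsHomogeneous h b) :
    A.act (p x) (φ b) = φ (((J h x / J x h : kˣ) : k) • B.act x b) := by
  rw [map_smul, hφ.map_act x h b hb, smul_smul, ← Units.val_mul]
  simp

/-- The image of a Hopf ideal under a surjective map of Hopf algebras up to a cochain. -/
theorem IsHopfIdeal.map (hφ : IsTwistedHopfMap p J B A φ) (hB : IsGraded B.toYDData)
    (hA : IsGraded A.toYDData) (hp : Function.Surjective p) (hs : Function.Surjective φ)
    {I : Submodule k B.carrier} (hI : IsHopfIdeal B I) : IsHopfIdeal A (I.map φ) where
  proj_mem g := by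
    rintro _ ⟨b, hb, rfl⟩
    rw [← hB.sum_proj b, map_sum, map_sum]
    refine Submodule.sum_mem _ fun h _ => ?_
    rw [hA.proj_apply (hφ.map_homog h _ (hB.homog_proj h b))]
    split_ifs
    · exact Submodule.mem_map_of_mem (hI.proj_mem h b hb)
    · exact Submodule.zero_mem _
  act_mem g := by
    rintro _ ⟨b, hb, rfl⟩
    obtain ⟨x, rfl⟩ := hp g
    rw [← hB.sum_proj b, map_sum, map_sum]
    refine Submodule.sum_mem _ fun h _ => ?_
    rw [hφ.act_eq (hB.homog_proj h b)]
    exact Submodule.mem_map_of_mem (Submodule.smul_mem _ _ (hI.act_mem x _ (hI.proj_mem h b hb)))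
  mul_mem_left a := by
    rintro _ ⟨b, hb, rfl⟩
    obtain ⟨a, rfl⟩ := hs a
    rw [← hB.sum_proj a, ← hB.sum_proj b, map_sum φ, map_sum φ, LinearMap.map_sum₂]
    refine Submodule.sum_mem _ fun g _ => ?_
    rw [map_sum]
    refine Submodule.sum_mem _ fun h _ => ?_
    rw [hφ.mul_eq (hB.homog_proj g a) (hB.homog_proj h b)]
    exact Submodule.mem_map_of_mem
      (Submodule.smul_mem _ _ (hI.mul_mem_left _ _ (hI.proj_mem h b hb)))
  mul_mem_right a := by
    rintro _ ⟨b, hb, rfl⟩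
    obtain ⟨a, rfl⟩ := hs a
    rw [← hB.sum_proj a, ← hB.sum_proj b, map_sum φ, map_sum φ, LinearMap.map_sum₂]
    refine Submodule.sum_mem _ fun g _ => ?_
    rw [map_sum]
    refine Submodule.sum_mem _ fun h _ => ?_
    rw [hφ.mul_eq (hB.homog_proj g b) (hB.homog_proj h a)]
    exact Submodule.mem_map_of_mem
      (Submodule.smul_mem _ _ (hI.mul_mem_right _ _ (hI.proj_mem g b hb)))
  comul_mem := by
    rintro _ ⟨b, hb, rfl⟩
    rw [← hφ.map_comul]
    exact map_mem_coidealSpan (fun x hx => Submodule.mem_map_of_mem hx)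
      (fun x hx => Submodule.mem_map_of_mem hx) (hI.cochainScale_mem (hI.comul_mem b hb))
  counit_eq_zero := by
    rintro _ ⟨b, hb, rfl⟩
    rw [hφ.map_counit, hI.counit_eq_zero b hb]
  antipode_mem := by
    rintro _ ⟨b, hb, rfl⟩
    rw [← hφ.map_antipode]
    exact Submodule.mem_map_of_mem (hI.antipode_mem b hb)

/-- The smallest graded subspace that contains `K`: the sum of the spaces of homogeneous
components of elements of `K`. -/
def homogSpan (B : YDData k H) (K : Submodule k B.carrier) : Submodule k B.carrier :=
  ⨆ h, K.map (B.proj h)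

theorem proj_mem_homogSpan {B : YDData k H} {K : Submodule k B.carrier} (h : H) {b : B.carrier}
    (hb : b ∈ K) : B.proj h b ∈ homogSpan B K :=
  Submodule.mem_iSup_of_mem h (Submodule.mem_map_of_mem hb)

theorem homogSpan_le {B : YDData k H} {K Q : Submodule k B.carrier}
    (h : ∀ h, ∀ b ∈ K, B.proj h b ∈ Q) : homogSpan B K ≤ Q :=
  iSup_le fun g => Submodule.map_le_iff_le_comap.mpr (h g)

theorem le_homogSpan {B : YDData k H} (hB : IsGraded B) (K : Submodule k B.carrier) :
    K ≤ homogSpan B K := by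
  intro b hb
  rw [← hB.sum_proj b]
  exact Submodule.sum_mem _ fun h _ => proj_mem_homogSpan h hb

theorem map_proj_eq_zero {B : YDData k H} (hB : IsGraded B) {h u v : H}
    {X : B.carrier ⊗[k] B.carrier} (hX : (tensorObj Ψ B B).IsHomogeneous h X) (huv : u * v ≠ h) :
    TensorProduct.map (B.proj u) (B.proj v) X = 0 := by
  refine tensorObj_homog_induction hB hB (P := fun X =>
    TensorProduct.map (B.proj u) (B.proj v) X = 0) ?_ ?_ ?_ hX
  · rw [map_zero]
  · intro X Y hX hY
    rw [map_add, hX, hY, add_zero]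
  · intro x y a b ha hb hxy
    rw [TensorProduct.map_tmul, hB.proj_apply ha, hB.proj_apply hb]
    split_ifs with h1 h2
    · exact absurd (by rw [h1, h2, hxy]) huv
    · rw [TensorProduct.tmul_zero]
    · rw [TensorProduct.zero_tmul]
    · rw [TensorProduct.zero_tmul]

theorem sum_map_proj {B : YDData k H} (hB : IsGraded B) (X : B.carrier ⊗[k] B.carrier) :
    ∑ u, ∑ v, TensorProduct.map (B.proj u) (B.proj v) X = X := by
  induction X using TensorProduct.induction_on with
  | zero => simp
  | add X Y hX hY =>
    simp_rw [map_add, Finset.sum_add_distrib]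
    rw [hX, hY]
  | tmul a b =>
    simp_rw [TensorProduct.map_tmul, ← TensorProduct.tmul_sum, ← TensorProduct.sum_tmul,
      hB.sum_proj]

theorem map_proj_cochainScale {B : YDData k H} (hB : IsGraded B) (u v : H)
    (X : B.carrier ⊗[k] B.carrier) :
    TensorProduct.map (B.proj u) (B.proj v) (cochainScale J B B X) =
      ((J u v : kˣ) : k) • TensorProduct.map (B.proj u) (B.proj v) X := by
  refine hB.tensor_induction_on hB (P := fun X =>
    TensorProduct.map (B.proj u) (B.proj v) (cochainScale J B B X) =
      ((J u v : kˣ) : k) • TensorProduct.map (B.proj u) (B.proj v) X) ?_ ?_ ?_ X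
  · simp only [map_zero, smul_zero]
  · intro X Y hX hY
    simp only [map_add, smul_add, hX, hY]
  · intro g h a b ha hb
    rw [cochainScale_tmul hB hB ha hb, map_smul, TensorProduct.map_tmul, hB.proj_apply ha,
      hB.proj_apply hb]
    split_ifs with h1 h2
    · rw [h1, h2]
    · simp only [TensorProduct.tmul_zero, smul_zero]
    · simp only [TensorProduct.zero_tmul, smul_zero]
    · simp only [TensorProduct.zero_tmul, smul_zero]

/-- The preimage of a Hopf ideal under a map of Hopf algebras up to a cochain need not be graded
by `H`, which is finer than the grading by `G`; its graded closure is a Hopf ideal. -/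
theorem IsHopfIdeal.homogSpan_comap (hφ : IsTwistedHopfMap p J B A φ) (hB : IsGradedHopf Ψ B)
    (hbij : Function.Bijective φ) {I : Submodule k A.carrier} (hI : IsHopfIdeal A I) :
    IsHopfIdeal B (homogSpan B.toYDData (I.comap φ)) where
  proj_mem g := by
    refine homogSpan_le (Q := (homogSpan B.toYDData (I.comap φ)).comap (B.proj g)) fun h b hb => ?_
    rw [Submodule.mem_comap, hB.isGraded.proj_proj]
    split_ifs
    · exact proj_mem_homogSpan h hb
    · exact Submodule.zero_mem _
  act_mem x := by
    refine homogSpan_le (Q := (homogSpan B.toYDData (I.comap φ)).comap (B.act x)) fun h b hb => ?_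
    let c : B.carrier := ∑ l, ((J l x / J x l : kˣ) : k) • B.act x (B.proj l b)
    have hc : c ∈ I.comap φ := by
      rw [Submodule.mem_comap, map_sum]
      simp_rw [← hφ.act_eq (hB.isGraded.homog_proj _ b)]
      rw [← map_sum, ← map_sum, hB.isGraded.sum_proj]
      exact hI.act_mem _ _ hb
    have hpc : B.proj h c = ((J h x / J x h : kˣ) : k) • B.act x (B.proj h b) := by
      simp only [c, map_sum, map_smul]
      rw [Finset.sum_eq_single h]
      · rw [hB.isGraded.homog_act x (hB.isGraded.homog_proj h b)]
      · intro l _ hl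
        rw [hB.isGraded.proj_apply (hB.isGraded.homog_act x (hB.isGraded.homog_proj l b)),
          if_neg (Ne.symm hl), smul_zero]
      · simp
    have := proj_mem_homogSpan (B := B.toYDData) h hc
    rw [hpc] at this
    rw [Submodule.mem_comap]
    exact (Submodule.smul_mem_iff _ (Units.ne_zero _)).mp this
  mul_mem_left a := by
    refine homogSpan_le (Q := (homogSpan B.toYDData (I.comap φ)).comap (B.mul a))
      fun h b hb => ?_
    refine hB.isGraded.induction_on (P := fun a =>
      B.mul a (B.proj h b) ∈ homogSpan B.toYDData (I.comap φ)) ?_ ?_ ?_ a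
    · rw [map_zero]
      exact Submodule.zero_mem _
    · intro a a' h1 h2
      rw [map_add]
      exact Submodule.add_mem _ h1 h2
    intro g a ha
    let c : B.carrier := ∑ l, (((J g l)⁻¹ : kˣ) : k) • B.mul a (B.proj l b)
    have hc : c ∈ I.comap φ := by
      rw [Submodule.mem_comap, map_sum]
      simp_rw [← hφ.mul_eq ha (hB.isGraded.homog_proj _ b)]
      rw [← map_sum, ← map_sum, hB.isGraded.sum_proj]
      exact hI.mul_mem_left _ _ hb
    have hpc : B.proj (g * h) c = (((J g h)⁻¹ : kˣ) : k) • B.mul a (B.proj h b) := by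
      simp only [c, map_sum, map_smul]
      rw [Finset.sum_eq_single h]
      · rw [hB.homog_mul g h _ _ ha (hB.isGraded.homog_proj h b)]
      · intro l _ hl
        rw [hB.isGraded.proj_apply (hB.homog_mul g l _ _ ha (hB.isGraded.homog_proj l b)),
          if_neg (fun e => hl (mul_left_cancel e).symm), smul_zero]
      · simp
    have := proj_mem_homogSpan (B := B.toYDData) (g * h) hc
    rw [hpc] at this
    exact (Submodule.smul_mem_iff _ (Units.ne_zero _)).mp this
  mul_mem_right a := by
    refine homogSpan_le (Q := (homogSpan B.toYDData (I.comap φ)).comap (B.mul.flip a))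
      fun h b hb => ?_
    refine hB.isGraded.induction_on (P := fun a =>
      B.mul (B.proj h b) a ∈ homogSpan B.toYDData (I.comap φ)) ?_ ?_ ?_ a
    · rw [map_zero]
      exact Submodule.zero_mem _
    · intro a a' h1 h2
      rw [map_add]
      exact Submodule.add_mem _ h1 h2
    intro g a ha
    let c : B.carrier := ∑ l, (((J l g)⁻¹ : kˣ) : k) • B.mul (B.proj l b) a
    have hc : c ∈ I.comap φ := by
      rw [Submodule.mem_comap, map_sum]
      simp_rw [← hφ.mul_eq (hB.isGraded.homog_proj _ b) ha]
      rw [← LinearMap.sum_apply, ← map_sum, ← map_sum, hB.isGraded.sum_proj]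
      exact hI.mul_mem_right _ _ hb
    have hpc : B.proj (h * g) c = (((J h g)⁻¹ : kˣ) : k) • B.mul (B.proj h b) a := by
      simp only [c, map_sum, map_smul]
      rw [Finset.sum_eq_single h]
      · rw [hB.homog_mul h g _ _ (hB.isGraded.homog_proj h b) ha]
      · intro l _ hl
        rw [hB.isGraded.proj_apply (hB.homog_mul l g _ _ (hB.isGraded.homog_proj l b) ha),
          if_neg (fun e => hl (mul_right_cancel e).symm), smul_zero]
      · simp
    have := proj_mem_homogSpan (B := B.toYDData) (h * g) hc
    rw [hpc] at this
    exact (Submodule.smul_mem_iff _ (Units.ne_zero _)).mp this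
  comul_mem := by
    refine homogSpan_le (Q := (coidealSpan (homogSpan B.toYDData (I.comap φ))).comap B.comul)
      fun h b hb => ?_
    let e := LinearEquiv.ofBijective φ hbij
    have hscale : cochainScale J B.toYDData B.toYDData (B.comul b) ∈ coidealSpan (I.comap φ) := by
      have h1 := map_mem_coidealSpan (I' := I.comap φ) (f := e.symm.toLinearMap)
        (g := e.symm.toLinearMap)
        (fun x hx => show φ (e.symm x) ∈ I from (e.apply_symm_apply x).symm ▸ hx)
        (fun x hx => show φ (e.symm x) ∈ I from (e.apply_symm_apply x).symm ▸ hx)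
        (hI.comul_mem _ hb)
      rw [← hφ.map_comul, ← LinearMap.comp_apply, ← TensorProduct.map_comp] at h1
      have h2 : e.symm.toLinearMap ∘ₗ φ = LinearMap.id :=
        LinearMap.ext fun x => e.symm_apply_apply x
      rwa [h2, TensorProduct.map_id] at h1
    have hcomp : ∀ u v, TensorProduct.map (B.proj u) (B.proj v) (B.comul b) ∈
        coidealSpan (homogSpan B.toYDData (I.comap φ)) := by
      intro u v
      have h1 := map_mem_coidealSpan (I' := homogSpan B.toYDData (I.comap φ))
        (f := B.proj u) (g := B.proj v) (fun _ hx => proj_mem_homogSpan u hx)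
        (fun _ hx => proj_mem_homogSpan v hx) hscale
      rw [map_proj_cochainScale hB.isGraded] at h1
      exact (Submodule.smul_mem_iff _ (Units.ne_zero _)).mp h1
    rw [Submodule.mem_comap, ← sum_map_proj hB.isGraded (B.comul _)]
    refine Submodule.sum_mem _ fun u _ => Submodule.sum_mem _ fun v _ => ?_
    have hne : ∀ l, u * v ≠ l →
        TensorProduct.map (B.proj u) (B.proj v) (B.comul (B.proj l b)) = 0 := fun l hl =>
      map_proj_eq_zero hB.isGraded (hB.homog_comul l _ (hB.isGraded.homog_proj l b)) hl
    by_cases huv : u * v = h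
    · have h1 := hcomp u v
      rw [← hB.isGraded.sum_proj b, map_sum, map_sum, Finset.sum_eq_single h] at h1
      · exact h1
      · exact fun l _ hl => hne l (huv.trans_ne (Ne.symm hl))
      · simp
    · rw [hne h huv]
      exact Submodule.zero_mem _
  counit_eq_zero := by
    refine homogSpan_le (Q := LinearMap.ker B.counit) fun h b hb => ?_
    have hne : ∀ l, l ≠ 1 → B.counit (B.proj l b) = 0 := fun l hl =>
      hB.counit_eq_zero l _ (hB.isGraded.homog_proj l b) hl
    rw [LinearMap.mem_ker]
    by_cases h1 : h = 1
    · have h2 := hI.counit_eq_zero _ hb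
      rw [hφ.map_counit, ← hB.isGraded.sum_proj b, map_sum, Finset.sum_eq_single 1] at h2
      · rwa [h1]
      · exact fun l _ hl => hne l hl
      · simp
    · exact hne h h1
  antipode_mem := by
    refine homogSpan_le (Q := (homogSpan B.toYDData (I.comap φ)).comap B.antipode)
      fun h b hb => ?_
    have h1 : B.proj h (B.antipode b) = B.antipode (B.proj h b) := by
      conv_lhs => rw [← hB.isGraded.sum_proj b]
      rw [map_sum, map_sum, Finset.sum_eq_single h]
      · exact hB.homog_antipode h _ (hB.isGraded.homog_proj h b)
      · intro l _ hl
        rw [hB.isGraded.proj_apply (hB.homog_antipode l _ (hB.isGraded.homog_proj l b)),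
          if_neg (Ne.symm hl)]
      · simp
    rw [Submodule.mem_comap, ← h1]
    refine proj_mem_homogSpan (B := B.toYDData) h ?_
    rw [Submodule.mem_comap, hφ.map_antipode]
    exact hI.antipode_mem _ hb

end HopfIdeals

section Quotient

variable {k : Type u} [Field k] {G : Type v} [CommGroup G] [Fintype G] [DecidableEq G]
  {H : Type w} [CommGroup H] [Fintype H] [DecidableEq H]
  {p : H →* G} {J : H → H → kˣ} {B : HopfData k H} {A : HopfData k G}
  {φ : B.carrier →ₗ[k] A.carrier}

theorem isGraded_quotient (hB : IsGraded B.toYDData) {I : Submodule k B.carrier}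
    (hI : IsHopfIdeal B I) : IsGraded (B.quotient I hI).toYDData where
  proj_proj g h v := by
    obtain ⟨b, rfl⟩ := I.mkQ_surjective v
    change I.mkQ (B.proj g (B.proj h b)) = if g = h then I.mkQ (B.proj h b) else 0
    rw [hB.proj_proj]
    split_ifs
    · rfl
    · exact map_zero _
  sum_proj v := by
    obtain ⟨b, rfl⟩ := I.mkQ_surjective v
    change ∑ g, I.mkQ (B.proj g b) = I.mkQ b
    rw [← map_sum, hB.sum_proj]
  proj_act g x v := by
    obtain ⟨b, rfl⟩ := I.mkQ_surjective v
    change I.mkQ (B.proj g (B.act x b)) = I.mkQ (B.act x (B.proj g b))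
    rw [hB.proj_act]

theorem exists_homog_of_quotient (hB : IsGraded B.toYDData) {I : Submodule k B.carrier}
    (hI : IsHopfIdeal B I) {g : H} {v : (B.quotient I hI).carrier}
    (hv : (B.quotient I hI).IsHomogeneous g v) : ∃ b, B.IsHomogeneous g b ∧ I.mkQ b = v := by
  obtain ⟨b, rfl⟩ := I.mkQ_surjective v
  exact ⟨B.proj g b, hB.homog_proj g b, hv⟩

theorem IsTwistedHopfMap.quotient (hφ : IsTwistedHopfMap p J B A φ) (hB : IsGraded B.toYDData)
    {I : Submodule k B.carrier} (hI : IsHopfIdeal B I) {I' : Submodule k A.carrier}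
    (hI' : IsHopfIdeal A I') (h : I ≤ I'.comap φ) :
    IsTwistedHopfMap p J (B.quotient I hI) (A.quotient I' hI') (I.mapQ I' φ h) where
  map_homog g v hv := by
    obtain ⟨b, hb, rfl⟩ := exists_homog_of_quotient hB hI hv
    exact congrArg I'.mkQ (hφ.map_homog g b hb)
  map_act x g v hv := by
    obtain ⟨b, hb, rfl⟩ := exists_homog_of_quotient hB hI hv
    exact congrArg I'.mkQ (hφ.map_act x g b hb)
  map_one := congrArg I'.mkQ hφ.map_one
  map_mul g h a b ha hb := by
    obtain ⟨a, ha', rfl⟩ := exists_homog_of_quotient hB hI ha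
    obtain ⟨b, hb', rfl⟩ := exists_homog_of_quotient hB hI hb
    exact congrArg I'.mkQ (hφ.map_mul g h a b ha' hb')
  map_comul v := by
    obtain ⟨b, rfl⟩ := I.mkQ_surjective v
    have hQ := isGraded_quotient hB hI
    let q : B.carrier →ₗ[k] (B.quotient I hI).carrier := I.mkQ
    have h1 : ∀ X, cochainScale J (B.quotient I hI).toYDData (B.quotient I hI).toYDData
        (TensorProduct.map q q X) =
        TensorProduct.map q q (cochainScale J B.toYDData B.toYDData X) := by
      intro X
      refine hB.tensor_induction_on hB (P := fun X =>
        cochainScale J (B.quotient I hI).toYDData (B.quotient I hI).toYDData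
          (TensorProduct.map q q X) =
        TensorProduct.map q q (cochainScale J B.toYDData B.toYDData X)) ?_ ?_ ?_ X
      · simp only [map_zero]
      · intro X Y hX hY
        simp only [map_add, hX, hY]
      · intro x y a b ha hb
        rw [cochainScale_tmul hB hB ha hb, map_smul]
        exact cochainScale_tmul hQ hQ (congrArg I.mkQ ha) (congrArg I.mkQ hb)
    let F : (B.quotient I hI).carrier →ₗ[k] (A.quotient I' hI').carrier := I.mapQ I' φ h
    let q' : A.carrier →ₗ[k] (A.quotient I' hI').carrier := I'.mkQ
    have h2 : F ∘ₗ q = q' ∘ₗ φ := rfl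
    change TensorProduct.map F F
      (cochainScale J (B.quotient I hI).toYDData (B.quotient I hI).toYDData
        (TensorProduct.map q q (B.comul b))) = TensorProduct.map q' q' (A.comul (φ b))
    rw [h1, ← hφ.map_comul]
    generalize cochainScale J B.toYDData B.toYDData (B.comul b) = X
    rw [← LinearMap.comp_apply, ← LinearMap.comp_apply,
      ← TensorProduct.map_comp, ← TensorProduct.map_comp, h2]
  map_counit v := by
    obtain ⟨b, rfl⟩ := I.mkQ_surjective v
    exact hφ.map_counit b
  map_antipode v := by
    obtain ⟨b, rfl⟩ := I.mkQ_surjective v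
    exact congrArg I'.mkQ (hφ.map_antipode b)

end Quotient

section Nichols

variable {k : Type u} [Field k] {G : Type v} [CommGroup G] [Fintype G] [DecidableEq G]
  {H : Type w} [CommGroup H] [Fintype H] [DecidableEq H]
  {p : H →* G} {J : H → H → kˣ} {Φ : G → G → G → kˣ} {Ψ : H → H → H → kˣ}

theorem tComp_proj {W : YDData k H} (n : ℕ) (h : H) (a : (tensorAlgObj Ψ W).carrier) :
    tComp Ψ W n ((tensorAlgObj Ψ W).proj h a) = (tensorAlgObj Ψ W).proj h (tComp Ψ W n a) := by
  refine tensorAlgObj_induction (P := fun a =>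
    tComp Ψ W n ((tensorAlgObj Ψ W).proj h a) = (tensorAlgObj Ψ W).proj h (tComp Ψ W n a))
    ?_ ?_ ?_ a
  · simp only [map_zero]
  · intro X Y hX hY
    simp only [map_add, hX, hY]
  · intro m t
    rw [tensorAlgObj_proj_tIncl, tComp_tIncl, tComp_tIncl]
    split_ifs
    · rw [tensorAlgObj_proj_tIncl]
    · rw [map_zero]

/-- A bijective twisted map of generating spaces identifies the maximal graded Hopf ideals of the
tensor algebras. -/
theorem IsTwistedMap.map_nicholsIdeal {W : YDData k H} {V : YDData k G}
    {f : W.carrier →ₗ[k] V.carrier} (hf : IsTwistedMap p J W V f) (hW : IsGraded W)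
    (hV : IsGraded V) (hΨ : IsTwistedPullback p J Φ Ψ) (hJ : ∀ g, J g 1 = 1 ∧ J 1 g = 1)
    (hp : Function.Surjective p) (hbij : Function.Bijective f) :
    (nicholsIdeal Ψ W).map (tensorAlgMap J Φ Ψ f) = nicholsIdeal Φ V := by
  have hφ := hf.isTwistedHopfMap hW hV hΨ hJ
  have hB := isGradedHopf_tensorAlg (Φ := Ψ) hW
  have hA := isGradedHopf_tensorAlg (Φ := Φ) hV
  have hφb := tensorAlgMap_bijective (J := J) (Φ := Φ) (Ψ := Ψ) hW hbij
  have hNW := isNicholsHopfIdeal_nicholsIdeal Ψ W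
  have hNV := isNicholsHopfIdeal_nicholsIdeal Φ V
  refine le_antisymm (le_sSup ⟨hNW.isHopfIdeal.map hφ hB.isGraded hA.isGraded hp hφb.2,
    ?_, ?_, ?_⟩) ?_
  · rintro n _ ⟨b, hb, rfl⟩
    rw [← tensorAlgMap_tComp]
    exact Submodule.mem_map_of_mem (hNW.graded n b hb)
  · rintro _ ⟨b, hb, rfl⟩
    rw [← tensorAlgMap_tComp, hNW.comp_zero b hb, map_zero]
  · rintro _ ⟨b, hb, rfl⟩
    rw [← tensorAlgMap_tComp, hNW.comp_one b hb, map_zero]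
  · intro x hx
    obtain ⟨b, rfl⟩ := hφb.2 x
    refine Submodule.mem_map_of_mem ?_
    let K : Submodule k (tensorAlgObj Ψ W).carrier :=
      (nicholsIdeal Φ V).comap (tensorAlgMap J Φ Ψ f)
    have hz : ∀ n, (∀ x ∈ nicholsIdeal Φ V, tComp Φ V n x = 0) →
        ∀ x ∈ homogSpan (tensorAlgObj Ψ W) K, tComp Ψ W n x = 0 := by
      intro n hn
      refine homogSpan_le (Q := LinearMap.ker (tComp Ψ W n)) fun h b hb => ?_
      have h1 : tComp Ψ W n b = 0 := by
        refine hφb.1 ?_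
        rw [tensorAlgMap_tComp, map_zero]
        exact hn _ hb
      rw [LinearMap.mem_ker, tComp_proj, h1, map_zero]
    have hK : IsNicholsHopfIdeal Ψ W (homogSpan (tensorAlgObj Ψ W) K) := by
      refine ⟨hNV.isHopfIdeal.homogSpan_comap hφ hB hφb, fun n => ?_, hz 0 hNV.comp_zero,
        hz 1 hNV.comp_one⟩
      refine homogSpan_le (Q := (homogSpan (tensorAlgObj Ψ W) K).comap (tComp Ψ W n))
        fun h b hb => ?_
      rw [Submodule.mem_comap, tComp_proj]
      refine proj_mem_homogSpan h ?_
      change tensorAlgMap J Φ Ψ f (tComp Ψ W n b) ∈ nicholsIdeal Φ V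
      rw [tensorAlgMap_tComp]
      exact hNV.graded n _ hb
    exact le_sSup (a := homogSpan (tensorAlgObj Ψ W) K) hK
      (le_homogSpan (isGraded_tensorAlgObj hW) K hx)

/-- A bijective twisted map of generating spaces induces an isomorphism of Nichols algebras that
respects the Hopf structures up to the cochain. -/
theorem IsTwistedMap.exists_nichols_equiv {W : YDModule Ψ} {V : YDModule Φ}
    {f : W.carrier →ₗ[k] V.carrier} (hf : IsTwistedMap p J W.toYDData V.toYDData f)
    (hΨ : IsTwistedPullback p J Φ Ψ) (hJ : ∀ g, J g 1 = 1 ∧ J 1 g = 1)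
    (hp : Function.Surjective p) (hbij : Function.Bijective f) :
    ∃ F : (nichols W).carrier ≃ₗ[k] (nichols V).carrier,
      IsTwistedHopfMap p J (nichols W) (nichols V) F.toLinearMap ∧
        ∀ w, F (nicholsGen W w) = nicholsGen V (f w) := by
  have hW := W.isYD.isGraded
  have hV := V.isYD.isGraded
  have hφb := tensorAlgMap_bijective (J := J) (Φ := Φ) (Ψ := Ψ) hW hbij
  have hmap := hf.map_nicholsIdeal hW hV hΨ hJ hp hbij
  have hle := Submodule.map_le_iff_le_comap.mp hmap.le
  refine ⟨Submodule.Quotient.equiv _ _ (LinearEquiv.ofBijective _ hφb) hmap,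
    (hf.isTwistedHopfMap hW hV hΨ hJ).quotient (isGraded_tensorAlgObj hW)
      (isNicholsHopfIdeal_nicholsIdeal Ψ W.toYDData).isHopfIdeal
      (isNicholsHopfIdeal_nicholsIdeal Φ V.toYDData).isHopfIdeal hle, fun w => ?_⟩
  exact congrArg (nicholsIdeal Φ V.toYDData).mkQ (tensorAlgMap_tGen hW hJ w)

end Nichols

/-! ### Untwisting a Yetter-Drinfeld module over a coboundary -/

section Untwist

variable {k : Type u} [Field k] {H : Type w} [CommGroup H] [Fintype H] [DecidableEq H]
  {J : H → H → kˣ} {Ψ : H → H → H → kˣ}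

/-- For `Ψ = ∂J`, the ordinary Yetter-Drinfeld module with the coaction of `U` and the action
`x ▷' u = J(h, x) / J(x, h) x ▷ u` for `u` of degree `h`. -/
def YDModule.untwist (U : YDModule Ψ) (J : H → H → kˣ) (hΨ : ∀ e f g, Ψ e f g = coboundary J e f g)
    (hJ : ∀ g, J g 1 = 1 ∧ J 1 g = 1) : YDModule (fun _ _ _ => 1 : H → H → H → kˣ) where
  carrier := U.carrier
  proj := U.proj
  act x := ∑ h : H, ((J h x / J x h : kˣ) : k) • (U.act x ∘ₗ U.proj h)
  isYD := by
    have hU := U.isYD.isGraded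
    have hact : ∀ (x h : H) (v : U.carrier), U.IsHomogeneous h v →
        (∑ h : H, ((J h x / J x h : kˣ) : k) • (U.act x ∘ₗ U.proj h)) v =
          ((J h x / J x h : kˣ) : k) • U.act x v := by
      intro x h v hv
      simp only [LinearMap.sum_apply, LinearMap.smul_apply, LinearMap.comp_apply]
      rw [Finset.sum_eq_single h]
      · rw [hv.eq]
      · intro l _ hl
        rw [hU.proj_apply hv, if_neg hl, map_zero, smul_zero]
      · simp
    refine ⟨hU.proj_proj, hU.sum_proj, ?_, ?_, ?_⟩
    · intro g x v
      simp only [LinearMap.sum_apply, LinearMap.smul_apply, LinearMap.comp_apply, map_sum, map_smul]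
      refine Finset.sum_congr rfl fun h _ => ?_
      rw [hU.proj_act, hU.proj_proj, hU.proj_proj]
      by_cases hgh : g = h
      · rw [if_pos hgh, if_pos hgh.symm, hgh]
      · rw [if_neg hgh, if_neg (Ne.symm hgh)]
    · intro v
      simp only [(hJ _).1, (hJ _).2, div_one, Units.val_one, one_smul, LinearMap.sum_apply,
        LinearMap.comp_apply, U.isYD.one_act]
      exact hU.sum_proj v
    · intro g e f v hv
      have hΨ' : tilde Ψ g e f = tilde (coboundary J) g e f := by
        rw [tilde, tilde, hΨ, hΨ, hΨ]
      have key := congrArg Units.val (tilde_coboundary J g e f)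
      dsimp only
      rw [hact f g v hv, map_smul, hact e g _ (hU.homog_act f hv), hact (e * f) g v hv,
        U.isYD.act_act g e f v hv, smul_smul, smul_smul, smul_smul, hΨ']
      congr 1
      simp only [tilde, mul_one, div_one, Units.val_one, one_mul]
      rw [← key]
      push_cast [tilde]
      ring

theorem YDModule.isTwistedMap_untwist (U : YDModule Ψ)
    (hΨ : ∀ e f g, Ψ e f g = coboundary J e f g) (hJ : ∀ g, J g 1 = 1 ∧ J 1 g = 1) :
    IsTwistedMap (MonoidHom.id H) J U.toYDData (U.untwist J hΨ hJ).toYDData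
      (LinearMap.id : U.carrier →ₗ[k] U.carrier) where
  map_homog _ _ hw := hw
  map_act x h v hv := by
    have hU := U.isYD.isGraded
    change U.act x v = ((J x h / J h x : kˣ) : k) •
      (∑ l : H, ((J l x / J x l : kˣ) : k) • (U.act x ∘ₗ U.proj l)) v
    simp only [LinearMap.sum_apply, LinearMap.smul_apply, LinearMap.comp_apply]
    rw [Finset.sum_eq_single h]
    · rw [hv.eq, smul_smul, ← Units.val_mul]
      simp
    · intro l _ hl
      rw [hU.proj_apply hv, if_neg hl, map_zero, smul_zero]
    · simp

end Untwist

/-! ### Consequences of a map of Hopf algebras up to a cochain -/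

section Consequences

variable {k : Type u} [Field k] {G : Type v} [CommGroup G] [Fintype G] [DecidableEq G]
  {H : Type w} [CommGroup H] [Fintype H] [DecidableEq H]
  {p : H →* G} {J : H → H → kˣ}

theorem cochainScale_one {B : YDData k H} (hB : IsGraded B) (X : B.carrier ⊗[k] B.carrier) :
    cochainScale 1 B B X = X := by
  refine hB.tensor_induction_on hB (P := fun X => cochainScale 1 B B X = X) ?_ ?_ ?_ X
  · rw [map_zero]
  · intro X Y hX hY
    rw [map_add, hX, hY]
  · intro g h a b ha hb
    rw [cochainScale_tmul hB hB ha hb]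
    simp

theorem IsTwistedHopfMap.map_mul_of_one {B : HopfData k H} {A : HopfData k G}
    {φ : B.carrier →ₗ[k] A.carrier} (hφ : IsTwistedHopfMap p 1 B A φ) (hB : IsGraded B.toYDData)
    (a b : B.carrier) : φ (B.mul a b) = A.mul (φ a) (φ b) := by
  refine hB.induction_on (P := fun a => φ (B.mul a b) = A.mul (φ a) (φ b)) ?_ ?_ ?_ a
  · simp only [map_zero, LinearMap.zero_apply]
  · intro a a' h h'
    simp only [map_add, LinearMap.add_apply, h, h']
  intro g a ha
  refine hB.induction_on (P := fun b => φ (B.mul a b) = A.mul (φ a) (φ b)) ?_ ?_ ?_ b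
  · simp only [map_zero]
  · intro b b' h h'
    simp only [map_add, h, h']
  intro h b hb
  rw [hφ.map_mul g h a b ha hb]
  simp

/-- A bijective map of Hopf algebras `B → A` up to `J`, over the same group, is an isomorphism of
`A^J` with `B`. -/
theorem IsTwistedHopfMap.nonempty_hopfIso {B A : HopfData k H} (F : B.carrier ≃ₗ[k] A.carrier)
    (hF : IsTwistedHopfMap (MonoidHom.id H) J B A F.toLinearMap) (hB : IsGraded B.toYDData)
    (hA : IsGraded A.toYDData) : Nonempty (HopfIso (A.twist J) B) := by
  have hproj : ∀ g b, A.proj g (F b) = F (B.proj g b) := by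
    intro g b
    conv_lhs => rw [← hB.sum_proj b]
    rw [map_sum, map_sum, Finset.sum_eq_single g]
    · exact hF.map_homog g _ (hB.homog_proj g b)
    · intro l _ hl
      have := hA.proj_apply (hF.map_homog l _ (hB.homog_proj l b)) g
      rw [MonoidHom.id_apply, if_neg (Ne.symm hl)] at this
      exact this
    · simp
  have symm_proj : ∀ g x, F.symm (A.proj g x) = B.proj g (F.symm x) := by
    intro g x
    obtain ⟨b, rfl⟩ := F.surjective x
    rw [hproj, F.symm_apply_apply, F.symm_apply_apply]
  have symm_act : ∀ g x, F.symm ((∑ x : H, ((J g x / J x g : kˣ) : k) •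
      (A.act g ∘ₗ A.proj x)) x) = B.act g (F.symm x) := by
    intro g x
    obtain ⟨b, rfl⟩ := F.surjective x
    rw [F.symm_apply_eq, F.symm_apply_apply]
    conv_rhs => rw [← hB.sum_proj b]
    rw [map_sum, map_sum, LinearMap.sum_apply]
    refine Finset.sum_congr rfl fun h _ => ?_
    rw [LinearMap.smul_apply, LinearMap.comp_apply, hproj]
    exact (hF.map_act g h _ (hB.homog_proj h b)).symm
  have symm_mul : ∀ x y, F.symm ((∑ x : H, ∑ y : H, ((J x y : kˣ) : k) •
      A.mul.compl₁₂ (A.proj x) (A.proj y)) x y) = B.mul (F.symm x) (F.symm y) := by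
    intro x y
    obtain ⟨a, rfl⟩ := F.surjective x
    obtain ⟨b, rfl⟩ := F.surjective y
    rw [F.symm_apply_eq, F.symm_apply_apply, F.symm_apply_apply]
    conv_rhs => rw [← hB.sum_proj a, ← hB.sum_proj b]
    simp only [map_sum, LinearMap.sum_apply, LinearMap.smul_apply, LinearMap.compl₁₂_apply, hproj]
    rw [Finset.sum_comm]
    refine Finset.sum_congr rfl fun h _ => Finset.sum_congr rfl fun g _ => ?_
    exact (hF.map_mul g h _ _ (hB.homog_proj g a) (hB.homog_proj h b)).symm
  have symm_comul : ∀ x, TensorProduct.map F.symm.toLinearMap F.symm.toLinearMap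
      ((∑ x : H, ∑ y : H, (((J x y)⁻¹ : kˣ) : k) •
        (TensorProduct.map (A.proj x) (A.proj y) ∘ₗ A.comul)) x) = B.comul (F.symm x) := by
    intro x
    obtain ⟨b, rfl⟩ := F.surjective x
    have h1 : (∑ x : H, ∑ y : H, (((J x y)⁻¹ : kˣ) : k) •
        (TensorProduct.map (A.proj x) (A.proj y) ∘ₗ A.comul)) (F b) =
        cochainScale J⁻¹ A.toYDData A.toYDData (A.comul (F b)) := by
      simp only [cochainScale, LinearMap.sum_apply, LinearMap.smul_apply, LinearMap.comp_apply]
      rfl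
    have h2 : ∀ X, cochainScale J⁻¹ A.toYDData A.toYDData (TensorProduct.map F.toLinearMap
        F.toLinearMap X) = TensorProduct.map F.toLinearMap F.toLinearMap
          (cochainScale J⁻¹ B.toYDData B.toYDData X) := by
      intro X
      refine hB.tensor_induction_on hB (P := fun X =>
        cochainScale J⁻¹ A.toYDData A.toYDData (TensorProduct.map F.toLinearMap
          F.toLinearMap X) = TensorProduct.map F.toLinearMap F.toLinearMap
            (cochainScale J⁻¹ B.toYDData B.toYDData X)) ?_ ?_ ?_ X
      · simp only [map_zero]
      · intro X Y hX hY
        simp only [map_add, hX, hY]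
      · intro g h a b ha hb
        rw [cochainScale_tmul hB hB ha hb, map_smul, TensorProduct.map_tmul,
          cochainScale_tmul hA hA (hF.map_homog g a ha) (hF.map_homog h b hb)]
        rfl
    have h3 := hF.map_comul b
    rw [LinearEquiv.coe_coe] at h3
    have h4 : F.symm.toLinearMap ∘ₗ F.toLinearMap = LinearMap.id :=
      LinearMap.ext F.symm_apply_apply
    rw [h1, F.symm_apply_apply, ← h3, h2, cochainScale_inv hB hB, ← LinearMap.comp_apply,
      ← TensorProduct.map_comp, h4, TensorProduct.map_id, LinearMap.id_apply]
  have symm_counit : ∀ x, B.counit (F.symm x) = A.counit x := by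
    intro x
    obtain ⟨b, rfl⟩ := F.surjective x
    rw [F.symm_apply_apply]
    exact (hF.map_counit b).symm
  have symm_antipode : ∀ x, F.symm (A.antipode x) = B.antipode (F.symm x) := by
    intro x
    obtain ⟨b, rfl⟩ := F.surjective x
    rw [F.symm_apply_apply, F.symm_apply_eq]
    exact (hF.map_antipode b).symm
  exact ⟨⟨F.symm, symm_proj, symm_act, (F.symm_apply_eq).mpr hF.map_one.symm, symm_mul,
    symm_comul, symm_counit, symm_antipode⟩⟩

end Consequences

/-! ### Canonical bases -/

section CanonicalBasis

open Module Polynomial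

variable {k : Type u} [Field k] [IsAlgClosed k]

/-- Commuting semisimple operators over an algebraically closed field have a basis of joint
eigenvectors. -/
theorem exists_basis_joint_eigenvectors {M ι : Type*} [AddCommGroup M] [Module k M]
    [FiniteDimensional k M] (T : ι → End k M) (hT : ∀ i j, Commute (T i) (T j))
    (hs : ∀ i, (T i).IsSemisimple) :
    ∃ (l : ℕ) (X : Basis (Fin l) k M), ∀ j i, ∃ c : k, T i (X j) = c • X j := by
  have h1 := End.iSup_iInf_maxGenEigenspace_eq_top_of_iSup_maxGenEigenspace_eq_top_of_commute T
    (fun i j _ => hT i j) fun i => End.iSup_maxGenEigenspace_eq_top (T i)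
  let S : Set M := {v | ∀ i, ∃ c : k, T i v = c • v}
  have hS : ⊤ ≤ Submodule.span k S := by
    rw [← h1]
    refine iSup_le fun χ v hv => Submodule.subset_span fun i => ⟨χ i, ?_⟩
    have h2 := (Submodule.mem_iInf _).mp hv i
    rw [(hs i).isFinitelySemisimple.maxGenEigenspace_eq_eigenspace] at h2
    exact End.mem_eigenspace_iff.mp h2
  let b := Basis.ofSpan hS
  have := FiniteDimensional.fintypeBasisIndex b
  refine ⟨_, b.reindex (Fintype.equivFin _), fun j => ?_⟩
  exact Basis.ofSpan_subset hS ⟨_, (b.reindex_apply _ j).symm⟩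

variable [CharZero k] {H : Type w} [CommGroup H] [Fintype H] [DecidableEq H]

/-- Over an abelian group, the operators of an ordinary Yetter-Drinfeld module commute, the
action has finite order and the projections are idempotent, so all are diagonalizable. -/
theorem YDModule.exists_isCanonicalBasis (V : YDModule (fun _ _ _ => 1 : H → H → H → kˣ))
    [FiniteDimensional k V.carrier] :
    ∃ (l : ℕ) (X : Basis (Fin l) k V.carrier), IsCanonicalBasis V X := by
  have hV := V.isYD.isGraded
  have hact : ∀ e f v, V.act e (V.act f v) = V.act (e * f) v := by
    intro e f v
    rw [← hV.sum_proj v]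
    simp only [map_sum]
    refine Finset.sum_congr rfl fun g _ => ?_
    rw [V.isYD.act_act g e f _ (hV.homog_proj g v)]
    simp [tilde]
  have hpow : ∀ x (n : ℕ), (V.act x : End k V.carrier) ^ n = V.act (x ^ n) := by
    intro x n
    induction n with
    | zero =>
      rw [pow_zero, pow_zero]
      exact LinearMap.ext fun v => (V.isYD.one_act v).symm
    | succ n ih =>
      rw [pow_succ, pow_succ, ih]
      exact LinearMap.ext fun v => hact _ _ v
  let T : H ⊕ H → End k V.carrier := Sum.elim V.proj V.act
  obtain ⟨l, X, hX⟩ := exists_basis_joint_eigenvectors T (by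
    rintro (g | g) (h | h) <;> refine LinearMap.ext fun v => ?_
    · change V.proj g (V.proj h v) = V.proj h (V.proj g v)
      rw [hV.proj_proj, hV.proj_proj]
      by_cases hgh : g = h
      · rw [hgh]
      · rw [if_neg hgh, if_neg (Ne.symm hgh)]
    · exact hV.proj_act g h v
    · exact (hV.proj_act h g v).symm
    · change V.act g (V.act h v) = V.act h (V.act g v)
      rw [hact, hact, mul_comm]) (by
    rintro (g | g)
    · refine End.isSemisimple_of_squarefree_aeval_eq_zero (p := (X : k[X]) * (X - C 1)) ?_ ?_
      · refine (separable_X.mul separable_X_sub_C ⟨1, -1, ?_⟩).squarefree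
        rw [C_1]
        ring
      · refine LinearMap.ext fun v => ?_
        change (aeval (V.proj g : End k V.carrier) ((X : k[X]) * (X - C 1))) v = 0
        simp only [map_mul, map_sub, aeval_X, map_one, Module.End.mul_apply,
          LinearMap.sub_apply, Module.End.one_apply]
        rw [hV.proj_proj, if_pos rfl, sub_self]
    · refine End.isSemisimple_of_squarefree_aeval_eq_zero
        (p := (X : k[X]) ^ Fintype.card H - 1) ?_ ?_
      · exact (X_pow_sub_one_separable_iff.mpr
          (Nat.cast_ne_zero.mpr Fintype.card_ne_zero)).squarefree
      · refine LinearMap.ext fun v => ?_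
        change (aeval (V.act g : End k V.carrier) ((X : k[X]) ^ Fintype.card H - 1)) v = 0
        rw [map_sub, map_pow, aeval_X, map_one, hpow, pow_card_eq_one, LinearMap.sub_apply,
          Module.End.one_apply, V.isYD.one_act, sub_self])
  refine ⟨l, X, fun j => ⟨?_, fun x => hX j (.inr x)⟩⟩
  -- the eigenvalues of the projections are `0` or `1`, and some projection is nonzero on `X j`
  obtain ⟨g, hg⟩ : ∃ g, V.proj g (X j) ≠ 0 := by
    by_contra! h
    refine X.ne_zero j ?_
    rw [← hV.sum_proj (X j)]
    exact Finset.sum_eq_zero fun g _ => h g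
  obtain ⟨c, hc⟩ : ∃ c : k, V.proj g (X j) = c • X j := hX j (.inl g)
  have h2 := hV.homog_proj g (X j)
  rw [hc] at hg
  have hc0 : c ≠ 0 := fun h => hg (by rw [h, zero_smul])
  rw [hc, YDData.IsHomogeneous, map_smul] at h2
  exact ⟨g, smul_right_injective _ hc0 h2⟩

end CanonicalBasis

/-! ### Abelian standard cocycles and their pull-backs -/

section AbelianCocycle

variable {k : Type u} [Field k]

theorem IsAbelianCocycle.tilde_symm {G : Type v} [CommGroup G] [DecidableEq G]
    {Φ : G → G → G → kˣ} (h : IsAbelianCocycle Φ) (g x y : G) :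
    tilde Φ g x y = tilde Φ g y x := by
  have hθ : ∀ x y, theta Φ g x y = tilde Φ g x y := by
    intro x y
    have h1 : (x * y)⁻¹ * g * x * y = g := by
      rw [mul_assoc, mul_comm _ g, inv_mul_cancel_right]
    have h2 : x⁻¹ * g * x = g := by rw [mul_comm _ g, inv_mul_cancel_right]
    rw [theta, tilde, h1, h2]
  have hm : ∀ x y, doubleMul Φ (Finsupp.single (g, x) (1 : k)) (Finsupp.single (g, y) 1) =
      Finsupp.single (g, x * y) ((tilde Φ g x y : kˣ) : k) := by
    intro x y
    simp [doubleMul, hθ]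
  have h3 := h (Finsupp.single (g, x) 1) (Finsupp.single (g, y) 1)
  rw [hm, hm, mul_comm y x] at h3
  exact Units.ext (Finsupp.single_injective _ h3)

variable {n : ℕ} {m : Fin n → ℕ} [∀ i, NeZero (m i)]

/-- The generator `𝕘_i`. -/
def generator (m : Fin n → ℕ) (i : Fin n) : AbGroup m :=
  Pi.mulSingle i (Multiplicative.ofAdd 1)

theorem expo_lt (x : AbGroup m) (i : Fin n) : expo x i < m i := ZMod.val_lt _

theorem expo_generator_of_ne {i j : Fin n} (h : j ≠ i) : expo (generator m i) j = 0 := by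
  simp [expo, generator, Pi.mulSingle_eq_of_ne h]

theorem expo_generator_self {i : Fin n} (h : 1 < m i) : expo (generator m i) i = 1 := by
  have : Fact (1 < m i) := ⟨h⟩
  simp [expo, generator, ZMod.val_one]

theorem expo_generator_add_div {i j : Fin n} (h : i ≠ j) (l : Fin n) :
    (expo (generator m i) l + expo (generator m j) l) / m l = 0 := by
  refine Nat.div_eq_of_lt ?_
  by_cases hl : l = i
  · rw [expo_generator_of_ne (i := j) (hl.trans_ne h), add_zero]
    exact expo_lt _ _
  · rw [expo_generator_of_ne hl, zero_add]
    exact expo_lt _ _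

theorem stdCocycle_generator (ζ : ℕ → kˣ) (a : CocycleIndex m) {r s t : Fin n} (hr : 1 < m r)
    (hs : 1 < m s) (ht : 1 < m t) (hrs : r ≠ s) :
    stdCocycle ζ m a (generator m t) (generator m s) (generator m r) =
      if r < s ∧ s < t then
        (ζ (Nat.gcd (m r) (Nat.gcd (m s) (m t))) ^ a.three r s t)⁻¹ else 1 := by
  unfold stdCocycle
  simp only [expo_generator_add_div hrs.symm, mul_zero, pow_zero, ite_self, Finset.prod_const_one,
    one_mul]
  rw [Finset.prod_eq_single r, Finset.prod_eq_single s, Finset.prod_eq_single t]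
  · rw [expo_generator_self hr, expo_generator_self hs, expo_generator_self ht, mul_one, mul_one,
      mul_one]
  · intro j _ hj
    rw [expo_generator_of_ne hj]
    simp
  · simp
  · intro j _ hj
    refine Finset.prod_eq_one fun l _ => ?_
    rw [expo_generator_of_ne hj]
    simp
  · simp
  · intro j _ hj
    refine Finset.prod_eq_one fun l _ => Finset.prod_eq_one fun l' _ => ?_
    rw [expo_generator_of_ne hj]
    simp
  · simp

/-- For an abelian standard cocycle, symmetry of `Φ̃` at three distinct generators forces the
trilinear part to be trivial. -/
theorem three_eq_zero_of_isAbelian {ζ : ℕ → kˣ} (hζ : ∀ t : ℕ, 0 < t → IsPrimitiveRoot (ζ t) t)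
    {a : CocycleIndex m} (hΦ : IsAbelianCocycle (stdCocycle ζ m a)) {r s t : Fin n} (hrs : r < s)
    (hst : s < t) : a.three r s t = 0 := by
  have hlt := a.three_lt r s t hrs hst
  set d := Nat.gcd (m r) (Nat.gcd (m s) (m t)) with hd
  rcases Nat.lt_or_ge 1 d with h1 | h1
  · have hdr : d ∣ m r := Nat.gcd_dvd_left _ _
    have hds : d ∣ m s := (Nat.gcd_dvd_right _ _).trans (Nat.gcd_dvd_left _ _)
    have hdt : d ∣ m t := (Nat.gcd_dvd_right _ _).trans (Nat.gcd_dvd_right _ _)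
    have hr := h1.trans_le (Nat.le_of_dvd (NeZero.pos _) hdr)
    have hs := h1.trans_le (Nat.le_of_dvd (NeZero.pos _) hds)
    have ht := h1.trans_le (Nat.le_of_dvd (NeZero.pos _) hdt)
    have key := hΦ.tilde_symm (generator m t) (generator m s) (generator m r)
    unfold tilde at key
    rw [stdCocycle_generator ζ a hr hs ht hrs.ne, stdCocycle_generator ζ a ht hr hs
      (hrs.trans hst).ne', stdCocycle_generator ζ a hr ht hs (hrs.trans hst).ne,
      stdCocycle_generator ζ a hs hr ht hrs.ne', stdCocycle_generator ζ a ht hs hr hst.ne',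
      stdCocycle_generator ζ a hs ht hr hst.ne, if_pos ⟨hrs, hst⟩,
      if_neg (fun h => h.1.not_gt (hrs.trans hst)), if_neg (fun h => h.2.not_gt hst),
      if_neg (fun h => h.1.not_gt hrs), if_neg (fun h => h.1.not_gt hst),
      if_neg (fun h => h.2.not_gt (hrs.trans hst)), mul_one, div_one, mul_one, div_one,
      inv_eq_one] at key
    exact Nat.eq_zero_of_dvd_of_lt ((hζ d (zero_lt_one.trans h1)).dvd_of_pow_eq_one _ key) hlt
  · omega

theorem expo_canonicalProj (x : AbGroup (fun i => m i ^ 2)) (i : Fin n) :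
    expo (canonicalProj m x) i = expo x i % m i := by
  have h : (ZMod.castHom (dvd_pow_self (m i) two_ne_zero) (ZMod (m i))
      (Multiplicative.toAdd (x i))).val = (Multiplicative.toAdd (x i)).val % m i := by
    rw [ZMod.castHom_apply, ZMod.cast_eq_val, ZMod.val_natCast]
  exact h

theorem expo_mul {m : Fin n → ℕ} [∀ i, NeZero (m i)] (x y : AbGroup m) (i : Fin n) :
    expo (x * y) i = (expo x i + expo y i) % m i := ZMod.val_add _ _

theorem expo_one (i : Fin n) : expo (1 : AbGroup m) i = 0 := by
  simp [expo]

theorem zpow_eq_zpow_of_dvd {ω : kˣ} {N : ℕ} (hω : ω ^ N = 1) {a b : ℤ} (h : (N : ℤ) ∣ a - b) :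
    ω ^ a = ω ^ b := by
  obtain ⟨c, hc⟩ := h
  rw [show a = N * c + b by linarith, zpow_add, zpow_mul, zpow_natCast, hω, one_zpow, one_mul]

end AbelianCocycle

section PullbackTrivial

variable {k : Type u} [Field k] [IsAlgClosed k] {n : ℕ} {m : Fin n → ℕ} [∀ i, NeZero (m i)]

theorem coboundary_prod {G ι : Type*} [CommGroup G] (S : Finset ι) (J : ι → G → G → kˣ)
    (e f g : G) :
    coboundary (fun x y => ∏ i ∈ S, J i x y) e f g = ∏ i ∈ S, coboundary (J i) e f g := by
  simp only [coboundary, Finset.prod_mul_distrib, Finset.prod_div_distrib]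

/-- Solvability of `y b² ≡ c b a` modulo `a²`: the square of `gcd(a, b)` divides `b a`. -/
theorem exists_int_dvd (a b c : ℕ) : ∃ y : ℤ, ((a : ℤ) ^ 2) ∣ y * b ^ 2 - c * b * a := by
  have hdvd : ((Int.gcd ((b : ℤ) ^ 2) ((a : ℤ) ^ 2) : ℕ) : ℤ) ∣ (c * b * a : ℤ) := by
    have h1 : ((Int.gcd ((b : ℤ) ^ 2) ((a : ℤ) ^ 2) : ℕ) : ℤ) = (Int.gcd b a : ℤ) ^ 2 := by
      rw [Int.pow_gcd_pow]
      push_cast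
      rfl
    rw [h1, pow_two, mul_assoc]
    exact (mul_dvd_mul (Int.gcd_dvd_left _ _) (Int.gcd_dvd_right _ _)).mul_left _
  obtain ⟨q, hq⟩ := hdvd
  refine ⟨q * Int.gcdA (b ^ 2) (a ^ 2), -(q * Int.gcdB (b ^ 2) (a ^ 2)), ?_⟩
  rw [hq, Int.gcd_eq_gcd_ab]
  ring

/-- Each factor `ζ_{m_t}^{c i_t [(j_s + k_s) / m_s]}` of a standard cocycle becomes a coboundary
on `∏ ℤ_{m_i²}`. With `ω ^ m_t = ζ_{m_t}`, the cochain is `ω` to the power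
`x_t (c m_t [y_s / m_s] - b y_s)`: it is additive in `x`, the first term produces the carry modulo
`m_s`, and `b` is chosen so that the two wrap-arounds modulo `m_s²` cancel. -/
theorem exists_coboundary_pair (ζ : ℕ → kˣ) (hζ : ∀ t : ℕ, 0 < t → IsPrimitiveRoot (ζ t) t)
    (s t : Fin n) (c : ℕ) :
    ∃ J : AbGroup (fun i => m i ^ 2) → AbGroup (fun i => m i ^ 2) → kˣ,
      (∀ g, J g 1 = 1 ∧ J 1 g = 1) ∧ ∀ e f g, coboundary J e f g =
        ζ (m t) ^ (c * expo (canonicalProj m e) t *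
          ((expo (canonicalProj m f) s + expo (canonicalProj m g) s) / m s)) := by
  obtain ⟨z, hz⟩ := IsAlgClosed.exists_pow_nat_eq ((ζ (m t) : kˣ) : k) (NeZero.pos (m t))
  have hz0 : z ≠ 0 := by
    rintro rfl
    rw [zero_pow (NeZero.ne _)] at hz
    exact (ζ (m t)).ne_zero hz.symm
  set ω : kˣ := Units.mk0 z hz0 with hω
  have hωt : ω ^ m t = ζ (m t) := by
    ext
    rw [Units.val_pow_eq_pow_val, hω, Units.val_mk0, hz]
  have hω1 : ω ^ (m t ^ 2) = 1 := by
    rw [pow_two, pow_mul, hωt, (hζ _ (NeZero.pos _)).pow_eq_one]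
  obtain ⟨b, hb⟩ := exists_int_dvd (m t) (m s) c
  let E : AbGroup (fun i => m i ^ 2) → ℤ := fun y =>
    c * m t * ((expo y s / m s : ℕ) : ℤ) - b * expo y s
  refine ⟨fun x y => ω ^ ((expo x t : ℤ) * E y), fun g => ⟨?_, ?_⟩, fun e f g => ?_⟩
  · simp [E, expo_one]
  · simp [expo_one]
  · have hs0 : 0 < m s := NeZero.pos _
    simp only [coboundary]
    rw [← zpow_add, ← zpow_add, div_eq_mul_inv, ← zpow_sub, ← hωt, ← pow_mul, ← zpow_natCast]
    refine zpow_eq_zpow_of_dvd hω1 ?_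
    rw [expo_mul e f t, expo_canonicalProj, expo_canonicalProj, expo_canonicalProj]
    have he := Nat.mod_add_div (expo e t + expo f t) (m t ^ 2)
    have het := Nat.mod_add_div (expo e t) (m t)
    have hfg : expo (f * g) s + m s ^ 2 * ((expo f s + expo g s) / m s ^ 2) =
        expo f s + expo g s := by
      rw [expo_mul f g s]
      exact Nat.mod_add_div _ _
    have hsum : (expo f s + expo g s) / m s = expo f s / m s + expo g s / m s +
        (expo f s % m s + expo g s % m s) / m s := by
      rw [Nat.add_div hs0]
      congr 1
      have h3 := Nat.mod_lt (expo f s) hs0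
      have h4 := Nat.mod_lt (expo g s) hs0
      split_ifs with h2
      · symm
        rw [Nat.div_eq_iff hs0]
        omega
      · symm
        exact Nat.div_eq_of_lt (by omega)
    have hq : expo (f * g) s / m s + m s * ((expo f s + expo g s) / m s ^ 2) =
        expo f s / m s + expo g s / m s + (expo f s % m s + expo g s % m s) / m s := by
      rw [← hsum, ← Nat.add_mul_div_left _ _ hs0, ← mul_assoc, ← pow_two, hfg]
    obtain ⟨d, hd⟩ := hb
    simp only [E]
    -- `w` is the wrap-around modulo `m_s²`, `r` the carry modulo `m_s`
    generalize (expo f s + expo g s) / m s ^ 2 = w at hfg hq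
    generalize (expo f s % m s + expo g s % m s) / m s = r at hq ⊢
    generalize (expo e t + expo f t) % m t ^ 2 = x at he ⊢
    generalize (expo e t + expo f t) / m t ^ 2 = v at he
    generalize expo e t % m t = x' at het ⊢
    generalize expo e t / m t = v' at het
    generalize expo (f * g) s / m s = q at hq ⊢
    generalize expo f s / m s = q₁ at hq ⊢
    generalize expo g s / m s = q₂ at hq ⊢
    zify at he het hfg hq
    refine ⟨v * (c * m t * q₂ - b * expo g s) + expo e t * w * d + c * v' * r, ?_⟩
    push_cast
    linear_combination -(c * m t * q₂ - b * expo g s : ℤ) * he +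
      (expo e t * c * m t : ℤ) * hq - expo e t * b * hfg - (m t * c * r : ℤ) * het +
      (expo e t : ℤ) * w * hd

/-- The pull-back of an abelian standard cocycle to `∏ ℤ_{m_i²}` is a coboundary. -/
theorem exists_coboundary_eq_pullback (ζ : ℕ → kˣ)
    (hζ : ∀ t : ℕ, 0 < t → IsPrimitiveRoot (ζ t) t) (a : CocycleIndex m)
    (hΦ : IsAbelianCocycle (stdCocycle ζ m a)) :
    ∃ J : AbGroup (fun i => m i ^ 2) → AbGroup (fun i => m i ^ 2) → kˣ,
      (∀ g, J g 1 = 1 ∧ J 1 g = 1) ∧ ∀ e f g,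
        pullbackCochain (canonicalProj m) (stdCocycle ζ m a) e f g = coboundary J e f g := by
  choose J hJ1 hJ using exists_coboundary_pair (m := m) ζ hζ
  refine ⟨fun x y => ∏ s, ∏ t, if s = t then J s t (a.one t) x y else
    if s < t then J s t (a.two s t) x y else 1, fun g => ⟨?_, ?_⟩, fun e f g => ?_⟩
  · simp [hJ1]
  · simp [hJ1]
  · rw [coboundary_prod]
    simp_rw [coboundary_prod]
    have h3 : ∀ x y z : AbGroup m, (∏ r, ∏ s, ∏ t, if r < s ∧ s < t then
        (ζ (Nat.gcd (m r) (Nat.gcd (m s) (m t))) ^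
          (a.three r s t * expo z r * expo y s * expo x t))⁻¹ else 1 : kˣ) = 1 := by
      intro x y z
      refine Finset.prod_eq_one fun r _ => Finset.prod_eq_one fun s _ =>
        Finset.prod_eq_one fun t _ => ?_
      split_ifs with h
      · rw [three_eq_zero_of_isAbelian hζ hΦ h.1 h.2]
        simp
      · rfl
    unfold pullbackCochain stdCocycle
    rw [h3, mul_one, ← Finset.prod_mul_distrib]
    refine Finset.prod_congr rfl fun s _ => ?_
    have hdiag : ∀ F : Fin n → kˣ, F s = ∏ t, if s = t then F t else 1 := by
      intro F
      rw [Finset.prod_ite_eq, if_pos (Finset.mem_univ s)]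
    rw [hdiag (fun l => ζ (m l) ^ (a.one l * expo (canonicalProj m e) l *
      ((expo (canonicalProj m f) l + expo (canonicalProj m g) l) / m l))),
      ← Finset.prod_mul_distrib]
    refine Finset.prod_congr rfl fun t _ => ?_
    by_cases hst : s = t
    · subst hst
      simp [hJ]
    · by_cases hlt : s < t
      · simp [hst, hlt, hJ]
      · simp [hst, hlt, coboundary]

end PullbackTrivial

/-! ### Comparison of a module with its pull-back -/

section PullbackModule

variable {k : Type u} [Field k] {G : Type v} [CommGroup G] [Fintype G] [DecidableEq G]
  {H : Type w} [CommGroup H] [Fintype H] [DecidableEq H] {Φ : G → G → G → kˣ}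
  (V : YDModule Φ) (π : H →* G) (ι : G → H) (hι : ∀ g, π (ι g) = g)

theorem YDModule.homog_of_pullback {h : H} {v : V.carrier}
    (hv : (V.pullback π ι hι).IsHomogeneous h v) : V.IsHomogeneous (π h) v := by
  have h1 : (∑ g : G, if ι g = h then V.proj g else 0) v = v := hv
  rw [LinearMap.sum_apply, Finset.sum_eq_single (π h)] at h1
  · split_ifs at h1 with h2
    · exact h1
    · have : v = 0 := h1.symm
      rw [this]
      exact .zero _ _
  · intro g _ hg
    rw [if_neg, LinearMap.zero_apply]
    rintro rfl
    exact hg (hι g).symm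
  · simp

theorem YDModule.isTwistedMap_pullback :
    IsTwistedMap π 1 (V.pullback π ι hι).toYDData V.toYDData
      (LinearMap.id : V.carrier →ₗ[k] V.carrier) where
  map_homog _ _ hw := V.homog_of_pullback π ι hι hw
  map_act x h w _ := by
    simp only [Pi.one_apply, div_one, Units.val_one, one_smul]
    rfl

/-- A module and its pull-back have isomorphic Nichols algebras, as soon as the pull-back has a
canonical basis. -/
theorem YDModule.nicholsIsomorphic_pullback {l : ℕ} (X : Module.Basis (Fin l) k V.carrier)
    (hX : IsCanonicalBasis (V.pullback π ι hι) X) :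
    NicholsIsomorphic V (V.pullback π ι hι) := by
  have hp : Function.Surjective π := fun g => ⟨ι g, hι g⟩
  obtain ⟨F, hF, hgen⟩ := (V.isTwistedMap_pullback π ι hι).exists_nichols_equiv (Φ := Φ)
    (Ψ := pullbackCochain π Φ) (fun e f g => by simp [pullbackCochain, coboundary])
    (fun g => ⟨rfl, rfl⟩) hp Function.bijective_id
  have hB : IsGraded (nichols (V.pullback π ι hι)).toYDData :=
    isGraded_quotient (isGraded_tensorAlgObj (V.pullback π ι hι).isYD.isGraded) _
  have hmul := hF.map_mul_of_one hB
  refine ⟨l, X, X, fun i => ⟨?_, fun x => ?_⟩, hX, F.symm, fun α => ?_, fun x y => ?_, fun x => ?_⟩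
  · obtain ⟨h, hh⟩ := (hX i).1
    exact ⟨π h, V.homog_of_pullback π ι hι hh⟩
  · obtain ⟨c, hc⟩ := (hX i).2 (ι x)
    refine ⟨c, ?_⟩
    rw [← hι x]
    exact hc
  · have hmon : ∀ (s : List (Fin l)) (b : (nichols (V.pullback π ι hι)).carrier),
        F (s.foldl (fun t i => (nichols (V.pullback π ι hι)).mul t
          (nicholsGen (V.pullback π ι hι) (X i))) b) =
        s.foldl (fun t i => (nichols V).mul t (nicholsGen V (X i))) (F b) := by
      intro s
      induction s with
      | nil => exact fun b => rfl
      | cons i s ih =>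
        intro b
        rw [List.foldl_cons, List.foldl_cons, ih]
        congr 1
        exact (hmul _ _).trans (congrArg _ (hgen (X i)))
    have hone : F (nichols (V.pullback π ι hι)).one = (nichols V).one := hF.map_one
    have hmap : (nicholsComponent (V.pullback π ι hι) X α).map F.toLinearMap =
        nicholsComponent V X α := by
      unfold nicholsComponent
      rw [Submodule.map_span]
      congr 1
      ext y
      constructor
      · rintro ⟨_, ⟨s, hs, rfl⟩, rfl⟩
        exact ⟨s, hs, (hmon s _).trans (by rw [hone])⟩
      · rintro ⟨s, hs, rfl⟩
        exact ⟨_, ⟨s, hs, rfl⟩, (hmon s _).trans (by rw [hone])⟩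
    rw [← hmap, ← Submodule.map_comp]
    have : F.symm.toLinearMap ∘ₗ F.toLinearMap = LinearMap.id :=
      LinearMap.ext F.symm_apply_apply
    rw [this, Submodule.map_id]
  · obtain ⟨a, rfl⟩ := F.surjective x
    obtain ⟨b, rfl⟩ := F.surjective y
    have h1 : F ((nichols (V.pullback π ι hι)).mul a b) = (nichols V).mul (F a) (F b) := hmul a b
    rw [← h1, F.symm_apply_apply, F.symm_apply_apply, F.symm_apply_apply]
  · obtain ⟨b, rfl⟩ := F.surjective x
    have h1 : TensorProduct.map F.toLinearMap F.toLinearMap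
        (cochainScale 1 (nichols (V.pullback π ι hι)).toYDData
          (nichols (V.pullback π ι hι)).toYDData ((nichols (V.pullback π ι hι)).comul b)) =
        (nichols V).comul (F b) := hF.map_comul b
    have h2 : F.symm.toLinearMap ∘ₗ F.toLinearMap = LinearMap.id :=
      LinearMap.ext F.symm_apply_apply
    rw [cochainScale_one hB] at h1
    rw [← h1, F.symm_apply_apply, ← LinearMap.comp_apply, ← TensorProduct.map_comp, h2,
      TensorProduct.map_id, LinearMap.id_apply]

end PullbackModule

section TrivialTwist

variable {k : Type u} [Field k] {H : Type w} [CommGroup H] [Fintype H] [DecidableEq H]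
  {J : H → H → kˣ} {Ψ : H → H → H → kˣ}

/-- Over a coboundary, the Nichols algebra of `U` is the twist of the Nichols algebra of the
untwisted module. -/
theorem YDModule.twistEquivalent_untwist (U : YDModule Ψ)
    (hΨ : ∀ e f g, Ψ e f g = coboundary J e f g) (hJ : ∀ g, J g 1 = 1 ∧ J 1 g = 1) :
    TwistEquivalent (fun _ _ _ => 1) (nichols (U.untwist J hΨ hJ)) Ψ (nichols U) := by
  obtain ⟨F, hF, -⟩ := (U.isTwistedMap_untwist hΨ hJ).exists_nichols_equiv
    (Φ := fun _ _ _ => 1) (Ψ := Ψ) (fun e f g => by rw [hΨ, one_mul]) hJ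
    Function.surjective_id Function.bijective_id
  exact ⟨J, hJ, fun e f g => by rw [hΨ, one_mul], hF.nonempty_hopfIso F
    (isGraded_quotient (isGraded_tensorAlgObj U.isYD.isGraded) _)
    (isGraded_quotient (isGraded_tensorAlgObj (U.untwist J hΨ hJ).isYD.isGraded) _)⟩

/-- A canonical basis of the untwisted module is one of the module itself, since the actions
differ by scalars on homogeneous elements. -/
theorem YDModule.isCanonicalBasis_of_untwist (U : YDModule Ψ)
    (hΨ : ∀ e f g, Ψ e f g = coboundary J e f g) (hJ : ∀ g, J g 1 = 1 ∧ J 1 g = 1) {l : ℕ}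
    {X : Module.Basis (Fin l) k U.carrier} (hX : IsCanonicalBasis (U.untwist J hΨ hJ) X) :
    IsCanonicalBasis U X := by
  intro i
  obtain ⟨⟨h, hh⟩, hx⟩ := hX i
  refine ⟨⟨h, hh⟩, fun x => ?_⟩
  obtain ⟨c, hc⟩ := hx x
  refine ⟨((J x h / J h x : kˣ) : k) * c, ?_⟩
  refine ((U.isTwistedMap_untwist hΨ hJ).map_act x h (X i) hh).trans ?_
  rw [mul_smul]
  exact congrArg (((J x h / J h x : kˣ) : k) • ·) hc

end TrivialTwist

end TwistedYD

end


open TwistedYD in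
theorem proposition4p5 {k : Type u} [Field k] [IsAlgClosed k] [CharZero k]
    (ζ : ℕ → kˣ) (hζ : ∀ t : ℕ, 0 < t → IsPrimitiveRoot (ζ t) t)
    {n : ℕ} (m : Fin n → ℕ) [∀ i, NeZero (m i)] (a : CocycleIndex m)
    (hΦ : IsAbelianCocycle (stdCocycle ζ m a))
    (V : YDModule (stdCocycle ζ m a)) [FiniteDimensional k V.carrier] :
    NicholsIsomorphic V
        (V.pullback (canonicalProj m) (canonicalSection m) (canonicalProj_section m)) ∧
      ∃ V' : YDModule (fun _ _ _ => 1 :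
          AbGroup (fun i => m i ^ 2) → AbGroup (fun i => m i ^ 2) →
            AbGroup (fun i => m i ^ 2) → kˣ),
        TwistEquivalent (fun _ _ _ => 1) (nichols V')
          (pullbackCochain (canonicalProj m) (stdCocycle ζ m a))
          (nichols (V.pullback (canonicalProj m) (canonicalSection m)
            (canonicalProj_section m))) := by
  obtain ⟨J, hJ, hΨ⟩ := exists_coboundary_eq_pullback ζ hζ a hΦ
  let U := V.pullback (canonicalProj m) (canonicalSection m) (canonicalProj_section m)
  have : FiniteDimensional k (U.untwist J hΨ hJ).carrier :=
    inferInstanceAs (FiniteDimensional k V.carrier)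
  obtain ⟨l, X, hX⟩ := (U.untwist J hΨ hJ).exists_isCanonicalBasis
  exact ⟨V.nicholsIsomorphic_pullback _ _ _ X (U.isCanonicalBasis_of_untwist hΨ hJ hX),
    U.untwist J hΨ hJ, U.twistEquivalent_untwist hΨ hJ⟩
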